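/- **Invariance of $\mathcal T$-shapedness.** Fix an infinite set of names and a finite forest $\mathcal T$ of base types; for $s,t\in\mathcal T$ write $s<t$ if $s$ is a proper ancestor of $t$. Types are $\tau ::= t \mid t[\tau]$ with $t\in\mathcal T$, and $\mathrm{base}(t)=\mathrm{base}(t[\tau])=t$. We consider $\pi$-calculus terms with annotated restrictions $$P ::= \mathbf 0 \mid \nu(x{:}\tau).P \mid P\parallel P \mid M \mid {!M},\qquad M ::= M+M \mid \pi.P,\qquad \pi ::= a(x)\mid \bar a\langle b\rangle \mid \boldsymbol\tau .$$ Structural congruence $\equiv$ is the least congruence that contains $\alpha$-conversion, commutativity and associativity of $+$ and $\parallel$, $P\parallel\mathbf 0\equiv P$, $\nu(x{:}\tau).\mathbf 0\equiv\mathbf 0$, exchange of restrictions, ${!M}\equiv M\parallel{!M}$, and $P\parallel\nu(x{:}\tau).Q\equiv\nu(x{:}\tau).(P\parallel Q)$ for $x\notin\mathrm{fn}(P)$; it never changes annotations. Terms $M$ and $!M$ are called sequential. A normal form is a term $N ::= \nu X.(A_1\parallel\cdots\parallel A_m)$, with $A_i$ of the form $\sum_j\pi_j.N_j$ or $!\sum_j\pi_j.N_j$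 (nonempty sums; $X$ a finite sequence of annotated names; $X$ and $m$ may be empty), in which every name is bound at most once and no name is both free and bound. *Reduction.* $P\to Q$ if one of the following holds, where $S',R',C,P'$ are finite (possibly empty) parallel compositions of sequential terms: (i) $P\equiv\nu W.(S\parallel R\parallel C)$, the latter a normal form, where $S$ is $\bar a\langle b\rangle.\nu Y_s.S'$ or $\bar a\langle b\rangle.\nu Y_s.S'+M_s$, $R$ is $a(x).\nu Y_r.R'$ or $a(x).\nu Y_r.R'+M_r$, and $Q\equiv\nu W Y_s Y_r.(S'\parallel R'\{x\mapsto b\}\parallel C)$; (ii) $P\equiv\nu W.(\boldsymbol\tau.\nu Y.P'\parallel C)$, the latter a normal form, and $Q\equiv\nu WY.(P'\parallel C)$. Annotations in $W,Y_s,Y_r,Y$ are kept. *$\mathcal T$-shapedness.* The forest of a term is defined by: $\mathrm{forest}(\mathbf 0)$ is empty; $\mathrm{forest}(A)$ is a single node labelled $A$ for $A$ sequential; $\mathrm{forest}(\nu(x{:}\tau).P)$ is $\mathrm{forest}(P)$ under a new root labelled $(x,\mathrm{base}(\tau))$; $\mathrm{forest}(P\parallel Q)$ is the disjoint union. $P$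 is $\mathcal T$-compatible if there is $Q\equiv P$ such that for every path of $\mathrm{forest}(Q)$ (from a node downwards) with labels $(x_1,t_1)\cdots(x_k,t_k)\,A$ we have $t_1<\dots<t_k$. $P$ is $\mathcal T$-shaped if all its subterms (including those under prefixes) are $\mathcal T$-compatible. *Typing.* Let $P=\nu X.(A_1\parallel\cdots\parallel A_m)$ be a normal form. $A_i$ and $A_j$ are linked if they have a common free name in $X$; tied-to is the reflexive and transitive closure of linked; a name $y$ is tied to $A_i$ in $P$ if $y\in\mathrm{fn}(A_j)$ for some $A_j$ tied to $A_i$; and $A_i$ is migratable in $a(x).P$ if $x$ is tied to $A_i$ in $P$. An environment $\Gamma$ is a partial map from names to types; $\Gamma,X$ is its extension by the assignments in $X$; for a set $Y$ of names and $t\in\mathcal T$, $\mathrm{base}(\Gamma(Y))<t$ means $\mathrm{base}(\Gamma(y))<t$ for all $y\in Y\cap\mathrm{dom}(\Gamma)$. The judgement $\Gamma\vdash P$ is defined inductively: - $\Gamma\vdash\nu X.(A_1\parallel\cdots\parallel A_m)$ if $\Gamma,X\vdash A_i$ for all $i$, and $\mathrm{base}(\Gamma(\mathrm{fn}(A_i)\setminus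 X))<\mathrm{base}(\tau)$ whenever $(x{:}\tau)\in X$ and $x$ is tied to $A_i$ in this term; - $\Gamma\vdash M+M'$ if $\Gamma\vdash M$ and $\Gamma\vdash M'$; $\Gamma\vdash{!M}$ if $\Gamma\vdash M$; $\Gamma\vdash\boldsymbol\tau.P$ if $\Gamma\vdash P$; - $\Gamma\vdash\bar a\langle b\rangle.P$ if $\Gamma(a)=t[\tau]$, $\Gamma(b)=\tau$ and $\Gamma\vdash P$ for some $t,\tau$; - $\Gamma\vdash a(x).P$, with $P=\nu X.(A_1\parallel\cdots\parallel A_m)$, if for some $t,\tau$: $\Gamma(a)=t[\tau]$, $(\Gamma,x{:}\tau)\vdash P$, and either $\mathrm{base}(\tau)<t$ or $\mathrm{base}(\Gamma(\mathrm{fn}(A_i)\setminus(X\cup\{x,a\})))<t$ for every $A_i$ migratable in $a(x).P$. $\Gamma$ is $P$-safe if $\mathrm{base}(\Gamma(x))<\mathrm{base}(\tau)$ for every $x\in\mathrm{fn}(P)\cap\mathrm{dom}(\Gamma)$ and every restriction $\nu(y{:}\tau)$ occurring anywhere in $P$. **Theorem.** Let $P$ be a normal form and let $\Gamma$ be a $P$-safe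 environment with $\Gamma\vdash P$. Suppose that $P$ is $\mathcal T$-shaped. Then every normal form $Q$ with $P\to Q$ is $\mathcal T$-shaped. Moreover, every term $Q$ with $P\to^*Q$ is $\mathcal T$-shaped. -/

import Mathlib

namespace HierPi

universe u v w

/-! ## Annotated terms -/

/-- Prefixes: input `a(x)`, output `a<b>` and the silent action. -/
inductive Prefix (N : Type u) where
  | inp (a x : N)
  | out (a b : N)
  | tau

mutual
/-- Pi-calculus terms over the names `N`; every restriction carries an annotation in `H`. -/
inductive Proc (N : Type u) (H : Type v) : Type (max u v) where
  | nil
  | res (x : N) (τ : H) (P : Proc N H)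
  | par (P Q : Proc N H)
  | sum (M : Choice N H)
  | bang (M : Choice N H)
/-- Choices: nonempty sums of prefixed terms. -/
inductive Choice (N : Type u) (H : Type v) : Type (max u v) where
  | pre (π : Prefix N) (P : Proc N H)
  | plus (M M' : Choice N H)
end

/-- Sequential terms: `M` or `!M`. -/
inductive SeqTerm (N : Type u) (H : Type v) where
  | once (M : Choice N H)
  | repl (M : Choice N H)

section Terms

variable {N : Type u} {H : Type v}

/-- A sequential term seen as a term. -/
def SeqTerm.toProc : SeqTerm N H → Proc N H
  | .once M => .sum M
  | .repl M => .bang M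

/-- `ν X. P` for a list `X` of annotated names. -/
def news : List (N × H) → Proc N H → Proc N H
  | [], P => P
  | (x, τ) :: X, P => .res x τ (news X P)

/-- The parallel composition of a list of sequential terms; it is `0` for the empty list. -/
def prod : List (SeqTerm N H) → Proc N H
  | [] => .nil
  | [A] => A.toProc
  | A :: B :: As => .par A.toProc (prod (B :: As))

/-- The term `ν X. (A₁ ∥ ⋯ ∥ Aₘ)`. -/
def nform (X : List (N × H)) (As : List (SeqTerm N H)) : Proc N H := news X (prod As)

/-- The active restrictions, i.e. those that are not under a prefix. For a normal form
`ν X. (A₁ ∥ ⋯ ∥ Aₘ)` this is `X`. -/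
def Proc.actRes : Proc N H → List (N × H)
  | .nil => []
  | .res x τ P => (x, τ) :: P.actRes
  | .par P Q => P.actRes ++ Q.actRes
  | .sum _ => []
  | .bang _ => []

/-- The active sequential subterms. For a normal form `ν X. (A₁ ∥ ⋯ ∥ Aₘ)` this is
`[A₁, …, Aₘ]`. -/
def Proc.actSeq : Proc N H → List (SeqTerm N H)
  | .nil => []
  | .res _ _ P => P.actSeq
  | .par P Q => P.actSeq ++ Q.actSeq
  | .sum M => [.once M]
  | .bang M => [.repl M]

mutual
/-- All restrictions in a term, active or not, with multiplicity. -/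
def Proc.allRes : Proc N H → List (N × H)
  | .nil => []
  | .res x τ P => (x, τ) :: P.allRes
  | .par P Q => P.allRes ++ Q.allRes
  | .sum M => M.allRes
  | .bang M => M.allRes
/-- All restrictions in a choice. -/
def Choice.allRes : Choice N H → List (N × H)
  | .pre _ P => P.allRes
  | .plus M M' => M.allRes ++ M'.allRes
end

mutual
/-- All bound names of a term (bound by a restriction or by an input), with multiplicity. -/
def Proc.bn : Proc N H → List N
  | .nil => []
  | .res x _ P => x :: P.bn
  | .par P Q => P.bn ++ Q.bn
  | .sum M => M.bn
  | .bang M => M.bn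
/-- All bound names of a choice. -/
def Choice.bn : Choice N H → List N
  | .pre (.inp _ x) P => x :: P.bn
  | .pre (.out _ _) P => P.bn
  | .pre .tau P => P.bn
  | .plus M M' => M.bn ++ M'.bn
end

mutual
/-- All subterms of a term, including the term itself and those under prefixes. -/
def Proc.subterms : Proc N H → List (Proc N H)
  | .nil => [.nil]
  | .res x τ P => .res x τ P :: P.subterms
  | .par P Q => .par P Q :: (P.subterms ++ Q.subterms)
  | .sum M => M.subterms
  | .bang M => .bang M :: M.subterms
/-- All subterms of a choice. -/
def Choice.subterms : Choice N H → List (Proc N H)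
  | .pre π P => .sum (.pre π P) :: P.subterms
  | .plus M M' => .sum (.plus M M') :: (M.subterms ++ M'.subterms)
end

/-- Apply `f` to the names of a prefix. -/
def Prefix.rename (f : N → N) : Prefix N → Prefix N
  | .inp a x => .inp (f a) (f x)
  | .out a b => .out (f a) (f b)
  | .tau => .tau

mutual
/-- Apply `f` to all names of a term, free or bound. It is only used with transpositions. -/
def Proc.rename (f : N → N) : Proc N H → Proc N H
  | .nil => .nil
  | .res x τ P => .res (f x) τ (P.rename f)
  | .par P Q => .par (P.rename f) (Q.rename f)
  | .sum M => .sum (M.rename f)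
  | .bang M => .bang (M.rename f)
/-- Apply `f` to all names of a choice. -/
def Choice.rename (f : N → N) : Choice N H → Choice N H
  | .pre π P => .pre (π.rename f) (P.rename f)
  | .plus M M' => .plus (M.rename f) (M'.rename f)
end

mutual
/-- The term is `A₁ ∥ ⋯ ∥ Aₘ` with `m ≥ 1`, bracketed in any way, where each `Aᵢ` is a choice or
a replicated choice whose continuations have the shape of a normal form. -/
def Proc.IsProd : Proc N H → Prop
  | .nil => False
  | .res _ _ _ => False
  | .par P Q => P.IsProd ∧ Q.IsProd
  | .sum M => M.HasNFShape
  | .bang M => M.HasNFShape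
/-- The term is derived from the grammar of normal forms: `ν x₁ ⋯ ν xₙ. (A₁ ∥ ⋯ ∥ Aₘ)`, where
`n` and `m` may be `0`. -/
def Proc.HasNFShape : Proc N H → Prop
  | .nil => True
  | .res _ _ P => P.HasNFShape
  | .par P Q => P.IsProd ∧ Q.IsProd
  | .sum M => M.HasNFShape
  | .bang M => M.HasNFShape
/-- All continuations of the choice have the shape of a normal form. -/
def Choice.HasNFShape : Choice N H → Prop
  | .pre _ P => P.HasNFShape
  | .plus M M' => M.HasNFShape ∧ M'.HasNFShape
end

end Terms

section Names

variable {N : Type u} {H : Type v} [DecidableEq N]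

mutual
/-- The free names of a term. -/
def Proc.fn : Proc N H → Finset N
  | .nil => ∅
  | .res x _ P => P.fn.erase x
  | .par P Q => P.fn ∪ Q.fn
  | .sum M => M.fn
  | .bang M => M.fn
/-- The free names of a choice. -/
def Choice.fn : Choice N H → Finset N
  | .pre (.inp a x) P => insert a (P.fn.erase x)
  | .pre (.out a b) P => insert a (insert b P.fn)
  | .pre .tau P => P.fn
  | .plus M M' => M.fn ∪ M'.fn
end

/-- The free names of a sequential term. -/
def SeqTerm.fn : SeqTerm N H → Finset N
  | .once M => M.fn
  | .repl M => M.fn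

/-- Every name is bound at most once, and no name is both free and bound. -/
def Proc.NameUniq (P : Proc N H) : Prop :=
  P.bn.Nodup ∧ ∀ x ∈ P.fn, x ∉ P.bn

/-- Normal forms. -/
def Proc.IsNF (P : Proc N H) : Prop := P.HasNFShape ∧ P.NameUniq

/-- The name `y` with `x` replaced by `b`. -/
def substName (x b y : N) : N := if y = x then b else y

mutual
/-- `P{x ↦ b}`: replace the free occurrences of `x` by `b`. It is only used where `b` is not bound
in `P`, so that no capture can occur. -/
def Proc.subst (x b : N) : Proc N H → Proc N H
  | .nil => .nil
  | .res y τ P => .res y τ (if y = x then P else P.subst x b)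
  | .par P Q => .par (P.subst x b) (Q.subst x b)
  | .sum M => .sum (M.subst x b)
  | .bang M => .bang (M.subst x b)
/-- Substitution in a choice. -/
def Choice.subst (x b : N) : Choice N H → Choice N H
  | .pre (.inp a y) P => .pre (.inp (substName x b a) y) (if y = x then P else P.subst x b)
  | .pre (.out a c) P => .pre (.out (substName x b a) (substName x b c)) (P.subst x b)
  | .pre .tau P => .pre .tau (P.subst x b)
  | .plus M M' => .plus (M.subst x b) (M'.subst x b)
end

/-- Substitution in a sequential term. -/
def SeqTerm.subst (x b : N) : SeqTerm N H → SeqTerm N H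
  | .once M => .once (M.subst x b)
  | .repl M => .repl (M.subst x b)

/-! ## Structural congruence and reduction -/

mutual
/-- Structural congruence. `alpha` is alpha-conversion of a restriction, written with the
transposition of the old and the new bound name; annotations are never changed. The law `exch`
is for distinct names, as `ν a. ν a. P` would bind a name twice. -/
inductive Proc.Cong : Proc N H → Proc N H → Prop where
  | refl (P) : Proc.Cong P P
  | symm {P Q} : Proc.Cong P Q → Proc.Cong Q P
  | trans {P Q R} : Proc.Cong P Q → Proc.Cong Q R → Proc.Cong P R
  | res (x τ) {P P'} : Proc.Cong P P' → Proc.Cong (.res x τ P) (.res x τ P')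
  | par {P P' Q Q'} : Proc.Cong P P' → Proc.Cong Q Q' → Proc.Cong (.par P Q) (.par P' Q')
  | sum {M M'} : Choice.Cong M M' → Proc.Cong (.sum M) (.sum M')
  | bang {M M'} : Choice.Cong M M' → Proc.Cong (.bang M) (.bang M')
  | alpha (x y τ P) : y ∉ P.fn →
      Proc.Cong (.res x τ P) (.res y τ (P.rename (Equiv.swap x y)))
  | par_comm (P Q) : Proc.Cong (.par P Q) (.par Q P)
  | par_assoc (P Q R) : Proc.Cong (.par (.par P Q) R) (.par P (.par Q R))
  | par_nil (P) : Proc.Cong (.par P .nil) P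
  | res_nil (x τ) : Proc.Cong (.res x τ .nil) .nil
  | exch (x τ y σ P) : x ≠ y → Proc.Cong (.res x τ (.res y σ P)) (.res y σ (.res x τ P))
  | unfold (M) : Proc.Cong (.bang M) (.par (.sum M) (.bang M))
  | extrude (P x τ Q) : x ∉ P.fn →
      Proc.Cong (.par P (.res x τ Q)) (.res x τ (.par P Q))
/-- Structural congruence of choices. -/
inductive Choice.Cong : Choice N H → Choice N H → Prop where
  | refl (M) : Choice.Cong M M
  | symm {M M'} : Choice.Cong M M' → Choice.Cong M' M
  | trans {M M' M''} : Choice.Cong M M' → Choice.Cong M' M'' → Choice.Cong M M''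
  | pre (π) {P P'} : Proc.Cong P P' → Choice.Cong (.pre π P) (.pre π P')
  | plus {M M' L L'} : Choice.Cong M M' → Choice.Cong L L' →
      Choice.Cong (.plus M L) (.plus M' L')
  | alpha (a x y P) : y ∉ P.fn →
      Choice.Cong (.pre (.inp a x) P) (.pre (.inp a y) (P.rename (Equiv.swap x y)))
  | plus_comm (M M') : Choice.Cong (.plus M M') (.plus M' M)
  | plus_assoc (M M' M'') :
      Choice.Cong (.plus (.plus M M') M'') (.plus M (.plus M' M''))
end

/-- The choice is `π.P` or `π.P + M`. -/
inductive Choice.Offers (π : Prefix N) (P : Proc N H) : Choice N H → Prop where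
  | alone : Choice.Offers π P (.pre π P)
  | plus (M) : Choice.Offers π P (.plus (.pre π P) M)

/-- Reduction of annotated terms; the restrictions that become active keep their annotations. -/
inductive Proc.Step : Proc N H → Proc N H → Prop where
  | sync {P Q : Proc N H} (W Ys Yr : List (N × H)) (S R : Choice N H)
      (S' R' C : List (SeqTerm N H)) (a b x : N) :
      Proc.Cong P (nform W (.once S :: .once R :: C)) →
      (nform W (.once S :: .once R :: C)).IsNF →
      Choice.Offers (.out a b) (nform Ys S') S →
      Choice.Offers (.inp a x) (nform Yr R') R →
      Proc.Cong Q (nform (W ++ Ys ++ Yr) (S' ++ R'.map (SeqTerm.subst x b) ++ C)) →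
      Proc.Step P Q
  | tau {P Q : Proc N H} (W Y : List (N × H)) (P' C : List (SeqTerm N H)) :
      Proc.Cong P (nform W (.once (.pre .tau (nform Y P')) :: C)) →
      (nform W (.once (.pre .tau (nform Y P')) :: C)).IsNF →
      Proc.Cong Q (nform (W ++ Y) (P' ++ C)) →
      Proc.Step P Q

/-- `Q` is reachable from `P`. -/
def Proc.Reach (P Q : Proc N H) : Prop := Relation.ReflTransGen Proc.Step P Q

end Names

/-! ## Hierarchies, forest representation, compatibility -/

/-- The relation `parent s t` (`s` is the parent of `t`) makes `T` a forest. -/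
structure IsForest {T : Type w} (parent : T → T → Prop) : Prop where
  parent_unique : ∀ s s' t, parent s t → parent s' t → s = s'
  acyclic : ∀ t, ¬ Relation.TransGen parent t t

/-- Labelled forests, generated by the empty forest, adding a root, and disjoint union. -/
inductive LForest (L : Type u) where
  | empty
  | node (l : L) (φ : LForest L)
  | union (φ ψ : LForest L)

/-- The traces (label sequences) of the nonempty paths that start in a root. -/
inductive LForest.RootTrace {L : Type u} : LForest L → List L → Prop where
  | single (l φ) : LForest.RootTrace (.node l φ) [l]
  | cons (l) {φ s} : LForest.RootTrace φ s → LForest.RootTrace (.node l φ) (l :: s)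
  | left {φ s} (ψ) : LForest.RootTrace φ s → LForest.RootTrace (.union φ ψ) s
  | right (φ) {ψ s} : LForest.RootTrace ψ s → LForest.RootTrace (.union φ ψ) s

/-- The traces of all nonempty paths. -/
inductive LForest.Trace {L : Type u} : LForest L → List L → Prop where
  | root {φ s} : LForest.RootTrace φ s → LForest.Trace φ s
  | under (l) {φ s} : LForest.Trace φ s → LForest.Trace (.node l φ) s
  | left {φ s} (ψ) : LForest.Trace φ s → LForest.Trace (.union φ ψ) s
  | right (φ) {ψ s} : LForest.Trace ψ s → LForest.Trace (.union φ ψ) s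

section Compat

variable {N : Type u} {H : Type v} {T : Type w}

/-- The forest of a term: inner nodes are active restrictions, labelled with the name and its base
type; leaves are the active sequential subterms. -/
def Proc.forest (base : H → T) : Proc N H → LForest ((N × T) ⊕ SeqTerm N H)
  | .nil => .empty
  | .res x τ P => .node (.inl (x, base τ)) (P.forest base)
  | .par P Q => .union (P.forest base) (Q.forest base)
  | .sum M => .node (.inr (.once M)) .empty
  | .bang M => .node (.inr (.repl M)) .empty

/-- Compatibility of a forest: along every trace `(x₁, t₁) ⋯ (xₖ, tₖ) A` one has
`t₁ < ⋯ < tₖ`. -/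
def ForestCompat (lt : T → T → Prop) (φ : LForest ((N × T) ⊕ SeqTerm N H)) : Prop :=
  ∀ (s : List (N × T)) (A : SeqTerm N H),
    φ.Trace (s.map Sum.inl ++ [Sum.inr A]) → (s.map Prod.snd).IsChain lt

/-- Compatibility of a term: some structurally congruent term has a compatible forest. -/
def Proc.TCompat [DecidableEq N] (base : H → T) (lt : T → T → Prop) (P : Proc N H) : Prop :=
  ∃ Q, Proc.Cong Q P ∧ ForestCompat lt (Q.forest base)

/-- A term is `T`-shaped if each of its subterms is `T`-compatible. -/
def Proc.TShaped [DecidableEq N] (base : H → T) (lt : T → T → Prop) (P : Proc N H) : Prop :=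
  ∀ Q ∈ P.subterms, Q.TCompat base lt

end Compat

/-! ## Linked, tied, migratable -/

section Tied

variable {N : Type u} {H : Type v} [DecidableEq N]

/-- The active restricted names of a term. -/
def Proc.actNames (P : Proc N H) : Finset N := (P.actRes.map Prod.fst).toFinset

/-- Active sequential terms `A`, `B` of `P` are linked if they share a name restricted at the top
of `P`. Components are referred to by the term rather than by an index: all relations here depend
only on free names, so equal components need not be told apart. -/
def Proc.Linked (P : Proc N H) (A B : SeqTerm N H) : Prop :=
  A ∈ P.actSeq ∧ B ∈ P.actSeq ∧ ∃ x ∈ P.actNames, x ∈ A.fn ∧ x ∈ B.fn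

/-- `A` is tied to `B` in `P`: the reflexive and transitive closure of `Linked`. -/
def Proc.Tied (P : Proc N H) : SeqTerm N H → SeqTerm N H → Prop := Relation.ReflTransGen P.Linked

/-- The name `y` is tied to the component `A` in `P`. -/
def Proc.NameTied (P : Proc N H) (y : N) (A : SeqTerm N H) : Prop :=
  ∃ B ∈ P.actSeq, y ∈ B.fn ∧ P.Tied B A

/-- `A` is migratable in `a(x).P`. -/
def Migratable (x : N) (P : Proc N H) (A : SeqTerm N H) : Prop := P.NameTied x A

end Tied

/-! ## Types and typing -/

/-- Types `t` and `t[τ]` over the base types `T`. -/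
inductive HType (T : Type w) where
  | name (t : T)
  | chan (t : T) (τ : HType T)

/-- The base type of a type. -/
def HType.base {T : Type w} : HType T → T
  | .name t => t
  | .chan t _ => t

/-- Typing environments: partial maps from names to types. -/
abbrev Env (N : Type u) (T : Type w) := N → Option (HType T)

section Typing

variable {N : Type u} {T : Type w} [DecidableEq N]

/-- The environment `Γ, x : τ`. -/
def Env.bind (Γ : Env N T) (x : N) (τ : HType T) : Env N T := Function.update Γ x (some τ)

/-- The environment `Γ, X`. -/
def Env.binds (Γ : Env N T) : List (N × HType T) → Env N T
  | [] => Γ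
  | (x, τ) :: X => Env.binds (Env.bind Γ x τ) X

/-- All base types in `base (Γ (Y))` are smaller than `t`. -/
def Env.Below (lt : T → T → Prop) (Γ : Env N T) (Y : Finset N) (t : T) : Prop :=
  ∀ y ∈ Y, ∀ σ, Γ y = some σ → lt σ.base t

mutual
/-- `Γ ⊢ P` for normal forms. Names restricted at the top of `P` are removed from `fn A` in the
side condition since `Γ` is meant to assign types to the names of the context only (a name of the
domain of `Γ` that is bound in the term is shadowed). -/
inductive Typed (lt : T → T → Prop) : Env N T → Proc N (HType T) → Prop where
  | par {Γ : Env N T} {P : Proc N (HType T)} :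
      (∀ A ∈ P.actSeq, TypedSeq lt (Γ.binds P.actRes) A) →
      (∀ A ∈ P.actSeq, ∀ x τ, (x, τ) ∈ P.actRes → P.NameTied x A →
        Γ.Below lt (A.fn \ P.actNames) τ.base) →
      Typed lt Γ P
/-- `Γ ⊢ A` for sequential terms. -/
inductive TypedSeq (lt : T → T → Prop) : Env N T → SeqTerm N (HType T) → Prop where
  | once {Γ : Env N T} {M : Choice N (HType T)} :
      TypedChoice lt Γ M → TypedSeq lt Γ (.once M)
  | repl {Γ : Env N T} {M : Choice N (HType T)} :
      TypedChoice lt Γ M → TypedSeq lt Γ (.repl M)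
/-- `Γ ⊢ M` for choices. -/
inductive TypedChoice (lt : T → T → Prop) : Env N T → Choice N (HType T) → Prop where
  | plus {Γ : Env N T} {M M' : Choice N (HType T)} :
      TypedChoice lt Γ M → TypedChoice lt Γ M' → TypedChoice lt Γ (.plus M M')
  | tau {Γ : Env N T} {P : Proc N (HType T)} :
      Typed lt Γ P → TypedChoice lt Γ (.pre .tau P)
  | out {Γ : Env N T} {P : Proc N (HType T)} {a b : N} {t : T} {τ : HType T} :
      Γ a = some (.chan t τ) → Γ b = some τ → Typed lt Γ P →
      TypedChoice lt Γ (.pre (.out a b) P)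
  | inp {Γ : Env N T} {P : Proc N (HType T)} {a x : N} {t : T} {τ : HType T} :
      Γ a = some (.chan t τ) → Typed lt (Γ.bind x τ) P →
      (lt τ.base t ∨
        ∀ A ∈ P.actSeq, Migratable x P A →
          Γ.Below lt (((A.fn \ P.actNames).erase x).erase a) t) →
      TypedChoice lt Γ (.pre (.inp a x) P)
end

/-- `Γ` is `P`-safe. -/
def Env.Safe (lt : T → T → Prop) (Γ : Env N T) (P : Proc N (HType T)) : Prop :=
  ∀ x ∈ P.fn, ∀ y τ, (y, τ) ∈ P.allRes → ∀ σ, Γ x = some σ → lt σ.base τ.base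

end Typing

end HierPi

-- Compatibility asks for a congruent term with a good forest, which is hard to follow along
-- reductions. It is replaced by a property of the communication graph: the vertices are the active
-- restrictions that are used, labelled with base types, and every active sequential subterm is a
-- hyperedge on its free names. Up to the multiplicity of edges, this graph is invariant under
-- structural congruence. A term is compatible iff its graph satisfies `Hier`: adjacent labels are
-- comparable, and distinct vertices with the same label t are never joined by a path on which all
-- labels are at least t. In a compatible forest a root is smaller than everything below it, so it
-- separates what it has to (`ForestCompat.compat`). Conversely, a vertex x with a maximal label is
-- strictly larger than its neighbours. The subterms that use x are put under x and count as one
-- edge from then on; `Hier` survives because the neighbours of x were already connected through a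
-- larger vertex (`exists_forestCompat_of_hier`).
--
-- The typing conditions are also read off graphs. `Sat` extends them to arbitrary terms and
-- includes the compatibility of all continuations, so that the invariant `Proc.Inv` passes to
-- congruent terms (`Proc.Cong.similar`). The invariant also contains safety, but only for
-- restrictions that are used.
--
-- A reduction attaches continuations `ν Y. ∏ A` to the graph on the context names W; the edges of
-- the reacting terms may be kept at first, since deleting edges preserves `Hier`. By `Hier.graft`
-- it suffices that the new vertices are larger than the vertices of W they are tied to, which is
-- the side condition of the rule for `ν`, and that tied edges attach to W only at vertices which
-- may be joined by an edge anyway (`Sim`). For a silent step and for the sender these vertices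
-- already share the edge of the reacting term. In the receiver, substituting b for x may tie b to a
-- name n. Here b and a share the sender, n and a share the receiver, and the input rule gives n = a
-- or makes the label of b or of n smaller than that of a, so that the detour through a is high
-- enough (`Hier.sim_via`). If a is not restricted, safety puts its base type below every
-- restriction that is used, and no such restricted b and n exist.

namespace HierPi

universe u v w

open Relation

/-! ## Graphs with hierarchical labels -/

section Graph

variable {V : Type*} {V' : Type*} {T : Type*} {T' : Type*}

/-- `v` can be reached from `u` through vertices whose label is at least `t`. -/
def Reaches (lt : T → T → Prop) (ty : V → T) (adj : V → V → Prop) (t : T) : V → V → Prop :=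
  ReflTransGen fun u v => adj u v ∧ (t = ty v ∨ lt t (ty v))

/-- Adjacent vertices have comparable labels, and distinct vertices with the same label are
separated by vertices whose label is not larger. -/
structure Hier (lt : T → T → Prop) (ty : V → T) (adj : V → V → Prop) : Prop where
  comparable : ∀ u v, adj u v → lt (ty u) (ty v) ∨ ty u = ty v ∨ lt (ty v) (ty u)
  separated : ∀ u v, u ≠ v → ty u = ty v → ¬ Reaches lt ty adj (ty u) u v

/-- An edge between `u` and `v` can be added without destroying `Hier`. -/
def Sim (lt : T → T → Prop) (ty : V → T) (adj : V → V → Prop) (u v : V) : Prop :=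
  (lt (ty u) (ty v) ∨ ty u = ty v ∨ lt (ty v) (ty u)) ∧
    ∀ t, (t = ty u ∨ lt t (ty u)) → (t = ty v ∨ lt t (ty v)) → Reaches lt ty adj t u v

variable {lt : T → T → Prop} {ty : V → T} {adj adj' : V → V → Prop}

theorem Reaches.le {t : T} {u v : V} (h : Reaches lt ty adj t u v)
    (hu : t = ty u ∨ lt t (ty u)) : t = ty v ∨ lt t (ty v) := by
  cases h with
  | refl => exact hu
  | tail _ h => exact h.2

/-- Each edge of the path is replaced by a path of the other graph at the same level. The bound on
the label of `u` is needed because `Reaches` does not constrain the vertex where a path starts. -/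
theorem Reaches.of_sim (hs : ∀ u v, adj' u v → Sim lt ty adj u v) {t : T} {u v : V}
    (hu : t = ty u ∨ lt t (ty u)) (h : Reaches lt ty adj' t u v) : Reaches lt ty adj t u v := by
  induction h with
  | refl => exact .refl
  | tail _ h ih => exact ih.trans ((hs _ _ h.1).2 _ (ih.le hu) h.2)

/-- This covers both the deletion of edges and the merging of edges: an edge is harmless if its ends
were connected before, at every level that is below both labels. -/
theorem Hier.of_sim (h : Hier lt ty adj) (hs : ∀ u v, adj' u v → Sim lt ty adj u v) :
    Hier lt ty adj' where
  comparable u v huv := (hs u v huv).1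
  separated u v hne heq hr := h.separated u v hne heq (hr.of_sim hs (.inl rfl))

theorem Hier.sim (h : Hier lt ty adj) {u v : V} (huv : adj u v) : Sim lt ty adj u v :=
  ⟨h.comparable u v huv, fun _ _ hv => .single ⟨huv, hv⟩⟩

theorem Hier.mono (h : Hier lt ty adj) (hadj : ∀ u v, adj' u v → adj u v) : Hier lt ty adj' :=
  h.of_sim fun _ _ huv => h.sim (hadj _ _ huv)

/-- The properties of the ancestor relation of a forest that are used. -/
structure TreeOrder (lt : T → T → Prop) : Prop where
  trans : ∀ {a b c}, lt a b → lt b c → lt a c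
  irrefl : ∀ a, ¬ lt a a
  forest : ∀ {a b c}, lt a c → lt b c → lt a b ∨ a = b ∨ lt b a

theorem TreeOrder.not_le (h : TreeOrder lt) {a b : T} (hab : lt a b) (hba : b = a ∨ lt b a) :
    False := by
  rcases hba with rfl | hba
  · exact h.irrefl _ hab
  · exact h.irrefl _ (h.trans hab hba)

/-- A level below both ends is strictly below `a`, so the path through `a` is admissible. If both
ends are smaller than `a`, they are comparable since the labels form a forest; otherwise one end is
at least `a` and transitivity suffices. -/
theorem Hier.sim_via (hlt : TreeOrder lt) (h : Hier lt ty adj) {u a v : V} (hua : adj u a)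
    (hav : adj a v) (hl : lt (ty u) (ty a) ∨ lt (ty v) (ty a)) : Sim lt ty adj u v := by
  refine ⟨?_, fun t hu hv => ?_⟩
  · have h1 := h.comparable _ _ hua
    have h2 := h.comparable _ _ hav
    rcases hl with hl | hl
    · rcases h2 with h2 | h2 | h2
      · exact .inl (hlt.trans hl h2)
      · exact .inl (h2 ▸ hl)
      · exact hlt.forest hl h2
    · rcases h1 with h1 | h1 | h1
      · exact hlt.forest h1 hl
      · exact .inr (.inr (h1 ▸ hl))
      · exact .inr (.inr (hlt.trans hl h1))
  · have ha : lt t (ty a) := by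
      rcases hl with hl | hl
      · rcases hu with rfl | hu
        · exact hl
        · exact hlt.trans hu hl
      · rcases hv with rfl | hv
        · exact hl
        · exact hlt.trans hv hl
    exact (ReflTransGen.single ⟨hua, .inr ha⟩).tail ⟨hav, hv⟩

theorem Hier.comap {lt' : T' → T' → Prop} {ty' : V' → T'} {adj' : V' → V' → Prop}
    (h : Hier lt' ty' adj') (f : V → V') (hf : Function.Injective f) (g : T → T')
    (hg : Function.Injective g) (hlt : ∀ s t, lt' (g s) (g t) ↔ lt s t)
    (hty : ∀ v, ty' (f v) = g (ty v)) (hadj : ∀ u v, adj u v → adj' (f u) (f v)) :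
    Hier lt ty adj where
  comparable u v huv := by
    have := h.comparable _ _ (hadj u v huv)
    simpa only [hty, hlt, hg.eq_iff] using this
  separated u v hne heq hr := by
    refine h.separated (f u) (f v) (hf.ne hne) (by rw [hty, hty, heq]) ?_
    rw [hty]
    refine ReflTransGen.lift f (fun a b hab => ⟨hadj _ _ hab.1, ?_⟩) _ _ hr
    simpa only [hty, hlt, hg.eq_iff] using hab.2

theorem Hier.map {lt' : T' → T' → Prop} {ty' : V' → T'} {adj' : V' → V' → Prop}
    (h : Hier lt ty adj) (f : V → V') (hf : Function.Injective f) (g : T → T')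
    (hg : Function.Injective g) (hlt : ∀ s t, lt' (g s) (g t) ↔ lt s t)
    (hty : ∀ v, ty' (f v) = g (ty v))
    (hadj : ∀ a b, adj' a b → ∃ u v, f u = a ∧ f v = b ∧ adj u v) :
    Hier lt' ty' adj' where
  comparable a b hab := by
    obtain ⟨u, v, rfl, rfl, huv⟩ := hadj a b hab
    simpa only [hty, hlt, hg.eq_iff] using h.comparable u v huv
  separated a b hne heq hr := by
    -- Vertices outside the range of `f` are isolated, so only a nontrivial path is known to start
    -- in the range; hence the condition `a ≠ b`.
    have key : ∀ b, Reaches lt' ty' adj' (ty' a) a b → a ≠ b →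
        ∃ u v, f u = a ∧ f v = b ∧ Reaches lt ty adj (ty u) u v := by
      intro b hr
      induction hr with
      | refl => exact fun h => absurd rfl h
      | @tail b c _ hbc ih =>
        intro _
        obtain ⟨v, w, rfl, rfl, hvw⟩ := hadj _ _ hbc.1
        have hle := hbc.2
        by_cases hav : a = f v
        · subst hav
          refine ⟨v, w, rfl, rfl, .single ⟨hvw, ?_⟩⟩
          simpa only [hty, hlt, hg.eq_iff] using hle
        · obtain ⟨u, v', rfl, hv', hr⟩ := ih hav
          obtain rfl := hf hv'
          refine ⟨u, w, rfl, rfl, hr.tail ⟨hvw, ?_⟩⟩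
          simpa only [hty, hlt, hg.eq_iff] using hle
    obtain ⟨u, v, rfl, rfl, huv⟩ := key b hr hne
    refine h.separated u v (fun h => hne (h ▸ rfl)) ?_ huv
    simpa only [hty, hg.eq_iff] using heq

/-- Two members of a family of edges are tied if they are connected through shared vertices
in `Y`. -/
def EdgeTied {I : Type*} (mem : I → Prop) (inc : I → V → Prop) (Y : V → Prop) : I → I → Prop :=
  ReflTransGen fun i j => mem i ∧ mem j ∧ ∃ y, Y y ∧ inc i y ∧ inc j y

theorem EdgeTied.symm {I : Type*} {mem : I → Prop} {inc : I → V → Prop} {Y : V → Prop} {i j : I}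
    (h : EdgeTied mem inc Y i j) : EdgeTied mem inc Y j i := by
  induction h with
  | refl => exact .refl
  | tail _ h ih =>
    obtain ⟨h1, h2, y, h3, h4, h5⟩ := h
    exact .head ⟨h2, h1, y, h3, h5, h4⟩ ih

/-- The graph of a family of edges on a set of vertices. -/
def EdgeAdj {I : Type*} (mem : I → Prop) (inc : I → V → Prop) (Y : V → Prop) (u v : V) : Prop :=
  Y u ∧ Y v ∧ ∃ i, mem i ∧ inc i u ∧ inc i v

/-- New vertices `Y` and edges can be added to a graph on `W` if they are larger than the vertices
of `W` which they are tied to, and tied edges only join vertices of `W` that may be joined. -/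
theorem Hier.graft (hlt : TreeOrder lt) (h : Hier lt ty adj) {I : Type*} {mem : I → Prop}
    {inc : I → V → Prop} {W Y : V → Prop} (hW : ∀ u v, adj u v → W u ∧ W v)
    (hWY : ∀ v, W v → ¬ Y v)
    (hY : Hier lt ty (EdgeAdj mem inc Y))
    (habove : ∀ y i j w, Y y → mem i → inc i y → EdgeTied mem inc Y i j → mem j → inc j w → W w →
      lt (ty w) (ty y))
    (hsim : ∀ i j w w', mem i → mem j → EdgeTied mem inc Y i j → inc i w → W w → inc j w' →
      W w' → Sim lt ty adj w w') :
    Hier lt ty fun u v => adj u v ∨ EdgeAdj mem inc (fun v => W v ∨ Y v) u v where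
  comparable u v := by
    rintro (huv | ⟨hu, hv, i, hi, hiu, hiv⟩)
    · exact h.comparable u v huv
    · rcases hu with hu | hu <;> rcases hv with hv | hv
      · exact (hsim i i u v hi hi .refl hiu hu hiv hv).1
      · exact .inl (habove v i i u hv hi hiv .refl hi hiu hu)
      · exact .inr (.inr (habove u i i v hu hi hiu .refl hi hiv hv))
      · exact hY.comparable u v ⟨hu, hv, i, hi, hiu, hiv⟩
  separated u v hne heq hr := by
    by_cases hu : Y u
    -- A path at level `ty u` that starts in `Y` stays in `Y`. All its edges are tied to an edge at
    -- `u`, so a step into `W` would lead to a label strictly below `ty u`.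
    · have key : ∀ z, Reaches lt ty (fun u v => adj u v ∨ EdgeAdj mem inc (fun v => W v ∨ Y v) u v)
          (ty u) u z → Y z ∧ Reaches lt ty (EdgeAdj mem inc Y) (ty u) u z ∧
            ∀ j, mem j → inc j z → ∃ i, mem i ∧ inc i u ∧ EdgeTied mem inc Y i j := by
        intro z hz
        induction hz with
        | refl => exact ⟨hu, .refl, fun j hj hju => ⟨j, hj, hju, .refl⟩⟩
        | @tail z z' _ hz ih =>
          obtain ⟨hYz, hr, ht⟩ := ih
          obtain ⟨hz | ⟨_, hz', j, hj, hjz, hjz'⟩, hle⟩ := hz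
          · exact absurd hYz (hWY _ (hW _ _ hz).1)
          · obtain ⟨i, hi, hiu, hij⟩ := ht j hj hjz
            rcases hz' with hz' | hz'
            · exact (hlt.not_le (habove u i j z' hu hi hiu hij hj hjz' hz') hle).elim
            · refine ⟨hz', hr.tail ⟨⟨hYz, hz', j, hj, hjz, hjz'⟩, hle⟩, fun k hk hkz' => ?_⟩
              exact ⟨i, hi, hiu, hij.tail ⟨hj, hk, z', hz', hjz', hkz'⟩⟩
      exact hY.separated u v hne heq (key v hr).2.1
    -- An excursion into `Y` leaves `W` at some `w` and uses only edges that are tied to each other.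
    -- When it returns to `W`, `hsim` replaces it by a path of `adj`. The second disjunct describes
    -- an excursion that has not returned yet.
    · have key : ∀ z, Reaches lt ty (fun u v => adj u v ∨ EdgeAdj mem inc (fun v => W v ∨ Y v) u v)
          (ty u) u z → (¬ Y z ∧ Reaches lt ty adj (ty u) u z) ∨
            (Y z ∧ ∃ w i j, W w ∧ Reaches lt ty adj (ty u) u w ∧ mem i ∧ mem j ∧ inc i z ∧
              EdgeTied mem inc Y i j ∧ inc j w) := by
        intro z hz
        induction hz with
        | refl => exact .inl ⟨hu, .refl⟩
        | @tail z z' _ hz ih =>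
          obtain ⟨hz | ⟨hWz, hz', k, hk, hkz, hkz'⟩, hle⟩ := hz
          · have hW' := hW _ _ hz
            rcases ih with ⟨_, hr⟩ | ⟨hYz, _⟩
            · exact .inl ⟨hWY _ hW'.2, hr.tail ⟨hz, hle⟩⟩
            · exact absurd hYz (hWY _ hW'.1)
          · rcases ih with ⟨hYz, hr⟩ | ⟨hYz, w, i, j, hw, hr, hi, hj, hiz, hij, hjw⟩
            · have hWz := hWz.resolve_right hYz
              rcases hz' with hz' | hz'
              · exact .inl ⟨hWY _ hz', hr.trans ((hsim k k z z' hk hk .refl hkz hWz hkz' hz').2 _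
                  (hr.le (.inl rfl)) hle)⟩
              · exact .inr ⟨hz', z, k, k, hWz, hr, hk, hk, hkz', .refl, hkz⟩
            · have hkj : EdgeTied mem inc Y k j := .head ⟨hk, hi, z, hYz, hkz, hiz⟩ hij
              rcases hz' with hz' | hz'
              · refine .inl ⟨hWY _ hz', hr.trans ((hsim j k w z' hj hk ?_ hjw hw hkz' hz').2 _
                  (hr.le (.inl rfl)) hle)⟩
                exact hkj.symm
              · exact .inr ⟨hz', w, k, j, hw, hr, hk, hj, hkz', hkj, hjw⟩
      rcases key v hr with ⟨_, hr⟩ | ⟨hYv, w, i, j, hw, hr, hi, hj, hiv, hij, hjw⟩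
      · exact h.separated u v hne heq hr
      -- The path cannot end during an excursion: the label of `w` is at least `ty u = ty v`, but
      -- `w` is strictly below `v`.
      · exact hlt.not_le (habove v i j w hYv hi hiv hij hj hjw hw) (heq ▸ hr.le (.inl rfl))

/-- A relation on labels extended to optional labels. -/
def optLt (lt : T → T → Prop) (s t : Option T) : Prop := ∃ a b, s = some a ∧ t = some b ∧ lt a b

@[simp] theorem optLt_some {a b : T} : optLt lt (some a) (some b) ↔ lt a b := by
  simp [optLt]

theorem TreeOrder.option (h : TreeOrder lt) : TreeOrder (optLt lt) where
  trans := by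
    rintro _ _ _ ⟨a, b, rfl, rfl, hab⟩ ⟨_, c, ⟨⟩, rfl, hbc⟩
    exact ⟨_, _, rfl, rfl, h.trans hab hbc⟩
  irrefl := by
    rintro _ ⟨a, _, rfl, ⟨⟩, ha⟩
    exact h.irrefl a ha
  forest := by
    rintro _ _ _ ⟨a, c, rfl, rfl, hac⟩ ⟨b, _, rfl, ⟨⟩, hbc⟩
    simpa using h.forest hac hbc

/-- For comparability of two ancestors of `c`, the chain from `a` to `c` is retraced from its end:
as parents are unique, the chain from `b` runs through the same vertices until one of the two chains
stops. -/
theorem IsForest.treeOrder {parent : T → T → Prop} (h : IsForest parent) :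
    TreeOrder (TransGen parent) where
  trans := TransGen.trans
  irrefl := h.acyclic
  forest := by
    intro a b c hac hbc
    have key : ∀ {c}, TransGen parent b c → ∀ {d}, (parent d c) → b = d ∨ TransGen parent b d := by
      intro c hbc d hd
      cases hbc with
      | single h' => exact .inl (h.parent_unique _ _ _ h' hd)
      | tail hb h' => exact .inr (h.parent_unique _ _ _ h' hd ▸ hb)
    induction hac with
    | single hac =>
      rcases key hbc hac with rfl | h
      · exact .inr (.inl rfl)
      · exact .inr (.inr h)
    | tail had hdc ih =>
      rcases key hbc hdc with rfl | h
      · exact .inl had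
      · exact ih h

end Graph

/-! ## The communication graph of a term -/

/-- A hypergraph with labelled vertices whose edges are incident to names and to vertices. -/
structure HGraph (N : Type u) (T : Type w) where
  /-- The vertices. -/
  ι : Type
  /-- The label of a vertex. -/
  ty : ι → T
  /-- The edges. -/
  κ : Type
  /-- The names in an edge. -/
  nm : κ → N → Prop
  /-- The vertices in an edge. -/
  inc : κ → ι → Prop

namespace HGraph

variable {N : Type u} {T : Type w}

/-- The graph without edges and vertices. -/
def empty : HGraph N T := ⟨Empty, Empty.elim, Empty, Empty.elim, Empty.elim⟩

/-- The graph with one edge, which consists of names. -/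
def single (s : N → Prop) : HGraph N T := ⟨Empty, Empty.elim, Unit, fun _ => s, fun _ => Empty.elim⟩

/-- Disjoint union. -/
def par (G H : HGraph N T) : HGraph N T where
  ι := G.ι ⊕ H.ι
  ty := Sum.elim G.ty H.ty
  κ := G.κ ⊕ H.κ
  nm := Sum.elim G.nm H.nm
  inc := Sum.elim (fun k => Sum.elim (G.inc k) fun _ => False)
    (fun k => Sum.elim (fun _ => False) (H.inc k))

/-- The name occurs in an edge. -/
def HasName (G : HGraph N T) (x : N) : Prop := ∃ k, G.nm k x

/-- The name `x` becomes a vertex with label `t` if it occurs at all. -/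
def res (x : N) (t : T) (G : HGraph N T) : HGraph N T where
  ι := PLift (G.HasName x) ⊕ G.ι
  ty := Sum.elim (fun _ => t) G.ty
  κ := G.κ
  nm k y := G.nm k y ∧ y ≠ x
  inc k := Sum.elim (fun _ => G.nm k x) (G.inc k)

/-- The edge `l` of `H` is the image of the edge `k` of `G` if names are mapped by `f` and vertices
by `g`. -/
def EdgeMap {G H : HGraph N T} (f : N → N) (g : G.ι → H.ι) (k : G.κ) (l : H.κ) : Prop :=
  (∀ y, H.nm l y ↔ ∃ x, G.nm k x ∧ f x = y) ∧ ∀ i, H.inc l (g i) ↔ G.inc k i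

/-- `H` is isomorphic to `G` (up to the multiplicity of edges) with the names mapped by `f`. -/
def Iso (f : N → N) (G H : HGraph N T) : Prop :=
  ∃ g : G.ι ≃ H.ι, (∀ i, H.ty (g i) = G.ty i) ∧ (∀ k, ∃ l, EdgeMap f g k l) ∧
    ∀ l, ∃ k, EdgeMap f g k l

theorem Iso.refl (G : HGraph N T) : Iso id G G :=
  ⟨Equiv.refl _, fun _ => rfl, fun k => ⟨k, by simp [EdgeMap]⟩, fun k => ⟨k, by simp [EdgeMap]⟩⟩

theorem EdgeMap.trans {f f' : N → N} {G H K : HGraph N T} {g : G.ι → H.ι} {g' : H.ι → K.ι}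
    {k : G.κ} {l : H.κ} {m : K.κ} (h : EdgeMap f g k l) (h' : EdgeMap f' g' l m) :
    EdgeMap (f' ∘ f) (g' ∘ g) k m :=
  ⟨fun y => by simp [h'.1, h.1], fun i => (h'.2 _).trans (h.2 i)⟩

theorem Iso.trans {f f' : N → N} {G H K : HGraph N T} (h : Iso f G H) (h' : Iso f' H K) :
    Iso (f' ∘ f) G K := by
  obtain ⟨a, ha, h1, h2⟩ := h
  obtain ⟨b, hb, h1', h2'⟩ := h'
  refine ⟨a.trans b, fun i => by simp [ha, hb], fun k => ?_, fun m => ?_⟩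
  · obtain ⟨l, hl⟩ := h1 k
    obtain ⟨m, hm⟩ := h1' l
    exact ⟨m, hl.trans hm⟩
  · obtain ⟨l, hl⟩ := h2' m
    obtain ⟨k, hk⟩ := h2 l
    exact ⟨k, hk.trans hl⟩

theorem EdgeMap.symm {G H : HGraph N T} {g : G.ι ≃ H.ι} {k : G.κ} {l : H.κ}
    (h : EdgeMap id g k l) : EdgeMap id g.symm l k :=
  ⟨fun y => by simp [h.1], fun i => by simp [← h.2]⟩

theorem Iso.symm {G H : HGraph N T} (h : Iso id G H) : Iso id H G := by
  obtain ⟨a, ha, h1, h2⟩ := h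
  exact ⟨a.symm, fun i => by simp [← ha], fun l => (h2 l).imp fun _ h => h.symm,
    fun k => (h1 k).imp fun _ h => h.symm⟩

theorem EdgeMap.congr {f f' : N → N} {G H : HGraph N T} {g : G.ι → H.ι} {k : G.κ} {l : H.κ}
    (h : EdgeMap f g k l) (hf : ∀ x, G.nm k x → f x = f' x) : EdgeMap f' g k l :=
  ⟨fun y => (h.1 y).trans (exists_congr fun x => and_congr_right fun hx => by rw [hf x hx]), h.2⟩

theorem Iso.congr {f f' : N → N} {G H : HGraph N T} (h : Iso f G H)
    (hf : ∀ x, G.HasName x → f x = f' x) : Iso f' G H := by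
  obtain ⟨a, ha, h1, h2⟩ := h
  exact ⟨a, ha, fun k => (h1 k).imp fun _ h => h.congr fun x hx => hf x ⟨k, hx⟩,
    fun l => (h2 l).imp fun k h => h.congr fun x hx => hf x ⟨k, hx⟩⟩

theorem Iso.hasName {f : N → N} {G H : HGraph N T} (h : Iso f G H) (y : N) :
    H.HasName y ↔ ∃ x, G.HasName x ∧ f x = y := by
  obtain ⟨a, ha, h1, h2⟩ := h
  constructor
  · rintro ⟨l, hl⟩
    obtain ⟨k, hk⟩ := h2 l
    obtain ⟨x, hx, rfl⟩ := (hk.1 y).1 hl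
    exact ⟨x, ⟨k, hx⟩, rfl⟩
  · rintro ⟨x, ⟨k, hx⟩, rfl⟩
    obtain ⟨l, hl⟩ := h1 k
    exact ⟨l, (hl.1 _).2 ⟨x, hx, rfl⟩⟩

theorem Iso.par {f : N → N} {G H G' H' : HGraph N T} (h : Iso f G G') (h' : Iso f H H') :
    Iso f (G.par H) (G'.par H') := by
  obtain ⟨a, ha, h1, h2⟩ := h
  obtain ⟨b, hb, h1', h2'⟩ := h'
  have hl : ∀ k l, EdgeMap f a k l →
      EdgeMap (G := G.par H) (H := G'.par H') f (Equiv.sumCongr a b) (.inl k) (.inl l) :=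
    fun k l h => ⟨h.1, by
      rintro (i | i)
      · exact h.2 i
      · exact Iff.rfl⟩
  have hr : ∀ k l, EdgeMap f b k l →
      EdgeMap (G := G.par H) (H := G'.par H') f (Equiv.sumCongr a b) (.inr k) (.inr l) :=
    fun k l h => ⟨h.1, by
      rintro (i | i)
      · exact Iff.rfl
      · exact h.2 i⟩
  refine ⟨Equiv.sumCongr a b, ?_, ?_, ?_⟩
  · rintro (i | i)
    · exact ha i
    · exact hb i
  · rintro (k | k)
    · exact (h1 k).elim fun l h => ⟨.inl l, hl k l h⟩
    · exact (h1' k).elim fun l h => ⟨.inr l, hr k l h⟩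
  · rintro (l | l)
    · exact (h2 l).elim fun k h => ⟨.inl k, hl k l h⟩
    · exact (h2' l).elim fun k h => ⟨.inr k, hr k l h⟩

/-- The map `f` may identify names, but no occurring name other than `x` may be sent to `x'`. Then
`x` yields a vertex exactly if `x'` does, with corresponding edges. -/
theorem Iso.res {f : N → N} {x x' : N} {G H : HGraph N T} (h : Iso f G H) (hx' : f x = x')
    (hx : ∀ y, G.HasName y → f y = x' → y = x) (t : T) : Iso f (G.res x t) (H.res x' t) := by
  have hn : G.HasName x ↔ H.HasName x' := by
    rw [h.hasName]
    constructor
    · exact fun h => ⟨x, h, hx'⟩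
    · rintro ⟨y, hy, hyx⟩
      exact hx y hy hyx ▸ hy
  obtain ⟨a, ha, h1, h2⟩ := h
  let b : (G.res x t).ι ≃ (H.res x' t).ι :=
    Equiv.sumCongr (Equiv.plift.trans ((Equiv.ofIff hn).trans Equiv.plift.symm)) a
  have hb : ∀ k l, EdgeMap f a k l → EdgeMap (G := G.res x t) (H := H.res x' t) f b k l := by
    refine fun k l h => ⟨fun y => ?_, ?_⟩
    · constructor
      · rintro ⟨hy, hyx⟩
        obtain ⟨z, hz, rfl⟩ := (h.1 y).1 hy
        exact ⟨z, ⟨hz, fun h => hyx (h ▸ hx')⟩, rfl⟩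
      · rintro ⟨z, ⟨hz, hzx⟩, rfl⟩
        exact ⟨(h.1 _).2 ⟨z, hz, rfl⟩, fun h => hzx (hx z ⟨k, hz⟩ h)⟩
    · rintro (i | i)
      · refine (h.1 x').trans ⟨?_, fun h => ⟨x, h, hx'⟩⟩
        rintro ⟨z, hz, hzx⟩
        exact hx z ⟨k, hz⟩ hzx ▸ hz
      · exact h.2 i
  refine ⟨b, ?_, fun k => (h1 k).imp (hb k), fun l => (h2 l).imp fun k => hb k l⟩
  rintro (i | i)
  · rfl
  · exact ha i

theorem hasName_par {G H : HGraph N T} {x : N} :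
    (G.par H).HasName x ↔ G.HasName x ∨ H.HasName x := Sum.exists

theorem hasName_res {x y : N} {t : T} {G : HGraph N T} :
    (G.res x t).HasName y ↔ G.HasName y ∧ y ≠ x := exists_and_right

theorem hasName_single {s : N → Prop} {x : N} : (single s : HGraph N T).HasName x ↔ s x :=
  ⟨fun ⟨_, h⟩ => h, fun h => ⟨(), h⟩⟩

theorem not_hasName_empty {x : N} : ¬ (empty : HGraph N T).HasName x := fun ⟨k, _⟩ => k.elim

/-- An isomorphism that does not change names, given by maps of vertices and edges. -/
theorem Iso.of_maps {G H : HGraph N T} (g : G.ι ≃ H.ι) (k : G.κ → H.κ) (l : H.κ → G.κ)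
    (hty : ∀ i, H.ty (g i) = G.ty i) (hk : ∀ e y, H.nm (k e) y ↔ G.nm e y)
    (hk' : ∀ e i, H.inc (k e) (g i) ↔ G.inc e i) (hl : ∀ e y, H.nm e y ↔ G.nm (l e) y)
    (hl' : ∀ e i, H.inc e (g i) ↔ G.inc (l e) i) : Iso id G H :=
  ⟨g, hty, fun e => ⟨k e, fun y => by simp [hk], hk' e⟩, fun e => ⟨l e, fun y => by simp [hl], hl' e⟩⟩

theorem par_comm (G H : HGraph N T) : Iso id (G.par H) (H.par G) := by
  refine Iso.of_maps (Equiv.sumComm _ _) Sum.swap Sum.swap ?_ ?_ ?_ ?_ ?_ <;>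
    rintro (_ | _) <;> try rintro (_ | _)
  all_goals first | (intro; rfl) | rfl

theorem par_assoc (G H K : HGraph N T) : Iso id ((G.par H).par K) (G.par (H.par K)) := by
  refine Iso.of_maps (Equiv.sumAssoc _ _ _) (Equiv.sumAssoc _ _ _) (Equiv.sumAssoc _ _ _).symm
    ?_ ?_ ?_ ?_ ?_
  · rintro ((_ | _) | _) <;> rfl
  · rintro ((_ | _) | _) _ <;> rfl
  · rintro ((_ | _) | _) ((_ | _) | _) <;> rfl
  · rintro (_ | _ | _) _ <;> rfl
  · rintro (_ | _ | _) ((_ | _) | _) <;> rfl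

theorem par_empty (G : HGraph N T) : Iso id (G.par empty) G := by
  have : IsEmpty (empty : HGraph N T).ι := inferInstanceAs (IsEmpty Empty)
  refine Iso.of_maps (Equiv.sumEmpty _ _) (Sum.elim id Empty.elim) Sum.inl ?_ ?_ ?_ ?_ ?_
  · rintro (_ | ⟨⟨⟩⟩); rfl
  · rintro (_ | ⟨⟨⟩⟩) _; rfl
  · rintro (_ | ⟨⟨⟩⟩) (_ | ⟨⟨⟩⟩); rfl
  · rintro _ _; rfl
  · rintro _ (_ | ⟨⟨⟩⟩); rfl

/-- Isomorphisms disregard the multiplicity of edges for the sake of this case: `!M ≡ M ∥ !M`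
duplicates an edge. -/
theorem single_par_single (s : N → Prop) :
    Iso id (single s : HGraph N T) ((single s).par (single s)) := by
  refine Iso.of_maps (Equiv.symm (Equiv.emptySum Empty Empty)) Sum.inl (fun _ => ()) ?_ ?_ ?_ ?_ ?_
  · rintro ⟨⟩
  · exact fun _ _ => Iff.rfl
  · rintro _ ⟨⟩
  · rintro (_ | _) _ <;> rfl
  · rintro _ ⟨⟩

/-- Restrictions yield vertices only if they are used, so that the graph does not see the law `ν x.
0 ≡ 0`. -/
theorem res_of_not_hasName {x : N} {G : HGraph N T} (hx : ¬ G.HasName x) (t : T) :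
    Iso id (G.res x t) G := by
  have : IsEmpty (PLift (G.HasName x)) := ⟨fun h => hx h.down⟩
  have hne : ∀ k y, G.nm k y → y ≠ x := fun k y h e => hx ⟨k, e ▸ h⟩
  refine Iso.of_maps (G := G.res x t) (Equiv.emptySum _ _) id id ?_ ?_ ?_ ?_ ?_
  · rintro (⟨⟨h⟩⟩ | _)
    · exact absurd h hx
    · rfl
  · exact fun k y => ⟨fun h => ⟨h, hne k y h⟩, And.left⟩
  · rintro _ (⟨⟨h⟩⟩ | _)
    · exact absurd h hx
    · rfl
  · exact fun k y => ⟨fun h => ⟨h, hne k y h⟩, And.left⟩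
  · rintro _ (⟨⟨h⟩⟩ | _)
    · exact absurd h hx
    · rfl

theorem res_res {x y : N} (hxy : x ≠ y) (s t : T) (G : HGraph N T) :
    Iso id ((G.res y t).res x s) ((G.res x s).res y t) := by
  have h1 : (G.res y t).HasName x ↔ G.HasName x := by simp [hasName_res, hxy]
  have h2 : (G.res x s).HasName y ↔ G.HasName y := by simp [hasName_res, hxy.symm]
  refine Iso.of_maps (G := (G.res y t).res x s) (H := (G.res x s).res y t)
    ⟨Sum.elim (fun a => .inr (.inl ⟨h1.1 a.down⟩))
      (Sum.elim (fun a => .inl ⟨h2.2 a.down⟩) (fun i => .inr (.inr i))),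
    Sum.elim (fun a => .inr (.inl ⟨h2.1 a.down⟩))
      (Sum.elim (fun a => .inl ⟨h1.2 a.down⟩) (fun i => .inr (.inr i))), ?_, ?_⟩ id id ?_ ?_ ?_ ?_ ?_
  · rintro (⟨_⟩ | ⟨_⟩ | i) <;> rfl
  · rintro (⟨_⟩ | ⟨_⟩ | i) <;> rfl
  · rintro (⟨_⟩ | ⟨_⟩ | i) <;> rfl
  · exact fun _ _ => and_right_comm
  · rintro k (⟨_⟩ | ⟨_⟩ | i)
    · exact ⟨fun h => ⟨h, hxy⟩, fun h => h.1⟩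
    · exact ⟨fun h => h.1, fun h => ⟨h, hxy.symm⟩⟩
    · rfl
  · exact fun _ _ => and_right_comm
  · rintro k (⟨_⟩ | ⟨_⟩ | i)
    · exact ⟨fun h => ⟨h, hxy⟩, fun h => h.1⟩
    · exact ⟨fun h => h.1, fun h => ⟨h, hxy.symm⟩⟩
    · rfl

theorem par_res {x : N} {G : HGraph N T} (hx : ¬ G.HasName x) (t : T) (H : HGraph N T) :
    Iso id (G.par (H.res x t)) ((G.par H).res x t) := by
  have h1 : (G.par H).HasName x ↔ H.HasName x := by simp [hasName_par, hx]
  have hne : ∀ k y, G.nm k y → y ≠ x := fun k y h e => hx ⟨k, e ▸ h⟩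
  have hnm : ∀ (k : G.κ ⊕ H.κ) y,
      ((G.par H).res x t).nm k y ↔ (G.par (H.res x t)).nm k y := by
    rintro (k | k) y
    · exact ⟨fun h => h.1, fun h => ⟨h, hne k y h⟩⟩
    · rfl
  refine Iso.of_maps (G := G.par (H.res x t)) (H := (G.par H).res x t)
    ⟨Sum.elim (fun i => .inr (.inl i))
      (Sum.elim (fun a => .inl ⟨h1.2 a.down⟩) (fun i => .inr (.inr i))),
    Sum.elim (fun a => .inr (.inl ⟨h1.1 a.down⟩))
      (Sum.elim .inl (fun i => .inr (.inr i))), ?_, ?_⟩ id id ?_ hnm ?_ hnm ?_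
  · rintro (i | ⟨_⟩ | i) <;> rfl
  · rintro (⟨_⟩ | i | i) <;> rfl
  · rintro (i | ⟨_⟩ | i) <;> rfl
  · rintro (k | k) (i | ⟨_⟩ | i) <;> try rfl
    exact iff_false_intro fun h => hne k x h rfl
  · rintro (k | k) (i | ⟨_⟩ | i) <;> try rfl
    exact iff_false_intro fun h => hne k x h rfl

/-- Two vertices share an edge. -/
def Adj (G : HGraph N T) (i j : G.ι) : Prop := ∃ k, G.inc k i ∧ G.inc k j

/-- Edges are tied if they are connected through shared vertices. -/
def Tied (G : HGraph N T) : G.κ → G.κ → Prop :=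
  ReflTransGen fun k l => ∃ i, G.inc k i ∧ G.inc l i

/-- Ties are lifted one by one, since vertices correspond bijectively and every edge of `H` has a
preimage. An edge may have several preimages; the one at the start can be prescribed. -/
theorem EdgeMap.tied {f : N → N} {G H : HGraph N T} {g : G.ι ≃ H.ι}
    (hg : ∀ l, ∃ k, EdgeMap (G := G) (H := H) f g k l)
    {k : G.κ} {l l' : H.κ} (hkl : EdgeMap f g k l) (h : H.Tied l l') :
    ∃ k', EdgeMap f g k' l' ∧ G.Tied k k' := by
  induction h with
  | refl => exact ⟨k, hkl, .refl⟩
  | tail _ h ih =>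
    obtain ⟨k1, hk1, ht⟩ := ih
    obtain ⟨i, hi, hi'⟩ := h
    obtain ⟨k2, hk2⟩ := hg _
    obtain ⟨j, rfl⟩ := g.surjective i
    exact ⟨k2, hk2, ht.tail ⟨j, (hk1.2 j).1 hi, (hk2.2 j).1 hi'⟩⟩

end HGraph

variable {N : Type u} {T : Type w}

/-- The communication graph of a term: the vertices are the active restrictions that are used,
and the edges are the active sequential subterms. -/
def Proc.graph [DecidableEq N] : Proc N (HType T) → HGraph N T
  | .nil => .empty
  | .res x τ P => P.graph.res x τ.base
  | .par P Q => P.graph.par Q.graph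
  | .sum M => .single (· ∈ M.fn)
  | .bang M => .single (· ∈ M.fn)

theorem Proc.hasName_graph [DecidableEq N] (P : Proc N (HType T)) (x : N) :
    P.graph.HasName x ↔ x ∈ P.fn := by
  cases P with
  | nil => exact iff_of_false HGraph.not_hasName_empty (by simp [Proc.fn])
  | res y τ P =>
    rw [Proc.graph, HGraph.hasName_res, P.hasName_graph, Proc.fn, Finset.mem_erase, and_comm]
  | par P Q =>
    rw [Proc.graph, HGraph.hasName_par, P.hasName_graph, Q.hasName_graph, Proc.fn, Finset.mem_union]
  | sum M => exact HGraph.hasName_single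
  | bang M => exact HGraph.hasName_single

/-! ## Renaming -/

section Rename

variable {N : Type u} {T : Type w}

mutual
theorem Proc.rename_rename (f g : N → N) :
    ∀ P : Proc N (HType T), (P.rename f).rename g = P.rename (g ∘ f)
  | .nil => rfl
  | .res _ _ P => by simp [Proc.rename, Proc.rename_rename f g P]
  | .par P Q => by simp [Proc.rename, Proc.rename_rename f g P, Proc.rename_rename f g Q]
  | .sum M => by simp [Proc.rename, Choice.rename_rename f g M]
  | .bang M => by simp [Proc.rename, Choice.rename_rename f g M]
theorem Choice.rename_rename (f g : N → N) :
    ∀ M : Choice N (HType T), (M.rename f).rename g = M.rename (g ∘ f)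
  | .pre π P => by cases π <;> simp [Choice.rename, Prefix.rename, Proc.rename_rename f g P]
  | .plus M M' => by simp [Choice.rename, Choice.rename_rename f g M, Choice.rename_rename f g M']
end

mutual
theorem Proc.rename_eq_self {f : N → N} (hf : ∀ x, f x = x) :
    ∀ P : Proc N (HType T), P.rename f = P
  | .nil => rfl
  | .res _ _ P => by simp [Proc.rename, Proc.rename_eq_self hf P, hf]
  | .par P Q => by simp [Proc.rename, Proc.rename_eq_self hf P, Proc.rename_eq_self hf Q]
  | .sum M => by simp [Proc.rename, Choice.rename_eq_self hf M]
  | .bang M => by simp [Proc.rename, Choice.rename_eq_self hf M]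
theorem Choice.rename_eq_self {f : N → N} (hf : ∀ x, f x = x) :
    ∀ M : Choice N (HType T), M.rename f = M
  | .pre π P => by cases π <;> simp [Choice.rename, Prefix.rename, Proc.rename_eq_self hf P, hf]
  | .plus M M' => by simp [Choice.rename, Choice.rename_eq_self hf M, Choice.rename_eq_self hf M']
end

variable [DecidableEq N]

/-- Renaming by `f` does not identify a name of `L` with another name. -/
def NoCapture (f : N → N) (L : List N) : Prop := ∀ y ∈ L, ∀ n, f n = f y → n = y

omit [DecidableEq N] in
theorem NoCapture.mono {f : N → N} {L L' : List N} (h : NoCapture f L) (hL : ∀ x ∈ L', x ∈ L) :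
    NoCapture f L' := fun y hy => h y (hL y hy)

omit [DecidableEq N] in
theorem NoCapture.of_injective {f : N → N} (h : Function.Injective f) (L : List N) :
    NoCapture f L := fun _ _ _ hn => h hn

theorem image_erase_of {f : N → N} {x : N} (hx : ∀ n, f n = f x → n = x) (s : Finset N) :
    (s.image f).erase (f x) = (s.erase x).image f := by
  ext y
  simp only [Finset.mem_erase, Finset.mem_image]
  constructor
  · rintro ⟨hy, n, hn, rfl⟩
    exact ⟨n, ⟨fun h => hy (h ▸ rfl), hn⟩, rfl⟩
  · rintro ⟨n, ⟨hn, hs⟩, rfl⟩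
    exact ⟨fun h => hn (hx n h), n, hs, rfl⟩

mutual
theorem Proc.fn_rename {f : N → N} :
    ∀ P : Proc N (HType T), NoCapture f P.bn → (P.rename f).fn = P.fn.image f
  | .nil, _ => by simp [Proc.rename, Proc.fn]
  | .res x τ P, h => by
    rw [Proc.rename, Proc.fn, P.fn_rename (h.mono (by simp +contextual [Proc.bn])), Proc.fn,
      image_erase_of (h x (by simp [Proc.bn]))]
  | .par P Q, h => by
    rw [Proc.rename, Proc.fn, P.fn_rename (h.mono (by simp +contextual [Proc.bn])),
      Q.fn_rename (h.mono (by simp +contextual [Proc.bn])), Proc.fn, Finset.image_union]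
  | .sum M, h => by rw [Proc.rename, Proc.fn, Proc.fn, M.fn_rename h]
  | .bang M, h => by rw [Proc.rename, Proc.fn, Proc.fn, M.fn_rename h]
theorem Choice.fn_rename {f : N → N} :
    ∀ M : Choice N (HType T), NoCapture f M.bn → (M.rename f).fn = M.fn.image f
  | .pre (.inp a x) P, h => by
    rw [Choice.rename, Prefix.rename, Choice.fn,
      P.fn_rename (h.mono (by simp +contextual [Choice.bn])),
      Choice.fn, image_erase_of (h x (by simp [Choice.bn])), Finset.image_insert]
  | .pre (.out a b) P, h => by
    rw [Choice.rename, Prefix.rename, Choice.fn,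
      P.fn_rename (h.mono (by simp +contextual [Choice.bn])),
      Choice.fn, Finset.image_insert, Finset.image_insert]
  | .pre .tau P, h => by
    rw [Choice.rename, Prefix.rename, Choice.fn,
      P.fn_rename (h.mono (by simp +contextual [Choice.bn])), Choice.fn]
  | .plus M M', h => by
    rw [Choice.rename, Choice.fn, M.fn_rename (h.mono (by simp +contextual [Choice.bn])),
      M'.fn_rename (h.mono (by simp +contextual [Choice.bn])), Choice.fn, Finset.image_union]
end

theorem HGraph.iso_single_image {f : N → N} (s : Finset N) :
    HGraph.Iso f (HGraph.single (· ∈ s) : HGraph N T) (HGraph.single (· ∈ s.image f)) :=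
  ⟨Equiv.refl _, by rintro ⟨⟩,
    fun _ => ⟨(), fun y => by simp [HGraph.single], by rintro ⟨⟩⟩,
    fun _ => ⟨(), fun y => by simp [HGraph.single], by rintro ⟨⟩⟩⟩

/-- Injectivity of `f` is not required: besides transpositions, this has to cover the substitution
of `b` for `x` in a receiver in which `b` may already occur. -/
theorem Proc.graph_rename {f : N → N} :
    ∀ P : Proc N (HType T), NoCapture f P.bn → HGraph.Iso f P.graph (P.rename f).graph
  | .nil, _ => ⟨Equiv.refl _, by rintro ⟨⟩, by rintro ⟨⟩, by rintro ⟨⟩⟩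
  | .res x τ P, h => (P.graph_rename (h.mono (by simp +contextual [Proc.bn]))).res rfl
      (fun y _ hy => h x (by simp [Proc.bn]) y hy) _
  | .par P Q, h => (P.graph_rename (h.mono (by simp +contextual [Proc.bn]))).par
      (Q.graph_rename (h.mono (by simp +contextual [Proc.bn])))
  | .sum M, h => by
    rw [Proc.rename, Proc.graph, Proc.graph, M.fn_rename h]
    exact HGraph.iso_single_image _
  | .bang M, h => by
    rw [Proc.rename, Proc.graph, Proc.graph, M.fn_rename h]
    exact HGraph.iso_single_image _

end Rename

/-! ## Satisfaction: typing of arbitrary terms -/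

section Sat

variable {N : Type u} {T : Type w}

/-- The graph of a term has a compatible arrangement. -/
def HGraph.Compat (lt : T → T → Prop) (G : HGraph N T) : Prop := Hier lt G.ty G.Adj

/-- Every vertex is above the context names of the edges that it is tied to. -/
def HGraph.Above (lt : T → T → Prop) (Γ : Env N T) (G : HGraph N T) : Prop :=
  ∀ i k l, G.inc k i → G.Tied k l → ∀ y, G.nm l y → ∀ σ, Γ y = some σ → lt σ.base (G.ty i)

/-- The names other than `x` and `a` of the edges that are tied to `x` are below `t`. -/
def HGraph.Migr (lt : T → T → Prop) (Γ : Env N T) (G : HGraph N T) (x a : N) (t : T) : Prop :=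
  ∀ k l, G.nm k x → G.Tied k l → ∀ y, G.nm l y → y ≠ x → y ≠ a → ∀ σ, Γ y = some σ → lt σ.base t

variable {lt : T → T → Prop}

theorem HGraph.Iso.compat {f : N → N} {G H : HGraph N T} (h : HGraph.Iso f G H)
    (hG : G.Compat lt) : H.Compat lt := by
  obtain ⟨g, hty, -, hl⟩ := h
  refine Hier.comap hG g.symm g.symm.injective id Function.injective_id (fun _ _ => Iff.rfl)
    (fun v => by simp [← hty]) ?_
  rintro i j ⟨l, hi, hj⟩
  obtain ⟨k, hk⟩ := hl l
  exact ⟨k, (hk.2 _).1 (by simpa using hi), (hk.2 _).1 (by simpa using hj)⟩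

/-- The condition is universal in the edges, so it transfers as soon as ties in `H` can be pulled
back to `G`. -/
theorem HGraph.Iso.above {f : N → N} {G H : HGraph N T} (h : HGraph.Iso f G H) {Γ Γ' : Env N T}
    (hΓ : ∀ x, G.HasName x → Γ' x = Γ (f x)) (hG : G.Above lt Γ') : H.Above lt Γ := by
  obtain ⟨g, hty, -, hl⟩ := h
  intro i k l hi ht y hy σ hσ
  obtain ⟨j, rfl⟩ := g.surjective i
  obtain ⟨k', hk'⟩ := hl k
  obtain ⟨l', hl', ht'⟩ := hk'.tied hl ht
  obtain ⟨x, hx, rfl⟩ := (hl'.1 _).1 hy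
  rw [hty]
  exact hG j k' l' ((hk'.2 _).1 hi) ht' x hx σ (by rw [hΓ x ⟨_, hx⟩, hσ])

/-- By `hx` the name `x'` comes from `x` only, and by `ha` a name that is exempt in `G` has an
exempt image in `H`; so every name that counts in `H` comes from one that counts in `G`. -/
theorem HGraph.Iso.migr {f : N → N} {G H : HGraph N T} (h : HGraph.Iso f G H) {Γ Γ' : Env N T}
    {x x' a a' : N} (hx : ∀ n, G.HasName n → (f n = x' ↔ n = x))
    (hΓ : ∀ n, G.HasName n → n ≠ x → Γ' n = Γ (f n))
    (ha : ∀ n, G.HasName n → n ≠ x → f n ≠ a' → n ≠ a) {t : T}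
    (hG : G.Migr lt Γ' x a t) : H.Migr lt Γ x' a' t := by
  obtain ⟨g, hty, -, hl⟩ := h
  intro k l hi ht y hy hyx hya σ hσ
  obtain ⟨k', hk'⟩ := hl k
  obtain ⟨l', hl', ht'⟩ := hk'.tied hl ht
  obtain ⟨n, hn, rfl⟩ := (hl'.1 _).1 hy
  obtain ⟨m, hm, hmx⟩ := (hk'.1 _).1 hi
  obtain rfl := (hx m ⟨_, hm⟩).1 hmx
  have hnm : n ≠ m := fun h => hyx (h ▸ hmx)
  exact hG k' l' hm ht' n hn hnm (ha n ⟨_, hn⟩ hnm hya) σ (by rw [hΓ n ⟨_, hn⟩ hnm, hσ])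

variable [DecidableEq N]

mutual
/-- The conditions on `P` that follow from `Γ ⊢ P` and from `T`-shapedness, except for those that
concern the top level of `P`. -/
def Proc.Sat (lt : T → T → Prop) : Env N T → Proc N (HType T) → Prop
  | _, .nil => True
  | Γ, .res x τ P => P.Sat lt (Γ.bind x τ)
  | Γ, .par P Q => P.Sat lt Γ ∧ Q.Sat lt Γ
  | Γ, .sum M => M.Sat lt Γ
  | Γ, .bang M => M.Sat lt Γ
/-- The conditions for a choice. -/
def Choice.Sat (lt : T → T → Prop) : Env N T → Choice N (HType T) → Prop
  | Γ, .pre (.inp a x) P => ∃ t τ, Γ a = some (.chan t τ) ∧ P.graph.Compat lt ∧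
      P.graph.Above lt (Γ.bind x τ) ∧ P.Sat lt (Γ.bind x τ) ∧
      (lt τ.base t ∨ P.graph.Migr lt Γ x a t)
  | Γ, .pre (.out a b) P => (∃ t τ, Γ a = some (.chan t τ) ∧ Γ b = some τ) ∧ P.graph.Compat lt ∧
      P.graph.Above lt Γ ∧ P.Sat lt Γ
  | Γ, .pre .tau P => P.graph.Compat lt ∧ P.graph.Above lt Γ ∧ P.Sat lt Γ
  | Γ, .plus M M' => M.Sat lt Γ ∧ M'.Sat lt Γ
end

theorem Env.bind_agree {f : N → N} {Γ Γ' : Env N T} {x x' : N} (τ : HType T) {s : Finset N}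
    (hx : f x = x') (hinj : ∀ n ∈ s, f n = x' → n = x)
    (h : ∀ n ∈ s, n ≠ x → Γ' n = Γ (f n)) :
    ∀ n ∈ s, Γ'.bind x τ n = Γ.bind x' τ (f n) := by
  intro n hn
  by_cases hnx : n = x
  · subst hnx
    simp [Env.bind, hx]
  · have : f n ≠ x' := fun h => hnx (hinj n hn h)
    simp [Env.bind, Function.update_of_ne, hnx, this, h n hn hnx]

mutual
-- This contains the substitution lemma of the type system: `Γ'` is `Γ` pulled back along `f`, so
-- for the map that sends `x` to `b` the name `x` must have in `Γ'` the type of `b` in `Γ`.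
theorem Proc.Sat.rename {f : N → N} : ∀ {P : Proc N (HType T)} {Γ Γ' : Env N T}, P.Sat lt Γ' →
    NoCapture f P.bn → (∀ n ∈ P.fn, Γ' n = Γ (f n)) → (P.rename f).Sat lt Γ
  | .nil, _, _, _, _, _ => trivial
  | .res x τ P, Γ, Γ', h, hf, hΓ => by
    refine Proc.Sat.rename (P := P) (Γ' := Γ'.bind x τ) h
      (hf.mono (by simp +contextual [Proc.bn])) (Env.bind_agree τ rfl ?_ ?_)
    · exact fun n _ => hf x (by simp [Proc.bn]) n
    · exact fun n hn hx => hΓ n (by simp [Proc.fn, hn, hx])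
  | .par P Q, Γ, Γ', h, hf, hΓ =>
    ⟨h.1.rename (hf.mono (by simp +contextual [Proc.bn])) fun n hn => hΓ n (by simp [Proc.fn, hn]),
      h.2.rename (hf.mono (by simp +contextual [Proc.bn])) fun n hn => hΓ n (by simp [Proc.fn, hn])⟩
  | .sum M, Γ, Γ', h, hf, hΓ => Choice.Sat.rename (M := M) h hf hΓ
  | .bang M, Γ, Γ', h, hf, hΓ => Choice.Sat.rename (M := M) h hf hΓ
theorem Choice.Sat.rename {f : N → N} : ∀ {M : Choice N (HType T)} {Γ Γ' : Env N T}, M.Sat lt Γ' →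
    NoCapture f M.bn → (∀ n ∈ M.fn, Γ' n = Γ (f n)) → (M.rename f).Sat lt Γ
  | .pre (.inp a x) P, Γ, Γ', h, hf, hΓ => by
    obtain ⟨t, τ, ha, hc, hab, hs, hm⟩ := h
    have hf' : NoCapture f P.bn := hf.mono (by simp +contextual [Choice.bn])
    have hx : ∀ n, f n = f x → n = x := hf x (by simp [Choice.bn])
    have hΓ' : ∀ n ∈ P.fn, n ≠ x → Γ' n = Γ (f n) := fun n hn hnx =>
      hΓ n (by simp [Choice.fn, hn, hnx])
    have hb := Env.bind_agree (Γ := Γ) (Γ' := Γ') τ rfl (fun n (_ : n ∈ P.fn) => hx n) hΓ'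
    have hi := P.graph_rename hf'
    refine ⟨t, τ, by rw [← hΓ a (by simp [Choice.fn]), ha], hi.compat hc,
      hi.above (fun n hn => hb n ((P.hasName_graph n).1 hn)) hab, hs.rename hf' hb, ?_⟩
    refine hm.imp_right fun hm => hi.migr (fun n _ => ⟨hx n, fun h => h ▸ rfl⟩)
      (fun n hn => hΓ' n ((P.hasName_graph n).1 hn)) ?_ hm
    exact fun n _ _ hn h => hn (h ▸ rfl)
  | .pre (.out a b) P, Γ, Γ', h, hf, hΓ => by
    obtain ⟨⟨t, τ, ha, hb⟩, hc, hab, hs⟩ := h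
    have hΓ' : ∀ n ∈ P.fn, Γ' n = Γ (f n) := fun n hn => hΓ n (by simp [Choice.fn, hn])
    have hi := P.graph_rename hf
    exact ⟨⟨t, τ, by rw [← hΓ a (by simp [Choice.fn]), ha], by
      rw [← hΓ b (by simp [Choice.fn]), hb]⟩, hi.compat hc,
      hi.above (fun n hn => hΓ' n ((P.hasName_graph n).1 hn)) hab, hs.rename hf hΓ'⟩
  | .pre .tau P, Γ, Γ', h, hf, hΓ => by
    obtain ⟨hc, hab, hs⟩ := h
    have hi := P.graph_rename hf
    exact ⟨hi.compat hc,
      hi.above (fun n hn => hΓ n ((P.hasName_graph n).1 hn)) hab, hs.rename hf hΓ⟩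
  | .plus M M', Γ, Γ', h, hf, hΓ =>
    ⟨h.1.rename (hf.mono (by simp +contextual [Choice.bn]))
      fun n hn => hΓ n (by simp [Choice.fn, hn]),
      h.2.rename (hf.mono (by simp +contextual [Choice.bn]))
      fun n hn => hΓ n (by simp [Choice.fn, hn])⟩
end

theorem Proc.Sat.congr_env {P : Proc N (HType T)} {Γ Γ' : Env N T} (h : P.Sat lt Γ')
    (hΓ : ∀ n ∈ P.fn, Γ' n = Γ n) : P.Sat lt Γ := by
  have := h.rename (f := id) (NoCapture.of_injective Function.injective_id _) hΓ
  rwa [Proc.rename_eq_self (f := id) fun _ => rfl] at this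

theorem Choice.Sat.congr_env {M : Choice N (HType T)} {Γ Γ' : Env N T} (h : M.Sat lt Γ')
    (hΓ : ∀ n ∈ M.fn, Γ' n = Γ n) : M.Sat lt Γ := by
  have := h.rename (f := id) (NoCapture.of_injective Function.injective_id _) hΓ
  rwa [Choice.rename_eq_self (f := id) fun _ => rfl] at this

mutual
/-- `t` is the base type of a restriction in `P` that is used. -/
def Proc.UsedType (t : T) : Proc N (HType T) → Prop
  | .nil => False
  | .res x τ P => (x ∈ P.fn ∧ τ.base = t) ∨ P.UsedType t
  | .par P Q => P.UsedType t ∨ Q.UsedType t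
  | .sum M => M.UsedType t
  | .bang M => M.UsedType t
/-- `t` is the base type of a restriction in a choice that is used. -/
def Choice.UsedType (t : T) : Choice N (HType T) → Prop
  | .pre _ P => P.UsedType t
  | .plus M M' => M.UsedType t ∨ M'.UsedType t
end

mutual
theorem Proc.usedType_rename {f : N → N} {t : T} : ∀ {P : Proc N (HType T)},
    NoCapture f P.bn → ((P.rename f).UsedType t ↔ P.UsedType t)
  | .nil, _ => Iff.rfl
  | .res x τ P, hf => by
    have hf' : NoCapture f P.bn := hf.mono (by simp +contextual [Proc.bn])
    have hx : f x ∈ (P.rename f).fn ↔ x ∈ P.fn := by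
      rw [P.fn_rename hf', Finset.mem_image]
      constructor
      · rintro ⟨n, hn, h⟩
        exact hf x (by simp [Proc.bn]) n h ▸ hn
      · exact fun h => ⟨x, h, rfl⟩
    simp only [Proc.rename, Proc.UsedType, hx, Proc.usedType_rename hf']
  | .par P Q, hf => by
    simp only [Proc.rename, Proc.UsedType,
      Proc.usedType_rename (hf.mono (by simp +contextual [Proc.bn]) : NoCapture f P.bn),
      Proc.usedType_rename (hf.mono (by simp +contextual [Proc.bn]) : NoCapture f Q.bn)]
  | .sum M, hf => Choice.usedType_rename (M := M) hf
  | .bang M, hf => Choice.usedType_rename (M := M) hf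
theorem Choice.usedType_rename {f : N → N} {t : T} : ∀ {M : Choice N (HType T)},
    NoCapture f M.bn → ((M.rename f).UsedType t ↔ M.UsedType t)
  | .pre π P, hf => by
    have hf' : NoCapture f P.bn := hf.mono (by cases π <;> simp +contextual [Choice.bn])
    simp only [Choice.rename, Choice.UsedType, Proc.usedType_rename hf']
  | .plus M M', hf => by
    simp only [Choice.rename, Choice.UsedType,
      Choice.usedType_rename (hf.mono (by simp +contextual [Choice.bn]) : NoCapture f M.bn),
      Choice.usedType_rename (hf.mono (by simp +contextual [Choice.bn]) : NoCapture f M'.bn)]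
end

/-! ## Invariance under structural congruence -/

/-- Terms that the invariants do not tell apart. -/
structure Proc.Similar (lt : T → T → Prop) (P Q : Proc N (HType T)) : Prop where
  fn : P.fn = Q.fn
  graph : HGraph.Iso id P.graph Q.graph
  sat : ∀ Γ, P.Sat lt Γ ↔ Q.Sat lt Γ
  used : ∀ t, P.UsedType t ↔ Q.UsedType t

/-- Choices that the invariants do not tell apart. -/
structure Choice.Similar (lt : T → T → Prop) (M M' : Choice N (HType T)) : Prop where
  fn : M.fn = M'.fn
  sat : ∀ Γ, M.Sat lt Γ ↔ M'.Sat lt Γ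
  used : ∀ t, M.UsedType t ↔ M'.UsedType t

omit [DecidableEq N] in
theorem HGraph.Iso.compat_iff {G H : HGraph N T} (h : HGraph.Iso id G H) :
    G.Compat lt ↔ H.Compat lt := ⟨h.compat, h.symm.compat⟩

omit [DecidableEq N] in
theorem HGraph.Iso.above_iff {G H : HGraph N T} (h : HGraph.Iso id G H) {Γ : Env N T} :
    G.Above lt Γ ↔ H.Above lt Γ := ⟨h.above fun _ _ => rfl, h.symm.above fun _ _ => rfl⟩

omit [DecidableEq N] in
theorem HGraph.Iso.migr_iff {G H : HGraph N T} (h : HGraph.Iso id G H) {Γ : Env N T} {x a : N}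
    {t : T} : G.Migr lt Γ x a t ↔ H.Migr lt Γ x a t :=
  ⟨h.migr (fun _ _ => Iff.rfl) (fun _ _ _ => rfl) (fun _ _ _ => id),
    h.symm.migr (fun _ _ => Iff.rfl) (fun _ _ _ => rfl) (fun _ _ _ => id)⟩

theorem swap_agree {x y : N} {P : Proc N (HType T)} (hy : y ∉ P.fn) :
    ∀ n ∈ P.fn, n ≠ x → Equiv.swap x y n = n :=
  fun _ hn hx => Equiv.swap_apply_of_ne_of_ne hx fun h => hy (h ▸ hn)

theorem fn_rename_swap (x y : N) (P : Proc N (HType T)) :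
    (P.rename (Equiv.swap x y)).fn = P.fn.image (Equiv.swap x y) :=
  P.fn_rename (NoCapture.of_injective (Equiv.injective _) _)

theorem erase_fn_rename_swap {x y : N} {P : Proc N (HType T)} (hy : y ∉ P.fn) :
    (P.rename (Equiv.swap x y)).fn.erase y = P.fn.erase x := by
  rw [fn_rename_swap]
  ext n
  simp only [Finset.mem_erase, Finset.mem_image]
  constructor
  · rintro ⟨hn, m, hm, rfl⟩
    have hmx : m ≠ x := by rintro rfl; simp at hn
    rw [swap_agree hy m hm hmx]
    exact ⟨hmx, hm⟩
  · rintro ⟨hn, hm⟩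
    exact ⟨fun h => hy (h ▸ hm), n, hm, swap_agree hy n hm hn⟩

/-- The converse of an `alpha` step is an `alpha` step. -/
theorem alpha_inv {x y : N} {P : Proc N (HType T)} (hy : y ∉ P.fn) :
    x ∉ (P.rename (Equiv.swap x y)).fn ∧
      (P.rename (Equiv.swap x y)).rename (Equiv.swap y x) = P := by
  constructor
  · rw [fn_rename_swap, Finset.mem_image]
    rintro ⟨n, hn, h⟩
    obtain rfl : n = y := by rw [← Equiv.swap_apply_left x y] at h; simpa using congrArg (Equiv.swap x y) h
    exact hy hn
  · rw [Proc.rename_rename, Proc.rename_eq_self]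
    intro n
    simp [Equiv.swap_comm y x]

theorem swap_bind_agree {x y : N} {P : Proc N (HType T)} (hy : y ∉ P.fn) (Γ : Env N T)
    (τ : HType T) : ∀ n ∈ P.fn, Γ.bind x τ n = Γ.bind y τ (Equiv.swap x y n) :=
  Env.bind_agree τ (Equiv.swap_apply_left x y)
    (fun n _ h => by rwa [Equiv.swap_apply_eq_iff, Equiv.swap_apply_right] at h)
    fun n hn hx => by rw [swap_agree hy n hn hx]

theorem Proc.Sat.alpha {x y : N} {P : Proc N (HType T)} (hy : y ∉ P.fn) {Γ : Env N T}
    {τ : HType T} (h : P.Sat lt (Γ.bind x τ)) :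
    (P.rename (Equiv.swap x y)).Sat lt (Γ.bind y τ) :=
  h.rename (NoCapture.of_injective (Equiv.injective _) _) (swap_bind_agree hy Γ τ)

theorem Choice.Sat.alpha {a x y : N} {P : Proc N (HType T)} (hy : y ∉ P.fn) {Γ : Env N T}
    (h : (Choice.pre (.inp a x) P).Sat lt Γ) :
    (Choice.pre (.inp a y) (P.rename (Equiv.swap x y))).Sat lt Γ := by
  obtain ⟨t, τ, ha, hc, hab, hs, hm⟩ := h
  have hi := P.graph_rename (NoCapture.of_injective (Equiv.swap x y).injective _)
  refine ⟨t, τ, ha, hi.compat hc,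
    hi.above (fun n hn => swap_bind_agree hy Γ τ n ((P.hasName_graph n).1 hn)) hab, hs.alpha hy,
    hm.imp_right fun hm => hi.migr (fun n hn => ?_) (fun n hn hx => ?_) (fun n hn hx => ?_) hm⟩
  · rw [Equiv.swap_apply_eq_iff, Equiv.swap_apply_right]
  · rw [swap_agree hy n ((P.hasName_graph n).1 hn) hx]
  · rw [swap_agree hy n ((P.hasName_graph n).1 hn) hx]
    exact id

theorem Proc.graph_alpha {x y : N} {P : Proc N (HType T)} (hy : y ∉ P.fn) (τ : HType T) :
    HGraph.Iso id (Proc.res x τ P).graph (Proc.res y τ (P.rename (Equiv.swap x y))).graph := by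
  have h := (Proc.res x τ P).graph_rename
    (NoCapture.of_injective (Equiv.swap x y).injective _)
  rw [Proc.rename, Equiv.swap_apply_left] at h
  refine h.congr fun n hn => ?_
  have hn := ((Proc.res x τ P).hasName_graph n).1 hn
  rw [Proc.fn, Finset.mem_erase] at hn
  exact swap_agree hy n hn.2 hn.1

mutual
-- The properties are proved simultaneously because they depend on each other: the graph of a
-- sequential term is given by its free names, `Sat` for a prefix involves the graph of the
-- continuation, and whether a restriction is used depends on free names.
theorem Proc.Cong.similar : ∀ {P Q : Proc N (HType T)}, P.Cong Q → P.Similar lt Q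
  | _, _, .refl P => ⟨rfl, .refl _, fun _ => Iff.rfl, fun _ => Iff.rfl⟩
  | _, _, .symm h =>
    ⟨h.similar.fn.symm, h.similar.graph.symm, fun Γ => (h.similar.sat Γ).symm,
      fun t => (h.similar.used t).symm⟩
  | _, _, .trans h h' =>
    ⟨h.similar.fn.trans h'.similar.fn, h.similar.graph.trans h'.similar.graph,
      fun Γ => (h.similar.sat Γ).trans (h'.similar.sat Γ),
      fun t => (h.similar.used t).trans (h'.similar.used t)⟩
  | _, _, .res x τ h =>
    have h := h.similar
    ⟨by rw [Proc.fn, Proc.fn, h.fn], h.graph.res rfl (fun _ _ => id) _, fun Γ => h.sat _,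
      fun t => by rw [Proc.UsedType, Proc.UsedType, h.fn, h.used]⟩
  | _, _, .par h h' =>
    have h := h.similar
    have h' := h'.similar
    ⟨by rw [Proc.fn, Proc.fn, h.fn, h'.fn], h.graph.par h'.graph,
      fun Γ => and_congr (h.sat Γ) (h'.sat Γ), fun t => or_congr (h.used t) (h'.used t)⟩
  | _, _, .sum h =>
    have h := h.similar
    ⟨h.fn, by rw [Proc.graph, Proc.graph, h.fn]; exact .refl _, h.sat, h.used⟩
  | _, _, .bang h =>
    have h := h.similar
    ⟨h.fn, by rw [Proc.graph, Proc.graph, h.fn]; exact .refl _, h.sat, h.used⟩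
  | _, _, .alpha x y τ P hy =>
    ⟨(erase_fn_rename_swap hy).symm, Proc.graph_alpha hy τ,
      fun Γ => ⟨fun h => Proc.Sat.alpha hy h, fun h => by
        have := Proc.Sat.alpha (alpha_inv hy).1 h
        rwa [(alpha_inv hy).2] at this⟩,
      fun t => by
        have : y ∈ (P.rename (Equiv.swap x y)).fn ↔ x ∈ P.fn := by
          rw [fn_rename_swap]
          simp [Equiv.swap_apply_eq_iff]
        rw [Proc.UsedType, Proc.UsedType, this,
          Proc.usedType_rename (NoCapture.of_injective (Equiv.injective _) _)]⟩
  | _, _, .par_comm P Q =>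
    ⟨Finset.union_comm _ _, HGraph.par_comm _ _, fun _ => and_comm, fun _ => or_comm⟩
  | _, _, .par_assoc P Q R =>
    ⟨Finset.union_assoc _ _ _, HGraph.par_assoc _ _ _, fun _ => and_assoc, fun _ => or_assoc⟩
  | _, _, .par_nil P =>
    ⟨Finset.union_empty _, HGraph.par_empty _, fun _ => iff_of_eq (and_true _), fun _ => iff_of_eq (or_false _)⟩
  | _, _, .res_nil x τ =>
    ⟨rfl, HGraph.res_of_not_hasName HGraph.not_hasName_empty _, fun _ => Iff.rfl,
      fun _ => by simp [Proc.UsedType, Proc.fn]⟩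
  | _, _, .exch x τ y σ P hxy =>
    ⟨Finset.erase_right_comm, HGraph.res_res hxy _ _ _, fun Γ => by
      rw [Proc.Sat, Proc.Sat, Proc.Sat, Proc.Sat, Env.bind, Env.bind, Env.bind, Env.bind,
        Function.update_comm hxy], fun t => by
      simp only [Proc.UsedType, Proc.fn, Finset.mem_erase, ne_eq, hxy, hxy.symm, not_false_eq_true,
        true_and]
      exact or_left_comm⟩
  | _, _, .unfold M =>
    ⟨(Finset.union_self _).symm, HGraph.single_par_single _, fun _ => (and_self_iff).symm,
      fun _ => (or_self_iff).symm⟩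
  | _, _, .extrude P x τ Q hx =>
    ⟨by simp only [Proc.fn, Finset.erase_union_distrib, Finset.erase_eq_of_notMem hx],
      HGraph.par_res (fun h => hx ((P.hasName_graph x).1 h)) _ _, fun Γ => and_congr_left' (by
        have : ∀ n ∈ P.fn, Γ n = Γ.bind x τ n := fun n hn =>
          (Function.update_of_ne (ne_of_mem_of_not_mem hn hx) _ _).symm
        exact ⟨fun h => h.congr_env this, fun h => h.congr_env fun n hn => (this n hn).symm⟩),
      fun t => by
        simp only [Proc.UsedType, Proc.fn, Finset.mem_union, hx, false_or]
        exact or_left_comm⟩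
theorem Choice.Cong.similar : ∀ {M M' : Choice N (HType T)}, M.Cong M' → M.Similar lt M'
  | _, _, .refl P => ⟨rfl, fun _ => Iff.rfl, fun _ => Iff.rfl⟩
  | _, _, .symm h =>
    ⟨h.similar.fn.symm, fun Γ => (h.similar.sat Γ).symm,
      fun t => (h.similar.used t).symm⟩
  | _, _, .trans h h' =>
    ⟨h.similar.fn.trans h'.similar.fn,
      fun Γ => (h.similar.sat Γ).trans (h'.similar.sat Γ),
      fun t => (h.similar.used t).trans (h'.similar.used t)⟩
  | _, _, .pre π h =>
    have h := h.similar
    ⟨by cases π <;> simp only [Choice.fn, h.fn], fun Γ => by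
      cases π <;> simp only [Choice.Sat, h.sat, h.graph.compat_iff, h.graph.above_iff,
        h.graph.migr_iff], h.used⟩
  | _, _, .plus h h' =>
    have h := h.similar
    have h' := h'.similar
    ⟨by rw [Choice.fn, Choice.fn, h.fn, h'.fn],
      fun Γ => and_congr (h.sat Γ) (h'.sat Γ), fun t => or_congr (h.used t) (h'.used t)⟩
  | _, _, .alpha a x y P hy =>
    ⟨by rw [Choice.fn, Choice.fn, erase_fn_rename_swap hy],
      fun Γ => ⟨fun h => h.alpha hy, fun h => by
        have := h.alpha (alpha_inv hy).1
        rwa [(alpha_inv hy).2] at this⟩,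
      fun t => (Proc.usedType_rename (NoCapture.of_injective (Equiv.injective _) _)).symm⟩
  | _, _, .plus_comm M M' => ⟨Finset.union_comm _ _, fun _ => and_comm, fun _ => or_comm⟩
  | _, _, .plus_assoc M M' M'' => ⟨Finset.union_assoc _ _ _, fun _ => and_assoc, fun _ => or_assoc⟩
end

end Sat

/-! ## Terms whose active restrictions are named apart -/

section Represent

variable {N : Type u} {T : Type w} [DecidableEq N]

theorem Proc.mem_actNames {P : Proc N (HType T)} {x : N} :
    x ∈ P.actNames ↔ ∃ τ, (x, τ) ∈ P.actRes := by
  simp [Proc.actNames]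

/-- The active restrictions bind distinct names, which are not free. -/
def Proc.ActUniq (P : Proc N (HType T)) : Prop :=
  (P.actRes.map Prod.fst).Nodup ∧ ∀ x ∈ P.actNames, x ∉ P.fn

theorem Proc.fn_subset_of_mem_actSeq {A : SeqTerm N (HType T)} : ∀ {P : Proc N (HType T)},
    A ∈ P.actSeq → ∀ x ∈ A.fn, x ∈ P.fn ∨ x ∈ P.actNames
  | .nil, h, _, _ => by simp [Proc.actSeq] at h
  | .res y τ P, h, x, hx => by
    have := P.fn_subset_of_mem_actSeq h x hx
    simp only [Proc.mem_actNames, Proc.fn, Proc.actRes, Finset.mem_erase, List.mem_cons,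
      Prod.mk.injEq] at this ⊢
    by_cases hxy : x = y
    · exact .inr ⟨τ, .inl ⟨hxy, rfl⟩⟩
    · exact this.imp (fun h => ⟨hxy, h⟩) fun ⟨σ, h⟩ => ⟨σ, .inr h⟩
  | .par P Q, h, x, hx => by
    simp only [Proc.mem_actNames, Proc.fn, Proc.actRes, Finset.mem_union, List.mem_append,
      exists_or]
    rcases List.mem_append.1 h with h | h
    · exact (P.fn_subset_of_mem_actSeq h x hx).imp .inl fun h => .inl (Proc.mem_actNames.1 h)
    · exact (Q.fn_subset_of_mem_actSeq h x hx).imp .inr fun h => .inr (Proc.mem_actNames.1 h)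
  | .sum M, h, x, hx => by
    obtain rfl := List.mem_singleton.1 h
    exact .inl hx
  | .bang M, h, x, hx => by
    obtain rfl := List.mem_singleton.1 h
    exact .inl hx

/-- The edge `k` of the graph corresponds to `A` if the vertices are named by `ℓ`. -/
def Proc.IsEdge (P : Proc N (HType T)) (ℓ : P.graph.ι → N) (k : P.graph.κ)
    (A : SeqTerm N (HType T)) : Prop :=
  (∀ y, P.graph.nm k y ↔ y ∈ A.fn ∧ y ∉ P.actNames) ∧ ∀ i, P.graph.inc k i ↔ ℓ i ∈ A.fn

/-- The vertices and edges of the graph of a term correspond to the active restrictions and the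
active sequential subterms. -/
structure Proc.Labelling (P : Proc N (HType T)) (ℓ : P.graph.ι → N) : Prop where
  inj : Function.Injective ℓ
  ty : ∀ i, ∃ τ, (ℓ i, τ) ∈ P.actRes ∧ τ.base = P.graph.ty i
  edge : ∀ k, ∃ A ∈ P.actSeq, P.IsEdge ℓ k A
  seq : ∀ A ∈ P.actSeq, ∃ k, P.IsEdge ℓ k A
  surj : ∀ A ∈ P.actSeq, ∀ x ∈ A.fn, x ∈ P.actNames → ∃ i, ℓ i = x

theorem Proc.ActUniq.res {x : N} {τ : HType T} {P : Proc N (HType T)}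
    (h : (Proc.res x τ P).ActUniq) : P.ActUniq ∧ x ∉ P.actNames := by
  have hx : x ∉ P.actNames := by
    have := (List.nodup_cons.1 h.1).1
    rwa [Proc.actNames, List.mem_toFinset]
  refine ⟨⟨(List.nodup_cons.1 h.1).2, fun y hy hyP => ?_⟩, hx⟩
  refine h.2 y ?_ ?_
  · obtain ⟨σ, hσ⟩ := Proc.mem_actNames.1 hy
    exact Proc.mem_actNames.2 ⟨σ, List.mem_cons_of_mem _ hσ⟩
  · exact Finset.mem_erase.2 ⟨fun h => hx (h ▸ hy), hyP⟩

theorem Proc.mem_actNames_res {x y : N} {τ : HType T} {P : Proc N (HType T)} :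
    y ∈ (Proc.res x τ P).actNames ↔ y = x ∨ y ∈ P.actNames := by
  simp [Proc.actNames, Proc.actRes]

theorem Proc.mem_actNames_par {y : N} {P Q : Proc N (HType T)} :
    y ∈ (Proc.par P Q).actNames ↔ y ∈ P.actNames ∨ y ∈ Q.actNames := by
  simp [Proc.actNames, Proc.actRes]

/-- The conditions on names in a parallel composition. -/
theorem Proc.ActUniq.par {P Q : Proc N (HType T)} (h : (Proc.par P Q).ActUniq) :
    P.ActUniq ∧ Q.ActUniq ∧ (∀ x ∈ P.actNames, x ∉ Q.actNames ∧ x ∉ Q.fn) ∧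
      ∀ x ∈ Q.actNames, x ∉ P.actNames ∧ x ∉ P.fn := by
  obtain ⟨h1, h2⟩ := h
  rw [Proc.actRes, List.map_append, List.nodup_append] at h1
  simp only [Proc.mem_actNames_par, Proc.fn, Finset.mem_union, not_or] at h2
  have h3 : ∀ x ∈ P.actNames, x ∉ Q.actNames := fun x hx hx' =>
    h1.2.2 x (List.mem_toFinset.1 hx) x (List.mem_toFinset.1 hx') rfl
  exact ⟨⟨h1.1, fun x hx => (h2 x (.inl hx)).1⟩, ⟨h1.2.1, fun x hx => (h2 x (.inr hx)).2⟩,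
    fun x hx => ⟨h3 x hx, (h2 x (.inl hx)).2⟩, fun x hx => ⟨fun h => h3 x h hx, (h2 x (.inr hx)).1⟩⟩

/-- In a parallel composition that is named apart, a component of one side uses no name restricted
on the other, which matches the absence of incidences across a disjoint union. A restriction that is
not used has no vertex, hence the form of `surj`. -/
theorem Proc.exists_labelling : ∀ {P : Proc N (HType T)}, P.ActUniq → ∃ ℓ, P.Labelling ℓ
  | .nil, _ => ⟨Empty.elim, ⟨fun i => i.elim, fun i => i.elim, fun k => k.elim,
      fun A h => by simp [Proc.actSeq] at h, fun A h => by simp [Proc.actSeq] at h⟩⟩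
  | .sum M, _ => ⟨Empty.elim, ⟨fun i => i.elim, fun i => i.elim,
      fun k => ⟨.once M, List.mem_singleton_self _, fun y => ⟨fun h => ⟨h, by
        simp [Proc.actNames, Proc.actRes]⟩, And.left⟩, fun i => i.elim⟩,
      fun A h => ⟨(), by
        obtain rfl := List.mem_singleton.1 h
        exact ⟨fun y => ⟨fun h => ⟨h, by simp [Proc.actNames, Proc.actRes]⟩, And.left⟩,
          fun i => i.elim⟩⟩, fun A h x _ hx => by simp [Proc.actNames, Proc.actRes] at hx⟩⟩
  | .bang M, _ => ⟨Empty.elim, ⟨fun i => i.elim, fun i => i.elim,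
      fun k => ⟨.repl M, List.mem_singleton_self _, fun y => ⟨fun h => ⟨h, by
        simp [Proc.actNames, Proc.actRes]⟩, And.left⟩, fun i => i.elim⟩,
      fun A h => ⟨(), by
        obtain rfl := List.mem_singleton.1 h
        exact ⟨fun y => ⟨fun h => ⟨h, by simp [Proc.actNames, Proc.actRes]⟩, And.left⟩,
          fun i => i.elim⟩⟩, fun A h x _ hx => by simp [Proc.actNames, Proc.actRes] at hx⟩⟩
  | .res x τ P, h => by
    obtain ⟨hP, hx⟩ := h.res
    obtain ⟨ℓ, hℓ⟩ := Proc.exists_labelling hP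
    have hact : ∀ i, ℓ i ∈ P.actNames := fun i =>
      Proc.mem_actNames.2 ((hℓ.ty i).imp fun _ h => h.1)
    have hM : ∀ k A, P.IsEdge ℓ k A →
        (Proc.res x τ P).IsEdge (Sum.elim (fun _ => x) ℓ) k A := by
      refine fun k A h => ⟨fun y => ?_, ?_⟩
      · rw [Proc.mem_actNames_res, not_or]
        exact (and_congr_left' (h.1 y)).trans (by tauto)
      · rintro (i | i)
        · exact (h.1 x).trans ⟨And.left, fun h => ⟨h, hx⟩⟩
        · exact h.2 i
    refine ⟨Sum.elim (fun _ => x) ℓ, ⟨?_, ?_, fun k => ?_, fun A hA => ?_, fun A hA y hy hy' => ?_⟩⟩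
    · rintro (i | i) (j | j) hij
      · exact congrArg Sum.inl (Subsingleton.elim i j)
      · exact absurd (hact j) (by rwa [← show x = ℓ j from hij])
      · exact absurd (hact i) (by rwa [show ℓ i = x from hij])
      · exact congrArg _ (hℓ.inj hij)
    · rintro (i | i)
      · exact ⟨τ, List.mem_cons_self, rfl⟩
      · exact (hℓ.ty i).imp fun _ h => ⟨List.mem_cons_of_mem _ h.1, h.2⟩
    · exact (hℓ.edge k).imp fun A h => ⟨h.1, hM k A h.2⟩
    · exact (hℓ.seq A hA).imp fun k => hM k A
    · rcases Proc.mem_actNames_res.1 hy' with rfl | hy'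
      · obtain ⟨k, hk⟩ := hℓ.seq A hA
        exact ⟨.inl ⟨⟨k, (hk.1 y).2 ⟨hy, hx⟩⟩⟩, rfl⟩
      · exact (hℓ.surj A hA y hy hy').elim fun i hi => ⟨.inr i, hi⟩
  | .par P Q, h => by
    obtain ⟨hP, hQ, hPQ, hQP⟩ := h.par
    obtain ⟨ℓ, hℓ⟩ := Proc.exists_labelling hP
    obtain ⟨ℓ', hℓ'⟩ := Proc.exists_labelling hQ
    have hact : ∀ i, ℓ i ∈ P.actNames := fun i =>
      Proc.mem_actNames.2 ((hℓ.ty i).imp fun _ h => h.1)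
    have hact' : ∀ i, ℓ' i ∈ Q.actNames := fun i =>
      Proc.mem_actNames.2 ((hℓ'.ty i).imp fun _ h => h.1)
    have hA : ∀ A ∈ P.actSeq, ∀ y ∈ A.fn, y ∉ Q.actNames := fun A hA y hy hyQ =>
      (Proc.fn_subset_of_mem_actSeq hA y hy).elim (hQP y hyQ).2 (hQP y hyQ).1
    have hA' : ∀ A ∈ Q.actSeq, ∀ y ∈ A.fn, y ∉ P.actNames := fun A hA y hy hyP =>
      (Proc.fn_subset_of_mem_actSeq hA y hy).elim (hPQ y hyP).2 (hPQ y hyP).1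
    have hM : ∀ k, ∀ A ∈ P.actSeq, P.IsEdge ℓ k A →
        (Proc.par P Q).IsEdge (Sum.elim ℓ ℓ') (.inl k) A := by
      refine fun k A hAP h => ⟨fun y => ?_, ?_⟩
      · rw [Proc.mem_actNames_par, not_or]
        exact (h.1 y).trans (and_congr_right fun hy => (and_iff_left (hA A hAP y hy)).symm)
      · rintro (i | i)
        · exact h.2 i
        · exact iff_of_false id fun hi => hA A hAP _ hi (hact' i)
    have hM' : ∀ k, ∀ A ∈ Q.actSeq, Q.IsEdge ℓ' k A →
        (Proc.par P Q).IsEdge (Sum.elim ℓ ℓ') (.inr k) A := by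
      refine fun k A hAP h => ⟨fun y => ?_, ?_⟩
      · rw [Proc.mem_actNames_par, not_or]
        exact (h.1 y).trans (and_congr_right fun hy => (and_iff_right (hA' A hAP y hy)).symm)
      · rintro (i | i)
        · exact iff_of_false id fun hi => hA' A hAP _ hi (hact i)
        · exact h.2 i
    refine ⟨Sum.elim ℓ ℓ', ⟨?_, ?_, ?_, fun A hA' => ?_, fun A hAm y hy hy' => ?_⟩⟩
    · rintro (i | i) (j | j) hij
      · exact congrArg _ (hℓ.inj hij)
      · exact absurd (hact' j) (by
          rw [← show ℓ i = ℓ' j from hij]; exact (hPQ _ (hact i)).1)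
      · exact absurd (hact j) (by
          rw [← show ℓ' i = ℓ j from hij]; exact (hQP _ (hact' i)).1)
      · exact congrArg _ (hℓ'.inj hij)
    · rintro (i | i)
      · exact (hℓ.ty i).imp fun _ h => ⟨List.mem_append_left _ h.1, h.2⟩
      · exact (hℓ'.ty i).imp fun _ h => ⟨List.mem_append_right _ h.1, h.2⟩
    · rintro (k | k)
      · exact (hℓ.edge k).imp fun A h => ⟨List.mem_append_left _ h.1, hM k A h.1 h.2⟩
      · exact (hℓ'.edge k).imp fun A h => ⟨List.mem_append_right _ h.1, hM' k A h.1 h.2⟩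
    · rcases List.mem_append.1 hA' with h | h
      · exact (hℓ.seq A h).elim fun k hk => ⟨.inl k, hM k A h hk⟩
      · exact (hℓ'.seq A h).elim fun k hk => ⟨.inr k, hM' k A h hk⟩
    · rcases List.mem_append.1 hAm with h | h
      · have hy' := (Proc.mem_actNames_par.1 hy').resolve_right (hA A h y hy)
        exact (hℓ.surj A h y hy hy').elim fun i hi => ⟨.inl i, hi⟩
      · have hy' := (Proc.mem_actNames_par.1 hy').resolve_left (hA' A h y hy)
        exact (hℓ'.surj A h y hy hy').elim fun i hi => ⟨.inr i, hi⟩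

variable {lt : T → T → Prop}

/-- Compatibility of the graph in terms of the names of the active restrictions. -/
theorem Proc.ActUniq.compat_iff {P : Proc N (HType T)} (h : P.ActUniq) {θ : N → Option T}
    (hθ : ∀ x τ, (x, τ) ∈ P.actRes → θ x = some τ.base) :
    P.graph.Compat lt ↔
      Hier (optLt lt) θ (EdgeAdj (· ∈ P.actSeq) (fun A u => u ∈ A.fn) (· ∈ P.actNames)) := by
  obtain ⟨ℓ, hℓ⟩ := Proc.exists_labelling h
  have hty : ∀ i, θ (ℓ i) = some (P.graph.ty i) := fun i => by
    obtain ⟨τ, h1, h2⟩ := hℓ.ty i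
    rw [hθ _ _ h1, h2]
  constructor
  · refine fun hc => hc.map ℓ hℓ.inj some (Option.some_injective _) (fun _ _ => optLt_some) hty ?_
    rintro a b ⟨ha, hb, A, hA, haA, hbA⟩
    obtain ⟨i, rfl⟩ := hℓ.surj A hA a haA ha
    obtain ⟨j, rfl⟩ := hℓ.surj A hA b hbA hb
    obtain ⟨k, hk⟩ := hℓ.seq A hA
    exact ⟨i, j, rfl, rfl, k, (hk.2 i).2 haA, (hk.2 j).2 hbA⟩
  · refine fun hc => hc.comap ℓ hℓ.inj some (Option.some_injective _) (fun _ _ => optLt_some) hty ?_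
    rintro i j ⟨k, hi, hj⟩
    obtain ⟨A, hA, hk⟩ := hℓ.edge k
    have hact : ∀ i, ℓ i ∈ P.actNames := fun i =>
      Proc.mem_actNames.2 ((hℓ.ty i).imp fun _ h => h.1)
    exact ⟨hact i, hact j, A, hA, (hk.2 i).1 hi, (hk.2 j).1 hj⟩

theorem Proc.Labelling.tied_of_tied {P : Proc N (HType T)} {ℓ : P.graph.ι → N}
    (hℓ : P.Labelling ℓ) {A B : SeqTerm N (HType T)} (h : P.Tied A B) {k : P.graph.κ}
    (hk : P.IsEdge ℓ k A) : ∃ l, P.IsEdge ℓ l B ∧ P.graph.Tied k l := by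
  induction h with
  | refl => exact ⟨k, hk, .refl⟩
  | @tail B C _ h ih =>
    obtain ⟨l, hl, hkl⟩ := ih
    obtain ⟨hB, hC, x, hx, hxB, hxC⟩ := h
    obtain ⟨m, hm⟩ := hℓ.seq C hC
    obtain ⟨i, rfl⟩ := hℓ.surj C hC x hxC hx
    exact ⟨m, hm, hkl.tail ⟨i, (hl.2 i).2 hxB, (hm.2 i).2 hxC⟩⟩

theorem Proc.Labelling.mem_actNames {P : Proc N (HType T)} {ℓ : P.graph.ι → N}
    (hℓ : P.Labelling ℓ) (i : P.graph.ι) : ℓ i ∈ P.actNames :=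
  Proc.mem_actNames.2 ((hℓ.ty i).imp fun _ h => h.1)

theorem Proc.Labelling.tied_of_graph_tied {P : Proc N (HType T)} {ℓ : P.graph.ι → N}
    (hℓ : P.Labelling ℓ) {k l : P.graph.κ} (h : P.graph.Tied k l) {A : SeqTerm N (HType T)}
    (hA : A ∈ P.actSeq) (hk : P.IsEdge ℓ k A) :
    ∃ B ∈ P.actSeq, P.IsEdge ℓ l B ∧ P.Tied A B := by
  induction h with
  | refl => exact ⟨A, hA, hk, .refl⟩
  | @tail l m _ h ih =>
    obtain ⟨B, hB, hl, hAB⟩ := ih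
    obtain ⟨i, hil, him⟩ := h
    obtain ⟨C, hC, hm⟩ := hℓ.edge m
    exact ⟨C, hC, hm, hAB.tail ⟨hB, hC, ℓ i, hℓ.mem_actNames i, (hl.2 i).1 hil, (hm.2 i).1 him⟩⟩

/-- The graph satisfies `Above` if the side condition of the typing rule for `ν X. ∏ A` holds. -/
theorem Proc.ActUniq.above {P : Proc N (HType T)} (h : P.ActUniq) {Γ : Env N T}
    (hΓ : ∀ A ∈ P.actSeq, ∀ x τ, (x, τ) ∈ P.actRes → P.NameTied x A →
      Γ.Below lt (A.fn \ P.actNames) τ.base) : P.graph.Above lt Γ := by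
  obtain ⟨ℓ, hℓ⟩ := Proc.exists_labelling h
  intro i k l hi hkl y hy σ hσ
  obtain ⟨A, hA, hk⟩ := hℓ.edge k
  obtain ⟨B, hB, hl, hAB⟩ := hℓ.tied_of_graph_tied hkl hA hk
  obtain ⟨τ, hτ, hty⟩ := hℓ.ty i
  rw [← hty]
  exact hΓ B hB _ τ hτ ⟨A, hA, (hk.2 i).1 hi, hAB⟩ y
    (Finset.mem_sdiff.2 ((hl.1 y).1 hy)) σ hσ

theorem Proc.ActUniq.migr {P : Proc N (HType T)} (h : P.ActUniq) {Γ : Env N T} {x a : N} {t : T}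
    (hΓ : ∀ A ∈ P.actSeq, Migratable x P A →
      Γ.Below lt (((A.fn \ P.actNames).erase x).erase a) t) : P.graph.Migr lt Γ x a t := by
  obtain ⟨ℓ, hℓ⟩ := Proc.exists_labelling h
  intro k l hx hkl y hy hyx hya σ hσ
  obtain ⟨A, hA, hk⟩ := hℓ.edge k
  obtain ⟨B, hB, hl, hAB⟩ := hℓ.tied_of_graph_tied hkl hA hk
  exact hΓ B hB ⟨A, hA, ((hk.1 x).1 hx).1, hAB⟩ y (Finset.mem_erase.2 ⟨hya,
    Finset.mem_erase.2 ⟨hyx, Finset.mem_sdiff.2 ((hl.1 y).1 hy)⟩⟩) σ hσ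

/-- The condition `Above` in terms of sequential subterms. -/
theorem Proc.ActUniq.below {P : Proc N (HType T)} (h : P.ActUniq) {Γ : Env N T}
    (hP : P.graph.Above lt Γ) {A B : SeqTerm N (HType T)} (hA : A ∈ P.actSeq) (hAB : P.Tied A B)
    {x y : N} {τ σ : HType T} (hx : (x, τ) ∈ P.actRes) (hxA : x ∈ A.fn) (hy : y ∈ B.fn)
    (hy' : y ∉ P.actNames) (hσ : Γ y = some σ) : lt σ.base τ.base := by
  obtain ⟨ℓ, hℓ⟩ := Proc.exists_labelling h
  obtain ⟨k, hk⟩ := hℓ.seq A hA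
  obtain ⟨l, hl, hkl⟩ := hℓ.tied_of_tied hAB hk
  obtain ⟨i, rfl⟩ := hℓ.surj A hA x hxA (Proc.mem_actNames.2 ⟨τ, hx⟩)
  obtain ⟨τ', hτ', hty⟩ := hℓ.ty i
  -- Active restrictions bind distinct names, so the annotation of `ℓ i` is unique.
  obtain rfl : τ = τ' := congrArg Prod.snd (List.inj_on_of_nodup_map h.1 hx hτ' rfl)
  rw [hty]
  exact hP i k l ((hk.2 i).2 hxA) hkl y ((hl.1 y).2 ⟨hy, hy'⟩) σ hσ

/-- The condition `Migr` in terms of sequential subterms. -/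
theorem Proc.ActUniq.migr_below {P : Proc N (HType T)} (h : P.ActUniq) {Γ : Env N T} {x a : N}
    {t : T} (hP : P.graph.Migr lt Γ x a t) {A B : SeqTerm N (HType T)} (hA : A ∈ P.actSeq)
    (hAB : P.Tied A B) (hx : x ∉ P.actNames) (hxA : x ∈ A.fn) {y : N} {σ : HType T}
    (hy : y ∈ B.fn) (hy' : y ∉ P.actNames) (hyx : y ≠ x) (hya : y ≠ a) (hσ : Γ y = some σ) :
    lt σ.base t := by
  obtain ⟨ℓ, hℓ⟩ := Proc.exists_labelling h
  obtain ⟨k, hk⟩ := hℓ.seq A hA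
  obtain ⟨l, hl, hkl⟩ := hℓ.tied_of_tied hAB hk
  exact hP k l ((hk.1 x).2 ⟨hxA, hx⟩) hkl y ((hl.1 y).2 ⟨hy, hy'⟩) hyx hya σ hσ

end Represent

/-! ## Compatibility and the communication graph -/

section Forest

variable {N : Type u} {T : Type w} {lt : T → T → Prop}

theorem ForestCompat.of_union_left {φ ψ : LForest ((N × T) ⊕ SeqTerm N (HType T))}
    (h : ForestCompat lt (.union φ ψ)) : ForestCompat lt φ := fun s A ht => h s A (.left _ ht)

theorem ForestCompat.of_union_right {φ ψ : LForest ((N × T) ⊕ SeqTerm N (HType T))}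
    (h : ForestCompat lt (.union φ ψ)) : ForestCompat lt ψ := fun s A ht => h s A (.right _ ht)

theorem ForestCompat.of_node {φ : LForest ((N × T) ⊕ SeqTerm N (HType T))} {l}
    (h : ForestCompat lt (.node l φ)) : ForestCompat lt φ := fun s A ht => h s A (.under _ ht)

theorem ForestCompat.union {φ ψ : LForest ((N × T) ⊕ SeqTerm N (HType T))}
    (h : ForestCompat lt φ) (h' : ForestCompat lt ψ) : ForestCompat lt (.union φ ψ) := by
  intro s A ht
  generalize hs : s.map Sum.inl ++ [Sum.inr A] = s' at ht
  cases ht with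
  | root ht =>
    subst hs
    cases ht with
    | left _ ht => exact h s A (.root ht)
    | right _ ht => exact h' s A (.root ht)
  | left _ ht => exact h s A (hs ▸ ht)
  | right _ ht => exact h' s A (hs ▸ ht)

theorem ForestCompat.empty : ForestCompat lt (.empty : LForest ((N × T) ⊕ SeqTerm N (HType T))) := by
  rintro s A (_ | _)
  rename_i h
  cases h

theorem LForest.RootTrace.of_leaf {B A : SeqTerm N (HType T)} {s : List (N × T)}
    (h : (LForest.node (.inr B) .empty).RootTrace (s.map Sum.inl ++ [Sum.inr A])) : s = [] := by
  generalize hs : s.map Sum.inl ++ [Sum.inr A] = s' at h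
  cases h with
  | single => cases s <;> simp_all
  | cons _ h => cases h

theorem LForest.RootTrace.of_node {φ : LForest ((N × T) ⊕ SeqTerm N (HType T))} {p : N × T}
    {A : SeqTerm N (HType T)} {s : List (N × T)}
    (h : (LForest.node (.inl p) φ).RootTrace (s.map Sum.inl ++ [Sum.inr A])) :
    ∃ s', s = p :: s' ∧ φ.RootTrace (s'.map Sum.inl ++ [Sum.inr A]) := by
  generalize hs : s.map Sum.inl ++ [Sum.inr A] = s' at h
  cases h with
  | single => cases s <;> simp_all
  | cons _ h =>
    cases s with
    | nil => simp at hs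
    | cons q s =>
      obtain ⟨h1, rfl⟩ := List.cons.inj hs
      obtain rfl := Sum.inl.inj h1
      exact ⟨s, rfl, h⟩

theorem TreeOrder.isChain_cons (hlt : TreeOrder lt) {a : T} {l : List T} :
    (a :: l).IsChain lt ↔ (∀ b ∈ l, lt a b) ∧ l.IsChain lt := by
  have : IsTrans T lt := ⟨fun _ _ _ => hlt.trans⟩
  rw [List.isChain_iff_pairwise, List.isChain_iff_pairwise, List.pairwise_cons]

theorem ForestCompat.leaf (B : SeqTerm N (HType T)) :
    ForestCompat lt (.node (.inr B) .empty : LForest ((N × T) ⊕ SeqTerm N (HType T))) := by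
  intro s A ht
  generalize hs : s.map Sum.inl ++ [Sum.inr A] = s' at ht
  cases ht with
  | root ht =>
    subst hs
    rw [ht.of_leaf]
    exact .nil
  | under _ ht => exact ForestCompat.empty s A (hs ▸ ht)

theorem ForestCompat.node (hlt : TreeOrder lt) {φ : LForest ((N × T) ⊕ SeqTerm N (HType T))}
    {x : N} {t : T} (h : ForestCompat lt φ)
    (hx : ∀ (s : List (N × T)) (A : SeqTerm N (HType T)),
      φ.RootTrace (s.map Sum.inl ++ [Sum.inr A]) → ∀ p ∈ s, lt t p.2) :
    ForestCompat lt (.node (.inl (x, t)) φ) := by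
  intro s A ht
  generalize hs : s.map Sum.inl ++ [Sum.inr A] = s' at ht
  cases ht with
  | root ht =>
    obtain ⟨s, rfl, ht⟩ := LForest.RootTrace.of_node (hs ▸ ht)
    exact hlt.isChain_cons.2 ⟨fun b hb => by
      obtain ⟨p, hp, rfl⟩ := List.mem_map.1 hb
      exact hx s A ht p hp, h s A (.root ht)⟩
  | under _ ht => exact h s A (hs ▸ ht)

variable [DecidableEq N]

theorem Proc.exists_rootTrace_of_mem_fn {x : N} : ∀ {P : Proc N (HType T)}, x ∈ P.fn →
    ∃ (s : List (N × T)) (A : SeqTerm N (HType T)),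
      (P.forest HType.base).RootTrace (s.map Sum.inl ++ [Sum.inr A])
  | .nil, h => by simp [Proc.fn] at h
  | .res y τ P, h => by
    obtain ⟨s, A, h⟩ := P.exists_rootTrace_of_mem_fn (Finset.mem_of_mem_erase h)
    exact ⟨(y, τ.base) :: s, A, .cons _ h⟩
  | .par P Q, h => by
    rcases Finset.mem_union.1 h with h | h
    · obtain ⟨s, A, h⟩ := P.exists_rootTrace_of_mem_fn h
      exact ⟨s, A, .left _ h⟩
    · obtain ⟨s, A, h⟩ := Q.exists_rootTrace_of_mem_fn h
      exact ⟨s, A, .right _ h⟩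
  | .sum M, _ => ⟨[], .once M, .single _ _⟩
  | .bang M, _ => ⟨[], .repl M, .single _ _⟩

/-- Compatibility of a forest speaks only of traces that end in a sequential term. A vertex stands
for a restriction that is used, so there is a leaf below it and its label does appear on such a
trace. -/
theorem Proc.exists_rootTrace_of_vertex : ∀ (P : Proc N (HType T)) (i : P.graph.ι),
    ∃ (s : List (N × T)) (A : SeqTerm N (HType T)),
      (P.forest HType.base).RootTrace (s.map Sum.inl ++ [Sum.inr A]) ∧
        ∃ p ∈ s, p.2 = P.graph.ty i
  | .nil, i => i.elim
  | .res y τ P, .inl i => by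
    obtain ⟨s, A, h⟩ := P.exists_rootTrace_of_mem_fn ((P.hasName_graph y).1 i.down)
    exact ⟨(y, τ.base) :: s, A, .cons _ h, _, List.mem_cons_self, rfl⟩
  | .res y τ P, .inr i => by
    obtain ⟨s, A, h, p, hp, hpi⟩ := P.exists_rootTrace_of_vertex i
    exact ⟨(y, τ.base) :: s, A, .cons _ h, p, List.mem_cons_of_mem _ hp, hpi⟩
  | .par P Q, .inl i => by
    obtain ⟨s, A, h, hp⟩ := P.exists_rootTrace_of_vertex i
    exact ⟨s, A, .left _ h, hp⟩
  | .par P Q, .inr i => by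
    obtain ⟨s, A, h, hp⟩ := Q.exists_rootTrace_of_vertex i
    exact ⟨s, A, .right _ h, hp⟩
  | .sum M, i => i.elim
  | .bang M, i => i.elim

omit [DecidableEq N] in
-- The label of `x` is smaller than all others, so a path between old vertices at the level of its
-- ends cannot pass through `x`.
theorem HGraph.Compat.res (hlt : TreeOrder lt) {G : HGraph N T} (h : G.Compat lt) (x : N) {t : T}
    (ht : ∀ i, lt t (G.ty i)) : (G.res x t).Compat lt where
  comparable := by
    rintro (i | i) (j | j) ⟨k, hi, hj⟩
    · exact .inr (.inl rfl)
    · exact .inl (ht j)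
    · exact .inr (.inr (ht i))
    · exact h.comparable i j ⟨k, hi, hj⟩
  separated := by
    rintro (i | i) (j | j) hne heq hr
    · exact hne (congrArg Sum.inl (Subsingleton.elim i j))
    · have heq : t = G.ty j := heq
      exact hlt.not_le (ht j) (.inl heq.symm)
    · have heq : G.ty i = t := heq
      exact hlt.not_le (ht i) (.inl heq)
    · have key : ∀ z, Reaches lt (G.res x t).ty (G.res x t).Adj (G.ty i) (.inr i) z →
          ∃ k, z = .inr k ∧ Reaches lt G.ty G.Adj (G.ty i) i k := by
        intro z hz
        induction hz with
        | refl => exact ⟨i, rfl, .refl⟩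
        | @tail y z _ hz ih =>
          obtain ⟨k, rfl, hr⟩ := ih
          rcases z with z | z
          · exact (hlt.not_le (ht i) hz.2).elim
          · exact ⟨z, rfl, hr.tail hz⟩
      obtain ⟨k, hk, hr⟩ := key _ hr
      obtain rfl := Sum.inr.inj hk
      exact h.separated i j (fun h => hne (h ▸ rfl)) heq hr

omit [DecidableEq N] in
theorem HGraph.Compat.par {G H : HGraph N T} (hG : G.Compat lt) (hH : H.Compat lt) :
    (G.par H).Compat lt where
  comparable := by
    rintro (i | i) (j | j) ⟨k | k, hi, hj⟩ <;> try exact hi.elim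
    · exact hG.comparable i j ⟨k, hi, hj⟩
    · exact hj.elim
    · exact hj.elim
    · exact hH.comparable i j ⟨k, hi, hj⟩
  separated := by
    have hl : ∀ t i z, Reaches lt (G.par H).ty (G.par H).Adj t (.inl i) z →
        ∃ j, z = .inl j ∧ Reaches lt G.ty G.Adj t i j := by
      intro t i z hz
      induction hz with
      | refl => exact ⟨i, rfl, .refl⟩
      | @tail y z _ hz ih =>
        obtain ⟨j, rfl, hr⟩ := ih
        obtain ⟨⟨k | k, h1, h2⟩, hle⟩ := hz
        · rcases z with z | z
          · exact ⟨z, rfl, hr.tail ⟨⟨k, h1, h2⟩, hle⟩⟩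
          · exact h2.elim
        · exact h1.elim
    have hr : ∀ t i z, Reaches lt (G.par H).ty (G.par H).Adj t (.inr i) z →
        ∃ j, z = .inr j ∧ Reaches lt H.ty H.Adj t i j := by
      intro t i z hz
      induction hz with
      | refl => exact ⟨i, rfl, .refl⟩
      | @tail y z _ hz ih =>
        obtain ⟨j, rfl, hr⟩ := ih
        obtain ⟨⟨k | k, h1, h2⟩, hle⟩ := hz
        · exact h1.elim
        · rcases z with z | z
          · exact h2.elim
          · exact ⟨z, rfl, hr.tail ⟨⟨k, h1, h2⟩, hle⟩⟩
    rintro (i | i) v hne heq hr'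
    · obtain ⟨j, rfl, hj⟩ := hl _ _ _ hr'
      exact hG.separated i j (fun h => hne (h ▸ rfl)) heq hj
    · obtain ⟨j, rfl, hj⟩ := hr _ _ _ hr'
      exact hH.separated i j (fun h => hne (h ▸ rfl)) heq hj

omit [DecidableEq N] in
theorem HGraph.Compat.of_res {G : HGraph N T} {x : N} {t : T} (h : (G.res x t).Compat lt) :
    G.Compat lt :=
  h.comap Sum.inr Sum.inr_injective id Function.injective_id (fun _ _ => Iff.rfl) (fun _ => rfl)
    fun _ _ ⟨k, hi, hj⟩ => ⟨k, hi, hj⟩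

omit [DecidableEq N] in
theorem HGraph.Compat.of_par {G H : HGraph N T} (h : (G.par H).Compat lt) :
    G.Compat lt ∧ H.Compat lt :=
  ⟨h.comap Sum.inl Sum.inl_injective id Function.injective_id (fun _ _ => Iff.rfl) (fun _ => rfl)
    fun _ _ ⟨k, hi, hj⟩ => ⟨.inl k, hi, hj⟩,
  h.comap Sum.inr Sum.inr_injective id Function.injective_id (fun _ _ => Iff.rfl) (fun _ => rfl)
    fun _ _ ⟨k, hi, hj⟩ => ⟨.inr k, hi, hj⟩⟩

theorem Proc.compat_sum (M : Choice N (HType T)) : (Proc.sum M).graph.Compat lt :=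
  ⟨fun i => i.elim, fun i => i.elim⟩

theorem Proc.compat_bang (M : Choice N (HType T)) : (Proc.bang M).graph.Compat lt :=
  ⟨fun i => i.elim, fun i => i.elim⟩

theorem Proc.compat_nil : (Proc.nil : Proc N (HType T)).graph.Compat lt :=
  ⟨fun i => i.elim, fun i => i.elim⟩

/-- At a restriction, the label of every vertex of the body follows the label of the root on some
trace, hence is larger, and the root can be added to the graph of the body. -/
theorem ForestCompat.compat (hlt : TreeOrder lt) : ∀ {P : Proc N (HType T)},
    ForestCompat lt (P.forest HType.base) → P.graph.Compat lt
  | .nil, _ => Proc.compat_nil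
  | .res x τ P, h => by
    refine (ForestCompat.compat hlt (P := P) h.of_node).res hlt x fun i => ?_
    obtain ⟨s, A, hr, p, hp, hpi⟩ := P.exists_rootTrace_of_vertex i
    have := h ((x, τ.base) :: s) A (.root (.cons _ hr))
    rw [List.map_cons, hlt.isChain_cons] at this
    rw [← hpi]
    exact this.1 _ (List.mem_map_of_mem hp)
  | .par P Q, h => (ForestCompat.compat hlt h.of_union_left).par
      (ForestCompat.compat hlt h.of_union_right)
  | .sum M, _ => Proc.compat_sum M
  | .bang M, _ => Proc.compat_bang M

theorem Proc.TCompat.compat (hlt : TreeOrder lt) {P : Proc N (HType T)}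
    (h : P.TCompat HType.base lt) : P.graph.Compat lt := by
  obtain ⟨Q, hQ, hc⟩ := h
  exact (hQ.similar (lt := lt)).graph.compat (hc.compat hlt)

/-! ### Construction of a compatible forest -/

/-- The parallel composition of a list of terms. -/
def parList : List (Proc N (HType T)) → Proc N (HType T)
  | [] => .nil
  | P :: Ps => .par P (parList Ps)

theorem mem_fn_parList {x : N} {Ps : List (Proc N (HType T))} :
    x ∈ (parList Ps).fn ↔ ∃ P ∈ Ps, x ∈ P.fn := by
  induction Ps with
  | nil => simp [parList, Proc.fn]
  | cons P Ps ih => simp [parList, Proc.fn, ih]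

omit [DecidableEq N] in
theorem rootTrace_parList {s : List ((N × T) ⊕ SeqTerm N (HType T))} :
    ∀ {Ps : List (Proc N (HType T))}, ((parList Ps).forest HType.base).RootTrace s →
      ∃ P ∈ Ps, (P.forest HType.base).RootTrace s
  | [], h => by cases h
  | P :: Ps, h => by
    cases h with
    | left _ h => exact ⟨P, List.mem_cons_self, h⟩
    | right _ h => exact (rootTrace_parList h).imp fun Q h => ⟨List.mem_cons_of_mem _ h.1, h.2⟩

omit [DecidableEq N] in
theorem forestCompat_parList : ∀ {Ps : List (Proc N (HType T))},
    (∀ P ∈ Ps, ForestCompat lt (P.forest HType.base)) →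
      ForestCompat lt ((parList Ps).forest HType.base)
  | [], _ => .empty
  | P :: _, h => (h P List.mem_cons_self).union
      (forestCompat_parList fun Q hQ => h Q (List.mem_cons_of_mem _ hQ))

theorem Proc.Cong.nil_par (P : Proc N (HType T)) : Proc.Cong (.par .nil P) P :=
  .trans (.par_comm _ _) (.par_nil _)

theorem Proc.Cong.par_left_comm (P Q R : Proc N (HType T)) :
    Proc.Cong (.par P (.par Q R)) (.par Q (.par P R)) :=
  .trans (.symm (.par_assoc _ _ _)) (.trans (.par (.par_comm _ _) (.refl _)) (.par_assoc _ _ _))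

theorem Proc.Cong.extrude_left {x : N} {Q : Proc N (HType T)} (hx : x ∉ Q.fn) (τ : HType T)
    (P : Proc N (HType T)) : Proc.Cong (.par (.res x τ P) Q) (.res x τ (.par P Q)) :=
  .trans (.par_comm _ _) (.trans (.extrude _ _ _ _ hx) (.res _ _ (.par_comm _ _)))

theorem parList_filter (p : Proc N (HType T) → Bool) : ∀ Ps : List (Proc N (HType T)),
    (parList Ps).Cong (.par (parList (Ps.filter p)) (parList (Ps.filter fun P => !p P)))
  | [] => .symm (.par_nil _)
  | P :: Ps => by
    have ih := parList_filter p Ps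
    by_cases h : p P
    · simp only [h, List.filter_cons_of_pos, Bool.not_true, Bool.false_eq_true, not_false_eq_true,
        List.filter_cons_of_neg, parList]
      exact .trans (.par (.refl _) ih) (.symm (.par_assoc _ _ _))
    · simp only [h, Bool.false_eq_true, not_false_eq_true, List.filter_cons_of_neg, Bool.not_false,
        List.filter_cons_of_pos, parList]
      exact .trans (.par (.refl _) ih) (.par_left_comm _ _ _)

omit [DecidableEq N] in
theorem news_append (P : Proc N (HType T)) : ∀ X Y : List (N × HType T),
    news (X ++ Y) P = news X (news Y P)
  | [], _ => rfl
  | (_, _) :: X, Y => by rw [List.cons_append, news, news, news_append P X Y]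

theorem Proc.Cong.news {P Q : Proc N (HType T)} (h : P.Cong Q) :
    ∀ X : List (N × HType T), (HierPi.news X P).Cong (HierPi.news X Q)
  | [] => h
  | (x, τ) :: X => .res x τ (Proc.Cong.news h X)

theorem res_news {x : N} (τ : HType T) (P : Proc N (HType T)) : ∀ X : List (N × HType T),
    x ∉ X.map Prod.fst → (Proc.res x τ (news X P)).Cong (news X (.res x τ P))
  | [], _ => .refl _
  | (y, σ) :: X, h => by
    rw [List.map_cons, List.mem_cons, not_or] at h
    exact .trans (.exch _ _ _ _ _ h.1) (.res _ _ (res_news τ P X h.2))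

omit [DecidableEq N] in
theorem exists_maximal_label (hlt : TreeOrder lt) : ∀ X : List (N × HType T), X ≠ [] →
    ∃ p ∈ X, ∀ q ∈ X, ¬ lt p.2.base q.2.base
  | [p], _ => ⟨p, by simp, by simpa using hlt.irrefl _⟩
  | p :: q :: X, _ => by
    obtain ⟨m, hm, hmax⟩ := exists_maximal_label hlt (q :: X) (by simp)
    by_cases h : lt m.2.base p.2.base
    · refine ⟨p, List.mem_cons_self, fun r hr hpr => ?_⟩
      rcases List.mem_cons.1 hr with rfl | hr
      · exact hlt.irrefl _ hpr
      · exact hmax r hr (hlt.trans h hpr)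
    · refine ⟨m, List.mem_cons_of_mem _ hm, fun r hr hmr => ?_⟩
      rcases List.mem_cons.1 hr with rfl | hr
      · exact h hmr
      · exact hmax r hr hmr

/-- Induction on the number of restrictions still to be placed. The terms in `Ps` are the trees
built so far, each acting as one hyperedge on the remaining names. The last hypothesis keeps the
labels in a tree above the remaining names that the tree uses, so that any of these names may be put
on top of it. -/
theorem exists_forestCompat_of_hier (hlt : TreeOrder lt) {θ : N → Option T} (n : ℕ) :
    ∀ (X : List (N × HType T)), X.length = n → (X.map Prod.fst).Nodup →
      (∀ p ∈ X, θ p.1 = some p.2.base) → ∀ Ps : List (Proc N (HType T)),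
      Hier (optLt lt) θ (EdgeAdj (· ∈ Ps) (fun P u => u ∈ P.fn) (· ∈ X.map Prod.fst)) →
      (∀ P ∈ Ps, ForestCompat lt (P.forest HType.base)) →
      (∀ P ∈ Ps, ∀ u ∈ X.map Prod.fst, u ∈ P.fn → ∀ (s : List (N × T)) A,
        (P.forest HType.base).RootTrace (s.map Sum.inl ++ [Sum.inr A]) →
          ∀ p ∈ s, optLt lt (θ u) (some p.2)) →
      ∃ Q : Proc N (HType T), Q.Cong (news X (parList Ps)) ∧ ForestCompat lt (Q.forest HType.base) := by
  induction n with
  | zero =>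
    intro X hX _ _ Ps _ hc _
    obtain rfl := List.length_eq_zero_iff.1 hX
    exact ⟨_, .refl _, forestCompat_parList hc⟩
  | succ n ih =>
    intro X hX hnd hθ Ps hH hc hl
    -- A restriction with a maximal label goes innermost: it is put directly above the terms that
    -- use it.
    obtain ⟨⟨x, τ⟩, hp, hmax⟩ := exists_maximal_label hlt X (by rintro rfl; simp at hX)
    obtain ⟨L, R, rfl⟩ := List.append_of_mem hp
    have hθx : θ x = some τ.base := hθ _ hp
    have hxLR : x ∉ (L ++ R).map Prod.fst := by
      have : ((L ++ (x, τ) :: R).map Prod.fst).Perm (x :: (L ++ R).map Prod.fst) := by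
        simp
      exact (List.nodup_cons.1 (this.nodup_iff.1 hnd)).1
    have hsub : ∀ p ∈ L ++ R, p ∈ L ++ (x, τ) :: R := by simp +contextual [or_imp]
    have hsub' : ∀ u ∈ (L ++ R).map Prod.fst, u ∈ (L ++ (x, τ) :: R).map Prod.fst :=
      fun u hu => List.map_subset _ hsub hu
    have hxm : x ∈ (L ++ (x, τ) :: R).map Prod.fst := List.mem_map_of_mem hp
    have hne : ∀ u ∈ (L ++ R).map Prod.fst, u ≠ x := fun u hu h => hxLR (h ▸ hu)
    let Pin := Ps.filter fun P => decide (x ∈ P.fn)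
    let Pout := Ps.filter fun P => !decide (x ∈ P.fn)
    have hin : ∀ P, P ∈ Pin ↔ P ∈ Ps ∧ x ∈ P.fn := by simp [Pin]
    have hout : ∀ P, P ∈ Pout ↔ P ∈ Ps ∧ x ∉ P.fn := by simp [Pout]
    -- Neighbours of `x` are strictly smaller: they are comparable to `x`, equal labels are never
    -- adjacent at distinct vertices, and `x` is maximal.
    have hltx : ∀ u ∈ (L ++ R).map Prod.fst, ∀ P ∈ Pin, u ∈ P.fn → optLt lt (θ u) (θ x) := by
      intro u hu P hP huP
      obtain ⟨hP, hxP⟩ := (hin P).1 hP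
      have hadj : EdgeAdj (· ∈ Ps) (fun P u => u ∈ P.fn) (· ∈ (L ++ (x, τ) :: R).map Prod.fst) u x :=
        ⟨hsub' u hu, hxm, P, hP, huP, hxP⟩
      rcases hH.comparable _ _ hadj with h | h | h
      · exact h
      · exact (hH.separated _ _ (hne u hu) h (.single ⟨hadj, .inl h⟩)).elim
      · obtain ⟨⟨y, σ⟩, hy, rfl⟩ := List.mem_map.1 (hsub' u hu)
        rw [hθx, hθ _ hy, optLt_some] at h
        exact (hmax _ hy h).elim
    have hxout : x ∉ (parList Pout).fn := by
      rw [mem_fn_parList]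
      rintro ⟨P, hP, hx⟩
      exact ((hout P).1 hP).2 hx
    refine Exists.elim (ih (L ++ R) (by simpa [← add_assoc] using hX)
      (hnd.sublist (List.Sublist.map _ (List.Sublist.append_left (List.sublist_cons_self _ _) _)))
      (fun p hp => hθ p (hsub p hp)) (.res x τ (parList Pin) :: Pout) ?_ ?_ ?_) ?_
    -- The new tree makes all neighbours of `x` adjacent. They were connected through `x`, whose
    -- label is larger.
    · refine hH.of_sim ?_
      rintro u v ⟨hu, hv, P, hP, huP, hvP⟩
      rcases List.mem_cons.1 hP with rfl | hP
      · obtain ⟨P1, hP1, hu1⟩ := mem_fn_parList.1 (Finset.mem_of_mem_erase huP)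
        obtain ⟨P2, hP2, hv2⟩ := mem_fn_parList.1 (Finset.mem_of_mem_erase hvP)
        refine hH.sim_via hlt.option (a := x) ?_ ?_ (.inl (hltx u hu P1 hP1 hu1))
        · exact ⟨hsub' u hu, hxm, P1, ((hin _).1 hP1).1, hu1, ((hin _).1 hP1).2⟩
        · exact ⟨hxm, hsub' v hv, P2, ((hin _).1 hP2).1, ((hin _).1 hP2).2, hv2⟩
      · exact hH.sim ⟨hsub' u hu, hsub' v hv, P, ((hout P).1 hP).1, huP, hvP⟩
    · intro P hP
      rcases List.mem_cons.1 hP with rfl | hP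
      · refine ForestCompat.node hlt (forestCompat_parList fun P hP => hc P ((hin P).1 hP).1) ?_
        intro s A ht p hp
        obtain ⟨P, hP, ht⟩ := rootTrace_parList ht
        have := hl P ((hin P).1 hP).1 x hxm ((hin P).1 hP).2 s A ht p hp
        rwa [hθx, optLt_some] at this
      · exact hc P ((hout P).1 hP).1
    · intro P hP u hu huP s A ht p hp
      rcases List.mem_cons.1 hP with rfl | hP
      · obtain ⟨P1, hP1, hu1⟩ := mem_fn_parList.1 (Finset.mem_of_mem_erase huP)
        have hux := hltx u hu P1 hP1 hu1
        obtain ⟨s, rfl, ht'⟩ := ht.of_node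
        rcases List.mem_cons.1 hp with rfl | hp
        · exact hθx ▸ hux
        · obtain ⟨P, hP, ht⟩ := rootTrace_parList ht'
          exact hlt.option.trans hux (hl P ((hin P).1 hP).1 x hxm ((hin P).1 hP).2 s A ht p hp)
      · exact hl P ((hout P).1 hP).1 u (hsub' u hu) huP s A ht p hp
    · rintro Q ⟨hQ, hQc⟩
      refine ⟨Q, hQ.trans ?_, hQc⟩
      -- Up to congruence, the restriction of `x` is moved inwards past `R`, and then its scope is
      -- narrowed to the terms that use `x`.
      rw [news_append, news_append, news]
      refine .news (.trans (.news ?_ R) (.symm (res_news τ _ R ?_))) L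
      · refine .trans (.extrude_left hxout _ _) (.res _ _ (.symm (parList_filter _ _)))
      · exact fun h => hxLR (by rw [List.map_append]; exact List.mem_append_right _ h)

end Forest

-- Restrictions pulled to the top, and compatible terms from compatible graphs

section NormalForms

variable {N : Type u} {T : Type w}

theorem Env.binds_append (Γ : Env N T) [DecidableEq N] : ∀ X Y : List (N × HType T),
    Γ.binds (X ++ Y) = (Γ.binds X).binds Y
  | [], _ => rfl
  | (x, τ) :: X, Y => by rw [List.cons_append, Env.binds, Env.binds, Env.binds_append]

variable [DecidableEq N]

theorem Env.binds_congr {Γ Δ : Env N T} {x : N} (h : Γ x = Δ x) : ∀ X : List (N × HType T),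
    Γ.binds X x = Δ.binds X x := by
  intro X
  induction X generalizing Γ Δ with
  | nil => exact h
  | cons p X ih =>
    refine ih ?_
    simp only [Env.bind, Function.update_apply, h]

theorem Env.binds_of_notMem {Γ : Env N T} {x : N} : ∀ {X : List (N × HType T)},
    x ∉ X.map Prod.fst → Γ.binds X x = Γ x := by
  intro X
  induction X generalizing Γ with
  | nil => exact fun _ => rfl
  | cons p X ih =>
    intro h
    rw [List.map_cons, List.mem_cons, not_or] at h
    rw [Env.binds, ih h.2, Env.bind, Function.update_of_ne h.1]

theorem Env.binds_of_mem {Γ : Env N T} {x : N} {τ : HType T} : ∀ {X : List (N × HType T)},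
    (X.map Prod.fst).Nodup → (x, τ) ∈ X → Γ.binds X x = some τ := by
  intro X
  induction X generalizing Γ with
  | nil => exact fun _ h => absurd h List.not_mem_nil
  | cons p X ih =>
    intro hnd h
    rw [List.map_cons, List.nodup_cons] at hnd
    rcases List.mem_cons.1 h with rfl | h
    · rw [Env.binds, Env.binds_of_notMem hnd.1, Env.bind, Function.update_self]
    · exact ih hnd.2 h

omit [DecidableEq N] in
theorem actRes_news (P : Proc N (HType T)) : ∀ X : List (N × HType T),
    (news X P).actRes = X ++ P.actRes
  | [] => rfl
  | (x, τ) :: X => by rw [news, Proc.actRes, actRes_news P X, List.cons_append]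

omit [DecidableEq N] in
theorem actSeq_news (P : Proc N (HType T)) : ∀ X : List (N × HType T),
    (news X P).actSeq = P.actSeq
  | [] => rfl
  | (x, τ) :: X => by rw [news, Proc.actSeq, actSeq_news P X]

omit [DecidableEq N] in
theorem actRes_toProc (A : SeqTerm N (HType T)) : A.toProc.actRes = [] := by cases A <;> rfl

omit [DecidableEq N] in
theorem actSeq_toProc (A : SeqTerm N (HType T)) : A.toProc.actSeq = [A] := by cases A <;> rfl

theorem fn_toProc (A : SeqTerm N (HType T)) : A.toProc.fn = A.fn := by cases A <;> rfl

theorem mem_fn_news {x : N} {P : Proc N (HType T)} : ∀ {X : List (N × HType T)},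
    x ∈ (news X P).fn ↔ x ∈ P.fn ∧ x ∉ X.map Prod.fst
  | [] => by simp [news]
  | (y, τ) :: X => by
    rw [news, Proc.fn, Finset.mem_erase, mem_fn_news, List.map_cons, List.mem_cons, not_or]
    tauto

omit [DecidableEq N] in
theorem actRes_parList : ∀ As : List (SeqTerm N (HType T)),
    (parList (As.map SeqTerm.toProc)).actRes = []
  | [] => rfl
  | A :: As => by rw [List.map_cons, parList, Proc.actRes, actRes_toProc, actRes_parList As]; rfl

omit [DecidableEq N] in
theorem actSeq_parList : ∀ As : List (SeqTerm N (HType T)),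
    (parList (As.map SeqTerm.toProc)).actSeq = As
  | [] => rfl
  | A :: As => by rw [List.map_cons, parList, Proc.actSeq, actSeq_toProc, actSeq_parList As]; rfl

theorem actUniq_news {X : List (N × HType T)} (hX : (X.map Prod.fst).Nodup) {P : Proc N (HType T)}
    (hP : P.actRes = []) : (news X P).ActUniq := by
  refine ⟨by rwa [actRes_news, hP, List.append_nil], fun x hx hx' => ?_⟩
  rw [Proc.actNames, List.mem_toFinset, actRes_news, hP, List.append_nil] at hx
  exact (mem_fn_news.1 hx').2 hx

/-- Apply `f` to the names of a sequential term. -/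
def SeqTerm.rename (f : N → N) : SeqTerm N (HType T) → SeqTerm N (HType T)
  | .once M => .once (M.rename f)
  | .repl M => .repl (M.rename f)

omit [DecidableEq N] in
theorem rename_parList (f : N → N) : ∀ As : List (SeqTerm N (HType T)),
    (parList (As.map SeqTerm.toProc)).rename f =
      parList ((As.map (SeqTerm.rename f)).map SeqTerm.toProc)
  | [] => rfl
  | A :: As => by
    rw [List.map_cons, parList, Proc.rename, rename_parList f As]
    cases A <;> rfl

omit [DecidableEq N] in
theorem rename_news {f : N → N} (P : Proc N (HType T)) : ∀ {X : List (N × HType T)},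
    (∀ x ∈ X.map Prod.fst, f x = x) → (news X P).rename f = news X (P.rename f)
  | [], _ => rfl
  | (x, τ) :: X, h => by
    rw [news, Proc.rename, rename_news P fun y hy => h y (List.mem_cons_of_mem _ hy),
      h x List.mem_cons_self, news]

theorem Proc.Cong.fn_eq {P Q : Proc N (HType T)} (h : P.Cong Q) : P.fn = Q.fn :=
  (h.similar (lt := fun _ _ => False)).fn

theorem news_par {P Q : Proc N (HType T)} : ∀ {X : List (N × HType T)},
    (∀ x ∈ X.map Prod.fst, x ∉ Q.fn) → (Proc.par (news X P) Q).Cong (news X (.par P Q))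
  | [], _ => .refl _
  | (x, _) :: _, h => .trans (.extrude_left (h x List.mem_cons_self) _ _)
      (.res _ _ (news_par fun y hy => h y (List.mem_cons_of_mem _ hy)))

theorem par_news {P Q : Proc N (HType T)} {X : List (N × HType T)}
    (h : ∀ x ∈ X.map Prod.fst, x ∉ P.fn) : (Proc.par P (news X Q)).Cong (news X (.par P Q)) :=
  .trans (.par_comm _ _) (.trans (news_par h) (.news (.par_comm _ _) X))

theorem parList_append (Ps Qs : List (Proc N (HType T))) :
    (parList (Ps ++ Qs)).Cong (.par (parList Ps) (parList Qs)) := by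
  induction Ps with
  | nil => exact .symm (.nil_par _)
  | cons P Ps ih => exact .trans (.par (.refl _) ih) (.symm (.par_assoc _ _ _))

/-- Every term is congruent to `ν X. (A₁ ∥ ⋯ ∥ Aₘ)` with distinct names `X` outside a given finite
set. -/
theorem Proc.exists_cong_news [Infinite N] : ∀ (P : Proc N (HType T)) (F : Finset N),
    ∃ (X : List (N × HType T)) (As : List (SeqTerm N (HType T))), (X.map Prod.fst).Nodup ∧
      (∀ x ∈ X.map Prod.fst, x ∉ F) ∧ P.Cong (news X (parList (As.map SeqTerm.toProc)))
  | .nil, _ => ⟨[], [], List.nodup_nil, by simp, .refl _⟩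
  | .sum M, _ => ⟨[], [.once M], List.nodup_nil, by simp, .symm (.par_nil _)⟩
  | .bang M, _ => ⟨[], [.repl M], List.nodup_nil, by simp, .symm (.par_nil _)⟩
  | .res x τ P, F => by
    -- As `x` may lie in `F`, it is renamed to a fresh `y`. The inner restrictions avoid both names
    -- and are therefore fixed by the transposition.
    obtain ⟨y, hy⟩ := Infinite.exists_notMem_finset (insert x (F ∪ P.fn))
    obtain ⟨X, As, hnd, hF, hc⟩ := P.exists_cong_news (insert x (insert y F))
    simp only [Finset.mem_insert, Finset.mem_union, not_or] at hy hF
    refine ⟨(y, τ) :: X, As.map (SeqTerm.rename (Equiv.swap x y)), ?_, ?_, ?_⟩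
    · rw [List.map_cons, List.nodup_cons]
      exact ⟨fun h => (hF y h).2.1 rfl, hnd⟩
    · rintro z hz
      rcases List.mem_cons.1 hz with rfl | hz
      · exact hy.2.1
      · exact (hF z hz).2.2
    · refine .trans (.res x τ hc) (.trans (.alpha x y τ _ (hc.fn_eq ▸ hy.2.2)) ?_)
      rw [rename_news _ fun z hz => Equiv.swap_apply_of_ne_of_ne (hF z hz).1 (hF z hz).2.1,
        rename_parList]
      exact .refl _
  | .par P Q, F => by
    -- The names for `Q` are chosen first, so that those for `P` can avoid them. Each side also
    -- avoids the free names of the other one, which permits scope extrusion.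
    obtain ⟨Y, Bs, hndY, hFY, hcY⟩ := Q.exists_cong_news (F ∪ P.fn)
    obtain ⟨X, As, hndX, hFX, hcX⟩ := P.exists_cong_news (F ∪ Q.fn ∪ (Y.map Prod.fst).toFinset)
    simp only [Finset.mem_union, not_or, List.mem_toFinset] at hFX hFY
    refine ⟨X ++ Y, As ++ Bs, ?_, ?_, ?_⟩
    · rw [List.map_append, List.nodup_append]
      exact ⟨hndX, hndY, fun a ha b hb h => (hFX a ha).2 (h ▸ hb)⟩
    · intro z hz
      rw [List.map_append, List.mem_append] at hz
      exact hz.elim (fun h => (hFX z h).1.1) fun h => (hFY z h).1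
    · refine .trans (.par hcX hcY) (.trans (news_par fun x hx => ?_) ?_)
      · rw [← hcY.fn_eq]
        exact (hFX x hx).1.2
      · rw [news_append, List.map_append]
        refine .news (.trans (par_news fun y hy hyA => ?_) (.news (.symm (parList_append _ _)) Y)) X
        refine (hFY y hy).2 (hcX.fn_eq ▸ mem_fn_news.2 ⟨hyA, fun h => (hFX y h).2 hy⟩)

variable {lt : T → T → Prop}

/-- In the form with all active restrictions on top, the components are single leaves, so the
conditions on trees in `exists_forestCompat_of_hier` hold trivially at the start. -/
theorem Proc.tCompat_of_compat [Infinite N] (hlt : TreeOrder lt) {P : Proc N (HType T)}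
    (h : P.graph.Compat lt) : P.TCompat HType.base lt := by
  obtain ⟨X, As, hnd, -, hc⟩ := P.exists_cong_news ∅
  have hu := actUniq_news hnd (actRes_parList As)
  let θ : N → Option T := fun x => (Env.binds (fun _ => none) X x).map HType.base
  have hθ : ∀ x τ, (x, τ) ∈ X → θ x = some τ.base := fun x τ hx => by
    simp only [θ, Env.binds_of_mem hnd hx, Option.map_some]
  have hres : (news X (parList (As.map SeqTerm.toProc))).actRes = X := by
    rw [actRes_news, actRes_parList, List.append_nil]
  have hH := (hu.compat_iff (θ := θ) (by rwa [hres])).1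
    ((hc.similar (lt := lt)).graph.compat h)
  refine Exists.elim (exists_forestCompat_of_hier hlt X.length X rfl hnd
    (fun p hp => hθ p.1 p.2 hp) (As.map SeqTerm.toProc) (hH.mono ?_) ?_ ?_) ?_
  · rintro u v ⟨hu, hv, P, hP, huP, hvP⟩
    obtain ⟨A, hA, rfl⟩ := List.mem_map.1 hP
    rw [fn_toProc] at huP hvP
    rw [EdgeAdj, actSeq_news, actSeq_parList, Proc.actNames, hres, List.mem_toFinset,
      List.mem_toFinset]
    exact ⟨hu, hv, A, hA, huP, hvP⟩
  · intro P hP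
    obtain ⟨A, -, rfl⟩ := List.mem_map.1 hP
    cases A <;> exact ForestCompat.leaf _
  · intro P hP u _ _ s B ht p hp
    obtain ⟨A, -, rfl⟩ := List.mem_map.1 hP
    have : s = [] := by cases A <;> exact LForest.RootTrace.of_leaf ht
    simp [this] at hp
  · exact fun Q ⟨hQ, hQc⟩ => ⟨Q, hQ.trans hc.symm, hQc⟩

/-! ## The invariant -/

mutual
-- The graph of an active subterm embeds in the graph of the term, except below a prefix; there
-- `Sat` supplies the compatibility of the continuation.
theorem Proc.Sat.compat_subterms : ∀ {P : Proc N (HType T)} {Γ : Env N T}, P.Sat lt Γ →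
    P.graph.Compat lt → ∀ Q ∈ P.subterms, Q.graph.Compat lt
  | .nil, _, _, h, Q, hQ => by
    obtain rfl := List.mem_singleton.1 hQ
    exact h
  | .res x τ P, _, hs, h, Q, hQ => by
    rcases List.mem_cons.1 hQ with rfl | hQ
    · exact h
    · exact Proc.Sat.compat_subterms (P := P) hs (HGraph.Compat.of_res h) Q hQ
  | .par P P', _, hs, h, Q, hQ => by
    rcases List.mem_cons.1 hQ with rfl | hQ
    · exact h
    · rcases List.mem_append.1 hQ with hQ | hQ
      · exact hs.1.compat_subterms (HGraph.Compat.of_par h).1 Q hQ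
      · exact hs.2.compat_subterms (HGraph.Compat.of_par h).2 Q hQ
  | .sum M, _, hs, _, Q, hQ => Choice.Sat.compat_subterms (M := M) hs Q hQ
  | .bang M, _, hs, h, Q, hQ => by
    rcases List.mem_cons.1 hQ with rfl | hQ
    · exact h
    · exact Choice.Sat.compat_subterms (M := M) hs Q hQ
theorem Choice.Sat.compat_subterms : ∀ {M : Choice N (HType T)} {Γ : Env N T}, M.Sat lt Γ →
    ∀ Q ∈ M.subterms, Q.graph.Compat lt
  | .pre (.inp a x) P, _, hs, Q, hQ => by
    obtain ⟨t, τ, -, hc, -, hs, -⟩ := hs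
    rcases List.mem_cons.1 hQ with rfl | hQ
    · exact Proc.compat_sum _
    · exact hs.compat_subterms hc Q hQ
  | .pre (.out a b) P, _, hs, Q, hQ => by
    obtain ⟨-, hc, -, hs⟩ := hs
    rcases List.mem_cons.1 hQ with rfl | hQ
    · exact Proc.compat_sum _
    · exact hs.compat_subterms hc Q hQ
  | .pre .tau P, _, hs, Q, hQ => by
    obtain ⟨hc, -, hs⟩ := hs
    rcases List.mem_cons.1 hQ with rfl | hQ
    · exact Proc.compat_sum _
    · exact hs.compat_subterms hc Q hQ
  | .plus M M', _, hs, Q, hQ => by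
    rcases List.mem_cons.1 hQ with rfl | hQ
    · exact Proc.compat_sum _
    · rcases List.mem_append.1 hQ with hQ | hQ
      · exact hs.1.compat_subterms Q hQ
      · exact hs.2.compat_subterms Q hQ
end

omit [DecidableEq N] in
theorem Proc.mem_subterms_self (P : Proc N (HType T)) : P ∈ P.subterms := by
  cases P with
  | sum M => cases M <;> exact List.mem_cons_self
  | nil => exact List.mem_singleton_self _
  | _ => exact List.mem_cons_self

omit [DecidableEq N] in
theorem Proc.actRes_sublist_bn : ∀ P : Proc N (HType T), (P.actRes.map Prod.fst).Sublist P.bn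
  | .nil => List.Sublist.refl _
  | .res _ _ P => P.actRes_sublist_bn.cons_cons _
  | .par P Q => by
    rw [Proc.actRes, List.map_append]
    exact P.actRes_sublist_bn.append Q.actRes_sublist_bn
  | .sum _ => List.nil_sublist _
  | .bang _ => List.nil_sublist _

theorem Proc.NameUniq.actUniq {P : Proc N (HType T)} (h : P.NameUniq) : P.ActUniq :=
  ⟨h.1.sublist P.actRes_sublist_bn, fun x hx hx' =>
    h.2 x hx' (P.actRes_sublist_bn.subset (List.mem_toFinset.1 hx))⟩

/-- Every name is bound at most once in the choice, and no name is both free and bound. -/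
def Choice.NameUniq (M : Choice N (HType T)) : Prop := M.bn.Nodup ∧ ∀ x ∈ M.fn, x ∉ M.bn

theorem Proc.NameUniq.res {x : N} {τ : HType T} {P : Proc N (HType T)}
    (h : (Proc.res x τ P).NameUniq) : P.NameUniq := by
  have hx := (List.nodup_cons.1 h.1)
  refine ⟨hx.2, fun y hy hyb => h.2 y (Finset.mem_erase.2 ⟨?_, hy⟩) (List.mem_cons_of_mem _ hyb)⟩
  rintro rfl
  exact hx.1 hyb

theorem Proc.NameUniq.par {P Q : Proc N (HType T)} (h : (Proc.par P Q).NameUniq) :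
    P.NameUniq ∧ Q.NameUniq :=
  ⟨⟨(List.nodup_append.1 h.1).1, fun x hx hxb =>
    h.2 x (Finset.mem_union_left _ hx) (List.mem_append_left _ hxb)⟩,
  ⟨(List.nodup_append.1 h.1).2.1, fun x hx hxb =>
    h.2 x (Finset.mem_union_right _ hx) (List.mem_append_right _ hxb)⟩⟩

theorem Choice.NameUniq.plus {M M' : Choice N (HType T)} (h : (Choice.plus M M').NameUniq) :
    M.NameUniq ∧ M'.NameUniq :=
  ⟨⟨(List.nodup_append.1 h.1).1, fun x hx hxb =>
    h.2 x (Finset.mem_union_left _ hx) (List.mem_append_left _ hxb)⟩,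
  ⟨(List.nodup_append.1 h.1).2.1, fun x hx hxb =>
    h.2 x (Finset.mem_union_right _ hx) (List.mem_append_right _ hxb)⟩⟩

theorem Choice.NameUniq.inp {a x : N} {P : Proc N (HType T)}
    (h : (Choice.pre (.inp a x) P).NameUniq) : P.NameUniq ∧ x ∉ P.bn ∧ a ≠ x := by
  have hx := (List.nodup_cons.1 h.1)
  refine ⟨⟨hx.2, fun y hy hyb => h.2 y ?_ (List.mem_cons_of_mem _ hyb)⟩, hx.1, ?_⟩
  · refine Finset.mem_insert_of_mem (Finset.mem_erase.2 ⟨?_, hy⟩)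
    rintro rfl
    exact hx.1 hyb
  · rintro rfl
    exact h.2 a (Finset.mem_insert_self _ _) List.mem_cons_self

theorem Choice.NameUniq.out {a b : N} {P : Proc N (HType T)}
    (h : (Choice.pre (.out a b) P).NameUniq) : P.NameUniq :=
  ⟨h.1, fun y hy => h.2 y (Finset.mem_insert_of_mem (Finset.mem_insert_of_mem hy))⟩

mutual
-- `Typed` adds all active restrictions to the environment at once, `Sat` one at a time. Here `Δ` is
-- the environment of the whole normal form, and while the term is taken apart the local environment
-- must agree with it only on names that the components use. For parallel compositions this relies
-- on neither side using names restricted on the other.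
theorem Proc.sat_of_typedSeq : ∀ {P : Proc N (HType T)} {Γ Δ : Env N T}, P.NameUniq →
    (∀ A ∈ P.actSeq, TypedSeq lt Δ A) →
    (∀ A ∈ P.actSeq, ∀ n ∈ A.fn, Γ.binds P.actRes n = Δ n) →
    (∀ Q ∈ P.subterms, Q.graph.Compat lt) → P.Sat lt Γ
  | .nil, _, _, _, _, _, _ => trivial
  | .res x τ P, _, _, hn, ht, hΔ, hc =>
    Proc.sat_of_typedSeq (P := P) hn.res ht hΔ fun Q hQ => hc Q (List.mem_cons_of_mem _ hQ)
  | .par P Q, Γ, _, hn, ht, hΔ, hc => by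
    obtain ⟨-, -, hPQ, hQP⟩ := hn.actUniq.par
    simp only [Proc.actRes, Env.binds_append] at hΔ
    constructor
    · refine Proc.sat_of_typedSeq hn.par.1 (fun A hA => ht A (List.mem_append_left _ hA))
        (fun A hA n hnA => ?_)
        fun R hR => hc R (List.mem_cons_of_mem _ (List.mem_append_left _ hR))
      rw [← hΔ A (List.mem_append_left _ hA) n hnA, Env.binds_of_notMem (X := Q.actRes)]
      intro hnQ
      have hnQ := hQP n (List.mem_toFinset.2 hnQ)
      exact (Proc.fn_subset_of_mem_actSeq hA n hnA).elim hnQ.2 hnQ.1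
    · refine Proc.sat_of_typedSeq hn.par.2 (fun A hA => ht A (List.mem_append_right _ hA))
        (fun A hA n hnA => ?_)
        fun R hR => hc R (List.mem_cons_of_mem _ (List.mem_append_right _ hR))
      rw [← hΔ A (List.mem_append_right _ hA) n hnA]
      refine Env.binds_congr (Env.binds_of_notMem fun hnP => ?_).symm _
      have hnP := hPQ n (List.mem_toFinset.2 hnP)
      exact (Proc.fn_subset_of_mem_actSeq hA n hnA).elim hnP.2 hnP.1
  | .sum M, _, _, hn, ht, hΔ, hc => by
    cases ht _ (List.mem_singleton_self _) with
    | once ht =>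
      exact (Choice.sat_of_typed (M := M) hn ht hc).congr_env
        fun n hn => (hΔ _ (List.mem_singleton_self _) n hn).symm
  | .bang M, _, _, hn, ht, hΔ, hc => by
    cases ht _ (List.mem_singleton_self _) with
    | repl ht =>
      exact (Choice.sat_of_typed (M := M) hn ht
        fun Q hQ => hc Q (List.mem_cons_of_mem _ hQ)).congr_env
        fun n hn => (hΔ _ (List.mem_singleton_self _) n hn).symm
theorem Choice.sat_of_typed : ∀ {M : Choice N (HType T)} {Γ : Env N T}, M.NameUniq →
    TypedChoice lt Γ M → (∀ Q ∈ M.subterms, Q.graph.Compat lt) → M.Sat lt Γ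
  | .pre (.inp a x) P, _, hn, ht, hc => by
    have hc : ∀ Q ∈ P.subterms, Q.graph.Compat lt := fun Q hQ => hc Q (List.mem_cons_of_mem _ hQ)
    cases ht with
    | inp ha ht hm =>
      cases ht with
      | par h1 h2 =>
        exact ⟨_, _, ha, hc P P.mem_subterms_self, hn.inp.1.actUniq.above h2,
          Proc.sat_of_typedSeq hn.inp.1 h1 (fun _ _ _ _ => rfl) hc,
          hm.imp_right hn.inp.1.actUniq.migr⟩
  | .pre (.out a b) P, _, hn, ht, hc => by
    have hc : ∀ Q ∈ P.subterms, Q.graph.Compat lt := fun Q hQ => hc Q (List.mem_cons_of_mem _ hQ)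
    cases ht with
    | out ha hb ht =>
      cases ht with
      | par h1 h2 =>
        exact ⟨⟨_, _, ha, hb⟩, hc P P.mem_subterms_self, hn.out.actUniq.above h2,
          Proc.sat_of_typedSeq hn.out h1 (fun _ _ _ _ => rfl) hc⟩
  | .pre .tau P, _, hn, ht, hc => by
    have hc : ∀ Q ∈ P.subterms, Q.graph.Compat lt := fun Q hQ => hc Q (List.mem_cons_of_mem _ hQ)
    have hn : P.NameUniq := hn
    cases ht with
    | tau ht =>
      cases ht with
      | par h1 h2 =>
        exact ⟨hc P P.mem_subterms_self, hn.actUniq.above h2,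
          Proc.sat_of_typedSeq hn h1 (fun _ _ _ _ => rfl) hc⟩
  | .plus M M', _, hn, ht, hc => by
    cases ht with
    | plus ht ht' =>
      exact ⟨Choice.sat_of_typed hn.plus.1 ht
        fun Q hQ => hc Q (List.mem_cons_of_mem _ (List.mem_append_left _ hQ)),
        Choice.sat_of_typed hn.plus.2 ht'
        fun Q hQ => hc Q (List.mem_cons_of_mem _ (List.mem_append_right _ hQ))⟩
end

mutual
theorem Proc.UsedType.mem_allRes {t : T} : ∀ {P : Proc N (HType T)}, P.UsedType t →
    ∃ p ∈ P.allRes, p.2.base = t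
  | .nil, h => h.elim
  | .res x τ P, h => by
    rcases h with h | h
    · exact ⟨(x, τ), List.mem_cons_self, h.2⟩
    · exact (Proc.UsedType.mem_allRes h).imp fun p h => ⟨List.mem_cons_of_mem _ h.1, h.2⟩
  | .par P Q, h => by
    rcases h with h | h
    · exact (Proc.UsedType.mem_allRes h).imp fun p h => ⟨List.mem_append_left _ h.1, h.2⟩
    · exact (Proc.UsedType.mem_allRes h).imp fun p h => ⟨List.mem_append_right _ h.1, h.2⟩
  | .sum M, h => Choice.UsedType.mem_allRes (M := M) h
  | .bang M, h => Choice.UsedType.mem_allRes (M := M) h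
theorem Choice.UsedType.mem_allRes {t : T} : ∀ {M : Choice N (HType T)}, M.UsedType t →
    ∃ p ∈ M.allRes, p.2.base = t
  | .pre _ P, h => Proc.UsedType.mem_allRes (P := P) h
  | .plus M M', h => by
    rcases h with h | h
    · exact (Choice.UsedType.mem_allRes h).imp fun p h => ⟨List.mem_append_left _ h.1, h.2⟩
    · exact (Choice.UsedType.mem_allRes h).imp fun p h => ⟨List.mem_append_right _ h.1, h.2⟩
end

/-- The invariant of reduction. In contrast to `Env.Safe`, restrictions of names that are not used
are ignored, as structural congruence can add them with any annotation. -/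
structure Proc.Inv (lt : T → T → Prop) (Γ : Env N T) (P : Proc N (HType T)) : Prop where
  compat : P.graph.Compat lt
  sat : P.Sat lt Γ
  safe : ∀ x ∈ P.fn, ∀ t, P.UsedType t → ∀ σ, Γ x = some σ → lt σ.base t

theorem Proc.Inv.of_cong {Γ : Env N T} {P Q : Proc N (HType T)} (h : P.Inv lt Γ) (hPQ : P.Cong Q) :
    Q.Inv lt Γ := by
  have hs := hPQ.similar (lt := lt)
  exact ⟨hs.graph.compat h.compat, (hs.sat Γ).1 h.sat, fun x hx t ht =>
    h.safe x (hs.fn ▸ hx) t ((hs.used t).2 ht)⟩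

theorem Proc.Inv.tShaped [Infinite N] (hlt : TreeOrder lt) {Γ : Env N T} {P : Proc N (HType T)}
    (h : P.Inv lt Γ) : P.TShaped HType.base lt := fun Q hQ =>
  Proc.tCompat_of_compat hlt (h.sat.compat_subterms h.compat Q hQ)

theorem Proc.inv_of_typed (hlt : TreeOrder lt) {Γ : Env N T} {P : Proc N (HType T)}
    (hP : P.NameUniq) (hsafe : Γ.Safe lt P) (ht : Typed lt Γ P)
    (hs : P.TShaped HType.base lt) : P.Inv lt Γ := by
  have hc : ∀ Q ∈ P.subterms, Q.graph.Compat lt := fun Q hQ => (hs Q hQ).compat hlt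
  refine ⟨hc P P.mem_subterms_self, ?_, fun x hx t hu σ hσ => ?_⟩
  · cases ht with
    | par h1 h2 => exact Proc.sat_of_typedSeq hP h1 (fun _ _ _ _ => rfl) hc
  · obtain ⟨⟨y, τ⟩, hy, rfl⟩ := hu.mem_allRes
    exact hsafe x hx y τ hy σ hσ

end NormalForms

-- Normal forms given by lists, substitution as renaming, and silent steps

section Reduction

variable {N : Type u} {T : Type w}

theorem actRes_prod : ∀ As : List (SeqTerm N (HType T)), (prod As).actRes = []
  | [] => rfl
  | [A] => actRes_toProc A
  | A :: B :: As => by rw [prod, Proc.actRes, actRes_toProc, actRes_prod (B :: As)]; rfl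

theorem actSeq_prod : ∀ As : List (SeqTerm N (HType T)), (prod As).actSeq = As
  | [] => rfl
  | [A] => actSeq_toProc A
  | A :: B :: As => by rw [prod, Proc.actSeq, actSeq_toProc, actSeq_prod (B :: As)]; rfl

theorem bn_prod : ∀ As : List (SeqTerm N (HType T)),
    (prod As).bn = As.flatMap fun A => A.toProc.bn
  | [] => rfl
  | [A] => by simp [prod]
  | A :: B :: As => by rw [prod, Proc.bn, bn_prod (B :: As), List.flatMap_cons (x := A)]

theorem bn_news (P : Proc N (HType T)) : ∀ X : List (N × HType T),
    (news X P).bn = X.map Prod.fst ++ P.bn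
  | [] => rfl
  | (x, τ) :: X => by rw [news, Proc.bn, bn_news P X]; rfl

theorem actRes_nform (X : List (N × HType T)) (As : List (SeqTerm N (HType T))) :
    (nform X As).actRes = X := by
  rw [nform, actRes_news, actRes_prod, List.append_nil]

theorem actSeq_nform (X : List (N × HType T)) (As : List (SeqTerm N (HType T))) :
    (nform X As).actSeq = As := by
  rw [nform, actSeq_news, actSeq_prod]

theorem bn_nform (X : List (N × HType T)) (As : List (SeqTerm N (HType T))) :
    (nform X As).bn = X.map Prod.fst ++ As.flatMap fun A => A.toProc.bn := by
  rw [nform, bn_news, bn_prod]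

variable [DecidableEq N]

theorem mem_actNames_nform {x : N} {X : List (N × HType T)} {As : List (SeqTerm N (HType T))} :
    x ∈ (nform X As).actNames ↔ x ∈ X.map Prod.fst := by
  rw [Proc.actNames, List.mem_toFinset, actRes_nform]

theorem mem_fn_prod {x : N} : ∀ {As : List (SeqTerm N (HType T))},
    x ∈ (prod As).fn ↔ ∃ A ∈ As, x ∈ A.fn
  | [] => by simp [prod, Proc.fn]
  | [A] => by simp [prod, fn_toProc]
  | A :: B :: As => by
    rw [prod, Proc.fn, Finset.mem_union, mem_fn_prod, fn_toProc, List.exists_mem_cons_iff (a := A)]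

theorem mem_fn_nform {x : N} {X : List (N × HType T)} {As : List (SeqTerm N (HType T))} :
    x ∈ (nform X As).fn ↔ (∃ A ∈ As, x ∈ A.fn) ∧ x ∉ X.map Prod.fst := by
  rw [nform, mem_fn_news, mem_fn_prod]

theorem actUniq_nform {X : List (N × HType T)} (hX : (X.map Prod.fst).Nodup)
    (As : List (SeqTerm N (HType T))) : (nform X As).ActUniq := actUniq_news hX (actRes_prod As)

variable {lt : T → T → Prop}

theorem sat_news {P : Proc N (HType T)} : ∀ {X : List (N × HType T)} {Γ : Env N T},
    (news X P).Sat lt Γ ↔ P.Sat lt (Γ.binds X)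
  | [], _ => Iff.rfl
  | (_, _) :: X, _ => sat_news (X := X)

theorem sat_prod {Γ : Env N T} : ∀ {As : List (SeqTerm N (HType T))},
    (prod As).Sat lt Γ ↔ ∀ A ∈ As, A.toProc.Sat lt Γ
  | [] => by simp [prod, Proc.Sat]
  | [A] => by simp [prod]
  | A :: B :: As => by rw [prod, Proc.Sat, sat_prod, List.forall_mem_cons (a := A)]

theorem sat_nform {X : List (N × HType T)} {As : List (SeqTerm N (HType T))} {Γ : Env N T} :
    (nform X As).Sat lt Γ ↔ ∀ A ∈ As, A.toProc.Sat lt (Γ.binds X) := by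
  rw [nform, sat_news, sat_prod]

theorem usedType_prod {t : T} : ∀ {As : List (SeqTerm N (HType T))},
    (prod As).UsedType t ↔ ∃ A ∈ As, A.toProc.UsedType t
  | [] => by simp [prod, Proc.UsedType]
  | [A] => by simp [prod]
  | A :: B :: As => by rw [prod, Proc.UsedType, usedType_prod, List.exists_mem_cons_iff (a := A)]

/-- As the names are distinct, no restriction in `X` is shadowed by a later one, so it is used iff
its name is free in `P`. -/
theorem usedType_news {t : T} {P : Proc N (HType T)} : ∀ {X : List (N × HType T)},
    (X.map Prod.fst).Nodup →
    ((news X P).UsedType t ↔ (∃ p ∈ X, p.1 ∈ P.fn ∧ p.2.base = t) ∨ P.UsedType t)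
  | [], _ => by simp [news]
  | (x, τ) :: X, h => by
    rw [List.map_cons, List.nodup_cons] at h
    rw [news, Proc.UsedType, usedType_news h.2, mem_fn_news, and_iff_left h.1,
      List.exists_mem_cons_iff, or_assoc]

theorem usedType_nform {t : T} {X : List (N × HType T)} (hX : (X.map Prod.fst).Nodup)
    {As : List (SeqTerm N (HType T))} : (nform X As).UsedType t ↔
      (∃ p ∈ X, (∃ A ∈ As, p.1 ∈ A.fn) ∧ p.2.base = t) ∨ ∃ A ∈ As, A.toProc.UsedType t := by
  rw [nform, usedType_news hX, usedType_prod]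
  simp only [mem_fn_prod]

theorem Choice.Offers.sat {π : Prefix N} {P : Proc N (HType T)} {M : Choice N (HType T)}
    (h : Choice.Offers π P M) {Γ : Env N T} (hM : M.Sat lt Γ) : (Choice.pre π P).Sat lt Γ := by
  cases h with
  | alone => exact hM
  | plus M => exact hM.1

theorem Choice.Offers.fn {π : Prefix N} {P : Proc N (HType T)} {M : Choice N (HType T)}
    (h : Choice.Offers π P M) : ∀ x ∈ (Choice.pre π P).fn, x ∈ M.fn := by
  cases h with
  | alone => exact fun _ => id
  | plus M => exact fun _ => Finset.mem_union_left _

omit [DecidableEq N] in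
theorem Choice.Offers.bn {π : Prefix N} {P : Proc N (HType T)} {M : Choice N (HType T)}
    (h : Choice.Offers π P M) : ∃ l, M.bn = (Choice.pre π P).bn ++ l := by
  cases h with
  | alone => exact ⟨[], (List.append_nil _).symm⟩
  | plus M => exact ⟨M.bn, rfl⟩

theorem Choice.Offers.usedType {π : Prefix N} {P : Proc N (HType T)} {M : Choice N (HType T)}
    (h : Choice.Offers π P M) {t : T} (ht : P.UsedType t) : M.UsedType t := by
  cases h with
  | alone => exact ht
  | plus M => exact .inl ht

theorem substName_self (x b : N) : substName x b x = b := if_pos rfl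

theorem substName_of_ne {x b y : N} (h : y ≠ x) : substName x b y = y := if_neg h

mutual
-- This makes the lemmas on renaming available for communication: if `x` is not bound, all its
-- occurrences are free.
theorem Proc.subst_eq_rename {x b : N} : ∀ {P : Proc N (HType T)}, x ∉ P.bn →
    P.subst x b = P.rename (substName x b)
  | .nil, _ => rfl
  | .res y τ P, h => by
    rw [Proc.bn, List.mem_cons, not_or] at h
    rw [Proc.subst, Proc.rename, Proc.subst_eq_rename h.2, if_neg (Ne.symm h.1),
      substName_of_ne (Ne.symm h.1)]
  | .par P Q, h => by
    rw [Proc.bn, List.mem_append, not_or] at h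
    rw [Proc.subst, Proc.rename, Proc.subst_eq_rename h.1, Proc.subst_eq_rename h.2]
  | .sum M, h => by rw [Proc.subst, Proc.rename, Choice.subst_eq_rename h]
  | .bang M, h => by rw [Proc.subst, Proc.rename, Choice.subst_eq_rename h]
theorem Choice.subst_eq_rename {x b : N} : ∀ {M : Choice N (HType T)}, x ∉ M.bn →
    M.subst x b = M.rename (substName x b)
  | .pre (.inp a y) P, h => by
    rw [Choice.bn, List.mem_cons, not_or] at h
    rw [Choice.subst, Choice.rename, Prefix.rename, Proc.subst_eq_rename h.2,
      if_neg (Ne.symm h.1), substName_of_ne (Ne.symm h.1)]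
  | .pre (.out a c) P, h => by
    rw [Choice.subst, Choice.rename, Prefix.rename, Proc.subst_eq_rename h]
  | .pre .tau P, h => by
    rw [Choice.subst, Choice.rename, Prefix.rename, Proc.subst_eq_rename h]
  | .plus M M', h => by
    rw [Choice.bn, List.mem_append, not_or] at h
    rw [Choice.subst, Choice.rename, Choice.subst_eq_rename h.1, Choice.subst_eq_rename h.2]
end

theorem toProc_subst {x b : N} {A : SeqTerm N (HType T)} (h : x ∉ A.toProc.bn) :
    (A.subst x b).toProc = A.toProc.rename (substName x b) := by
  rw [← Proc.subst_eq_rename h]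
  cases A <;> rfl

theorem noCapture_substName {x b : N} {L : List N} (hx : x ∉ L) (hb : b ∉ L) :
    NoCapture (substName x b) L := by
  intro y hy n hn
  have hyx : y ≠ x := fun h => hx (h ▸ hy)
  rw [substName_of_ne hyx] at hn
  by_cases h : n = x
  · rw [h, substName_self] at hn
    exact absurd hy (hn ▸ hb)
  · rwa [substName_of_ne h] at hn

theorem mem_fn_subst {x b : N} {A : SeqTerm N (HType T)} (hx : x ∉ A.toProc.bn)
    (hb : b ∉ A.toProc.bn) {y : N} :
    y ∈ (A.subst x b).fn ↔ ∃ n ∈ A.fn, substName x b n = y := by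
  rw [← fn_toProc, toProc_subst hx, Proc.fn_rename _ (noCapture_substName hx hb), fn_toProc,
    Finset.mem_image]

theorem Proc.tied_nform {X : List (N × HType T)} {As : List (SeqTerm N (HType T))}
    {A B : SeqTerm N (HType T)} (h : EdgeTied (· ∈ As) (fun A u => u ∈ A.fn) (· ∈ X.map Prod.fst) A B) :
    (nform X As).Tied A B := by
  refine ReflTransGen.mono (fun A B h => ?_) _ _ h
  obtain ⟨hA, hB, y, hy, hyA, hyB⟩ := h
  rw [Proc.Linked, actSeq_nform]
  exact ⟨hA, hB, y, mem_actNames_nform.2 hy, hyA, hyB⟩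

theorem compat_nform_iff {X : List (N × HType T)} (hX : (X.map Prod.fst).Nodup)
    {As : List (SeqTerm N (HType T))} {θ : N → Option T}
    (hθ : ∀ p ∈ X, θ p.1 = some p.2.base) : (nform X As).graph.Compat lt ↔
      Hier (optLt lt) θ (EdgeAdj (· ∈ As) (fun A u => u ∈ A.fn) (· ∈ X.map Prod.fst)) := by
  rw [(actUniq_nform hX As).compat_iff (θ := θ) (by
    rw [actRes_nform]; exact fun x τ h => hθ _ h), actSeq_nform]
  simp only [mem_actNames_nform]

/-- The continuation `ν Y. ∏ As`, with its free names mapped by `f`, can be added to a graph. -/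
theorem Hier.graft_nform (hlt : TreeOrder lt) {θ : N → Option T} {adj : N → N → Prop}
    (H : Hier (optLt lt) θ adj) {W : N → Prop} {Y : List (N × HType T)}
    {As : List (SeqTerm N (HType T))} {Δ : Env N T} (f : N → N)
    (hW : ∀ u v, adj u v → W u ∧ W v) (hWY : ∀ v, W v → v ∉ Y.map Prod.fst)
    (hY : (Y.map Prod.fst).Nodup) (hθ : ∀ p ∈ Y, θ p.1 = some p.2.base)
    (hf : ∀ n, f n ∈ Y.map Prod.fst → f n = n) (hf' : ∀ n ∈ Y.map Prod.fst, f n = n)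
    (hc : (nform Y As).graph.Compat lt) (hab : (nform Y As).graph.Above lt Δ)
    (hΔ : ∀ A ∈ As, ∀ n ∈ A.fn, W (f n) → ∃ σ, Δ n = some σ ∧ θ (f n) = some σ.base)
    (hsim : ∀ A ∈ As, ∀ B ∈ As, (nform Y As).Tied A B → ∀ n ∈ A.fn, ∀ n' ∈ B.fn,
      W (f n) → W (f n') → Sim (optLt lt) θ adj (f n) (f n')) :
    Hier (optLt lt) θ fun u v => adj u v ∨
      EdgeAdj (· ∈ As) (fun A v => ∃ n ∈ A.fn, f n = v) (fun v => W v ∨ v ∈ Y.map Prod.fst) u v := by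
  have hmem : ∀ (A : SeqTerm N (HType T)) v, v ∈ Y.map Prod.fst → (∃ n ∈ A.fn, f n = v) →
      v ∈ A.fn := by
    rintro A v hv ⟨n, hn, rfl⟩
    rwa [hf n hv]
  have htied : ∀ {A B}, EdgeTied (· ∈ As) (fun A v => ∃ n ∈ A.fn, f n = v) (· ∈ Y.map Prod.fst) A B →
      (nform Y As).Tied A B := by
    intro A B h
    refine Proc.tied_nform (ReflTransGen.mono (fun A B h => ?_) _ _ h)
    obtain ⟨hA, hB, y, hy, hyA, hyB⟩ := h
    exact ⟨hA, hB, y, hy, hmem A y hy hyA, hmem B y hy hyB⟩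
  refine H.graft hlt.option hW hWY ?_ ?_ ?_
  · refine ((compat_nform_iff hY hθ).1 hc).mono ?_
    rintro u v ⟨hu, hv, A, hA, huA, hvA⟩
    exact ⟨hu, hv, A, hA, hmem A u hu huA, hmem A v hv hvA⟩
  -- The side condition for `ν` bounds the type of `n` in `Δ`, and by `hΔ` the label of the image `f
  -- n` is the base of this type.
  · rintro y A B w hy hA hyA hAB hB ⟨n, hn, rfl⟩ hw
    obtain ⟨σ, hσ, hθσ⟩ := hΔ B hB n hn hw
    obtain ⟨⟨y, τ⟩, hyτ, rfl⟩ := List.mem_map.1 hy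
    rw [hθσ, hθ _ hyτ, optLt_some]
    refine (actUniq_nform hY As).below hab (A := A) (B := B) (by rwa [actSeq_nform]) (htied hAB)
      (by rwa [actRes_nform]) (hmem A y hy hyA) hn (fun hnY => ?_) hσ
    rw [mem_actNames_nform] at hnY
    exact hWY _ hw (by rwa [hf' n hnY])
  · rintro A B w w' hA hB hAB ⟨n, hn, rfl⟩ hw ⟨n', hn', rfl⟩ hw'
    exact hsim A hA B hB (htied hAB) n hn n' hn' hw hw'

/-- The names in `W` that the continuation uses are free in `S`, hence adjacent before the step, and
`Above` puts the new vertices above them. The edge `S` is present during the grafting and is dropped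
by `mono` afterwards. -/
theorem Proc.Inv.tau (hlt : TreeOrder lt) {Γ : Env N T} {W Y : List (N × HType T)}
    {P' C : List (SeqTerm N (HType T))}
    (h : (nform W (.once (.pre .tau (nform Y P')) :: C)).Inv lt Γ)
    (hn : (nform W (.once (.pre .tau (nform Y P')) :: C)).NameUniq) :
    (nform (W ++ Y) (P' ++ C)).Inv lt Γ := by
  set S : SeqTerm N (HType T) := .once (.pre .tau (nform Y P')) with hS
  have hSbn : S.toProc.bn = Y.map Prod.fst ++ P'.flatMap fun A => A.toProc.bn := bn_nform Y P'
  have hSfn : ∀ n, n ∈ S.fn ↔ (∃ A ∈ P', n ∈ A.fn) ∧ n ∉ Y.map Prod.fst := fun n => mem_fn_nform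
  have hbn := bn_nform W (S :: C)
  rw [List.flatMap_cons, hSbn] at hbn
  obtain ⟨hnd, hfb⟩ := hn
  -- A free name of a component is restricted by `W` or free in the whole term. In the first case it
  -- would be bound twice if it were in `Y`, in the second it would be both free and bound.
  have hY : ∀ n, (∃ A ∈ S :: C, n ∈ A.fn) → n ∉ Y.map Prod.fst := by
    intro n hnA hnY
    by_cases hnW : n ∈ W.map Prod.fst
    · rw [hbn] at hnd
      simp only [List.nodup_append, List.mem_append] at hnd
      grind
    · refine hfb n (mem_fn_nform.2 ⟨hnA, hnW⟩) ?_
      rw [hbn]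
      simp only [List.mem_append]
      tauto
  have hWY : ∀ n ∈ W.map Prod.fst, n ∉ Y.map Prod.fst := by
    rw [hbn] at hnd
    simp only [List.nodup_append, List.mem_append] at hnd
    grind
  have hWn : (W.map Prod.fst).Nodup := by
    rw [hbn] at hnd
    exact (List.nodup_append.1 hnd).1
  have hYn : (Y.map Prod.fst).Nodup := by
    rw [hbn] at hnd
    simp only [List.nodup_append] at hnd
    tauto
  have hWYn : ((W ++ Y).map Prod.fst).Nodup := by
    rw [List.map_append, List.nodup_append]
    exact ⟨hWn, hYn, fun a ha b hb hab => hWY a ha (hab ▸ hb)⟩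
  have hfn : ∀ A ∈ P' ++ C, ∀ n ∈ A.fn, n ∉ Y.map Prod.fst → ∃ A ∈ S :: C, n ∈ A.fn := by
    intro A hA n hnA hnY
    rcases List.mem_append.1 hA with hA | hA
    · exact ⟨S, List.mem_cons_self, (hSfn n).2 ⟨⟨A, hA, hnA⟩, hnY⟩⟩
    · exact ⟨A, List.mem_cons_of_mem _ hA, hnA⟩
  have hsat := sat_nform.1 h.sat
  obtain ⟨hSc, hSa, hSs⟩ : (nform Y P').graph.Compat lt ∧ (nform Y P').graph.Above lt (Γ.binds W) ∧
    (nform Y P').Sat lt (Γ.binds W) := hsat S List.mem_cons_self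
  refine ⟨?_, sat_nform.2 fun A hA => ?_, fun n hn t ht => ?_⟩
  · let θ : N → Option T := fun n => (Γ.binds (W ++ Y) n).map HType.base
    have hθ : ∀ p ∈ W ++ Y, θ p.1 = some p.2.base := fun p hp => by
      simp only [θ, Env.binds_of_mem hWYn hp, Option.map_some]
    have H := (compat_nform_iff hWn fun p hp => hθ p (List.mem_append_left _ hp)).1 h.compat
    rw [compat_nform_iff hWYn hθ]
    refine (H.graft_nform hlt (W := (· ∈ W.map Prod.fst)) (Y := Y) (As := P') (Δ := Γ.binds W) id
      (fun u v h => ⟨h.1, h.2.1⟩) hWY hYn (fun p hp => hθ p (List.mem_append_right _ hp))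
      (fun _ _ => rfl) (fun _ _ => rfl) hSc hSa ?_ ?_).mono ?_
    · intro A hA n hn hnW
      obtain ⟨⟨n, σ⟩, hp, rfl⟩ := List.mem_map.1 hnW
      exact ⟨σ, Env.binds_of_mem hWn hp, hθ _ (List.mem_append_left _ hp)⟩
    · intro A hA B hB _ n hn n' hn' hnW hnW'
      exact H.sim ⟨hnW, hnW', S, List.mem_cons_self, (hSfn n).2 ⟨⟨A, hA, hn⟩, hWY n hnW⟩,
        (hSfn n').2 ⟨⟨B, hB, hn'⟩, hWY n' hnW'⟩⟩
    · rintro u v ⟨hu, hv, A, hA, huA, hvA⟩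
      rw [List.map_append, List.mem_append] at hu hv
      rcases List.mem_append.1 hA with hA | hA
      · exact .inr ⟨hu, hv, A, hA, ⟨u, huA, rfl⟩, ⟨v, hvA, rfl⟩⟩
      · have hAm : A ∈ S :: C := List.mem_cons_of_mem _ hA
        exact .inl ⟨hu.resolve_right (hY u ⟨A, hAm, huA⟩), hv.resolve_right (hY v ⟨A, hAm, hvA⟩),
          A, hAm, huA, hvA⟩
  · rw [Env.binds_append]
    rcases List.mem_append.1 hA with hA | hA
    · exact sat_nform.1 hSs A hA
    · refine (hsat A (List.mem_cons_of_mem _ hA)).congr_env fun n hnA => ?_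
      rw [fn_toProc] at hnA
      exact (Env.binds_of_notMem (hY n ⟨A, List.mem_cons_of_mem _ hA, hnA⟩)).symm
  · obtain ⟨⟨A, hA, hnA⟩, hnW⟩ := mem_fn_nform.1 hn
    rw [List.map_append, List.mem_append, not_or] at hnW
    refine h.safe n (mem_fn_nform.2 ⟨hfn A hA n hnA hnW.2, hnW.1⟩) t ?_
    have hSu : (nform Y P').UsedType t → (nform W (S :: C)).UsedType t := fun hu =>
      (usedType_nform hWn).2 (.inr ⟨S, List.mem_cons_self, hu⟩)
    rcases (usedType_nform hWYn).1 ht with ⟨p, hp, ⟨B, hB, hpB⟩, rfl⟩ | ⟨B, hB, hBt⟩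
    · rcases List.mem_append.1 hp with hp | hp
      · exact (usedType_nform hWn).2 (.inl ⟨p, hp,
          hfn B hB _ hpB (hWY _ (List.mem_map_of_mem hp)), rfl⟩)
      · refine hSu ((usedType_nform hYn).2 (.inl ⟨p, hp, ⟨B, ?_, hpB⟩, rfl⟩))
        refine (List.mem_append.1 hB).resolve_right fun hB => ?_
        exact hY _ ⟨B, List.mem_cons_of_mem _ hB, hpB⟩ (List.mem_map_of_mem hp)
    · rcases List.mem_append.1 hB with hB | hB
      · exact hSu ((usedType_nform hYn).2 (.inr ⟨B, hB, hBt⟩))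
      · exact (usedType_nform hWn).2 (.inr ⟨B, List.mem_cons_of_mem _ hB, hBt⟩)

end Reduction

-- Communication, and the invariant along reductions

section Communication

variable {N : Type u} {T : Type w} [DecidableEq N] {lt : T → T → Prop}

/-- The continuations are grafted in turn: that of the sender onto `W`, as for a silent step, and
then that of the receiver, with `b` for `x`, onto `W` and `Ys`. The second grafting needs an
argument only where `b` becomes tied to another name of the receiver. -/
theorem Proc.Inv.sync (hlt : TreeOrder lt) {Γ : Env N T} {W Ys Yr : List (N × HType T)}
    {S R : Choice N (HType T)} {S' R' C : List (SeqTerm N (HType T))} {a b x : N}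
    (h : (nform W (.once S :: .once R :: C)).Inv lt Γ)
    (hn : (nform W (.once S :: .once R :: C)).NameUniq)
    (hS : Choice.Offers (.out a b) (nform Ys S') S)
    (hR : Choice.Offers (.inp a x) (nform Yr R') R) :
    (nform (W ++ Ys ++ Yr) (S' ++ R'.map (SeqTerm.subst x b) ++ C)).Inv lt Γ := by
  set P := nform W (.once S :: .once R :: C) with hP
  -- Names.
  have hSm : SeqTerm.once S ∈ SeqTerm.once S :: .once R :: C := List.mem_cons_self
  have hRm : SeqTerm.once R ∈ SeqTerm.once S :: .once R :: C :=
    List.mem_cons_of_mem _ List.mem_cons_self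
  have hCm : ∀ A ∈ C, A ∈ SeqTerm.once S :: .once R :: C := fun A hA =>
    List.mem_cons_of_mem _ (List.mem_cons_of_mem _ hA)
  have haS : a ∈ S.fn := hS.fn a (Finset.mem_insert_self _ _)
  have hbS : b ∈ S.fn := hS.fn b (Finset.mem_insert_of_mem (Finset.mem_insert_self _ _))
  have haR : a ∈ R.fn := hR.fn a (Finset.mem_insert_self _ _)
  have hfnS : ∀ A ∈ S', ∀ n ∈ A.fn, n ∉ Ys.map Prod.fst → n ∈ S.fn := fun A hA n hnA hnY =>
    hS.fn n (Finset.mem_insert_of_mem (Finset.mem_insert_of_mem (mem_fn_nform.2 ⟨⟨A, hA, hnA⟩, hnY⟩)))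
  have hfnR : ∀ A ∈ R', ∀ n ∈ A.fn, n ∉ Yr.map Prod.fst → n ≠ x → n ∈ R.fn :=
    fun A hA n hnA hnY hnx => hR.fn n (Finset.mem_insert_of_mem (Finset.mem_erase.2
      ⟨hnx, mem_fn_nform.2 ⟨⟨A, hA, hnA⟩, hnY⟩⟩))
  obtain ⟨hnd, hfb⟩ := hn
  obtain ⟨s2, hs2⟩ := hS.bn
  obtain ⟨r2, hr2⟩ := hR.bn
  have hbn : P.bn = W.map Prod.fst ++ (((Ys.map Prod.fst ++ S'.flatMap fun A => A.toProc.bn) ++ s2) ++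
      ((x :: (Yr.map Prod.fst ++ R'.flatMap fun A => A.toProc.bn) ++ r2) ++
        C.flatMap fun A => A.toProc.bn)) := by
    rw [hP, bn_nform, List.flatMap_cons, List.flatMap_cons, ← bn_nform Ys S', ← bn_nform Yr R']
    exact congrArg₂ _ rfl (congrArg₂ _ hs2 (congrArg₂ _ hr2 rfl))
  have hbnd : ∀ n, (n ∈ Ys.map Prod.fst ∨ n = x ∨ n ∈ Yr.map Prod.fst ∨
      n ∈ R'.flatMap fun A => A.toProc.bn) → n ∈ P.bn ∧ n ∉ W.map Prod.fst := by
    rw [hbn] at hnd ⊢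
    simp only [List.nodup_append, List.nodup_cons, List.mem_append, List.mem_cons,
      List.cons_append] at hnd ⊢
    grind
  have hfree : ∀ n, (∃ A ∈ SeqTerm.once S :: .once R :: C, n ∈ A.fn) →
      n ∉ Ys.map Prod.fst ∧ n ≠ x ∧ n ∉ Yr.map Prod.fst ∧
        n ∉ R'.flatMap fun A => A.toProc.bn := by
    intro n hnA
    by_cases hnW : n ∈ W.map Prod.fst
    · have := fun h => (hbnd n h).2 hnW
      tauto
    · have := fun h => hfb n (mem_fn_nform.2 ⟨hnA, hnW⟩) (hbnd n h).1
      tauto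
  have hfreeS : ∀ n ∈ S.fn, _ := fun n hn => hfree n ⟨_, hSm, hn⟩
  have hfreeR : ∀ n ∈ R.fn, _ := fun n hn => hfree n ⟨_, hRm, hn⟩
  obtain ⟨hWn, hYsn, hYrn, hYsr, hYsx, hxr, hxR⟩ : (W.map Prod.fst).Nodup ∧
      (Ys.map Prod.fst).Nodup ∧ (Yr.map Prod.fst).Nodup ∧
      (∀ n ∈ Ys.map Prod.fst, n ∉ Yr.map Prod.fst) ∧ (∀ n ∈ Ys.map Prod.fst, n ≠ x) ∧
      x ∉ Yr.map Prod.fst ∧ x ∉ R'.flatMap fun A => A.toProc.bn := by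
    rw [hbn] at hnd
    simp only [List.nodup_append, List.nodup_cons, List.mem_append, List.mem_cons,
      List.cons_append] at hnd
    grind
  have hWYs : ∀ n ∈ W.map Prod.fst, n ∉ Ys.map Prod.fst := fun n hn h => (hbnd n (.inl h)).2 hn
  have hWx : x ∉ W.map Prod.fst := (hbnd x (.inr (.inl rfl))).2
  have hWYr : ∀ n ∈ W.map Prod.fst, n ∉ Yr.map Prod.fst := fun n hn h =>
    (hbnd n (.inr (.inr (.inl h)))).2 hn
  have hWYn : ((W ++ Ys ++ Yr).map Prod.fst).Nodup := by
    rw [List.map_append, List.map_append, List.nodup_append, List.nodup_append]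
    refine ⟨⟨hWn, hYsn, fun n hn m hm hnm => hWYs n hn (hnm ▸ hm)⟩, hYrn, fun n hn m hm hnm => ?_⟩
    rcases List.mem_append.1 hn with hn | hn
    · exact hWYr n hn (hnm ▸ hm)
    · exact hYsr n hn (hnm ▸ hm)
  have hmem : ∀ n, n ∈ (W ++ Ys ++ Yr).map Prod.fst ↔
      (n ∈ W.map Prod.fst ∨ n ∈ Ys.map Prod.fst) ∨ n ∈ Yr.map Prod.fst := fun n => by
    rw [List.map_append, List.map_append, List.mem_append, List.mem_append]
  have hxA : ∀ A ∈ R', x ∉ A.toProc.bn := fun A hA hx => hxR (List.mem_flatMap.2 ⟨A, hA, hx⟩)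
  have hbA : ∀ A ∈ R', b ∉ A.toProc.bn := fun A hA hb =>
    (hfreeS b hbS).2.2.2 (List.mem_flatMap.2 ⟨A, hA, hb⟩)
  have hfnC : ∀ A ∈ S' ++ R'.map (SeqTerm.subst x b) ++ C, ∀ n ∈ A.fn, n ∉ Ys.map Prod.fst →
      n ∉ Yr.map Prod.fst → ∃ A ∈ SeqTerm.once S :: .once R :: C, n ∈ A.fn := by
    intro A hA n hnA hns hnr
    rcases List.mem_append.1 hA with hA | hA
    · rcases List.mem_append.1 hA with hA | hA
      · exact ⟨_, hSm, hfnS A hA n hnA hns⟩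
      · obtain ⟨A, hA', rfl⟩ := List.mem_map.1 hA
        obtain ⟨m, hm, rfl⟩ := (mem_fn_subst (hxA A hA') (hbA A hA')).1 hnA
        by_cases hmx : m = x
        · rw [hmx, substName_self]
          exact ⟨_, hSm, hbS⟩
        · rw [substName_of_ne hmx] at hnr ⊢
          exact ⟨_, hRm, hfnR A hA' m hm hnr hmx⟩
    · exact ⟨A, hCm A hA, hnA⟩
  -- Typing.
  have hsat := sat_nform.1 h.sat
  obtain ⟨⟨t, τ, hat, hbt⟩, hSc, hSa, hSs⟩ := hS.sat (hsat _ hSm)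
  obtain ⟨t', τ', hat', hRc, hRa, hRs, hRm'⟩ := hR.sat (hsat _ hRm)
  -- Both partners find the same type for `a` in the environment, so `x` is assumed to have the type
  -- `τ` of `b`.
  rw [hat, Option.some.injEq, HType.chan.injEq] at hat'
  obtain ⟨rfl, rfl⟩ := hat'
  have hWbind : ∀ p ∈ W, Γ.binds W p.1 = some p.2 := fun p hp => Env.binds_of_mem hWn hp
  refine ⟨?_, sat_nform.2 fun A hA => ?_, fun n hn t ht => ?_⟩
  · let θ : N → Option T := fun n => (Γ.binds (W ++ Ys ++ Yr) n).map HType.base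
    have hθ : ∀ p ∈ W ++ Ys ++ Yr, θ p.1 = some p.2.base := fun p hp => by
      simp only [θ, Env.binds_of_mem hWYn hp, Option.map_some]
    have hθW : ∀ p ∈ W, θ p.1 = some p.2.base := fun p hp =>
      hθ p (List.mem_append_left _ (List.mem_append_left _ hp))
    have hθW' : ∀ n ∈ W.map Prod.fst, ∃ σ, Γ.binds W n = some σ ∧ θ n = some σ.base ∧
        (n, σ) ∈ W := by
      intro n hn
      obtain ⟨⟨n, σ⟩, hp, rfl⟩ := List.mem_map.1 hn
      exact ⟨σ, hWbind _ hp, hθW _ hp, hp⟩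
    have H := (compat_nform_iff hWn hθW).1 h.compat
    have H1 := H.graft_nform hlt (W := (· ∈ W.map Prod.fst)) (Y := Ys) (As := S')
      (Δ := Γ.binds W) id
      (fun u v h => ⟨h.1, h.2.1⟩) hWYs hYsn
      (fun p hp => hθ p (List.mem_append_left _ (List.mem_append_right _ hp)))
      (fun _ _ => rfl) (fun _ _ => rfl) hSc hSa
      (fun A hA n hn hnW => (hθW' n hnW).imp fun σ hσ => ⟨hσ.1, hσ.2.1⟩)
      (fun A hA B hB _ n hn n' hn' hnW hnW' => H.sim ⟨hnW, hnW', _, hSm,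
        hfnS A hA n hn (hWYs n hnW), hfnS B hB n' hn' (hWYs n' hnW')⟩)
    -- The received name is linked to names of the receiver only via the channel.
    have hvia : b ∈ W.map Prod.fst → ∀ A ∈ R', ∀ B ∈ R', (nform Yr R').Tied A B → x ∈ A.fn →
        ∀ n ∈ B.fn, n ∈ W.map Prod.fst →
          n = a ∨ (a ∈ W.map Prod.fst ∧ (optLt lt (θ b) (θ a) ∨ optLt lt (θ n) (θ a))) := by
      intro hbW A hA B hB hAB hxA n hnB hnW
      obtain ⟨σb, hσb, hθb, hbp⟩ := hθW' b hbW
      obtain ⟨σn, hσn, hθn, hnp⟩ := hθW' n hnW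
      obtain rfl : σb = τ := Option.some.inj (hσb.symm.trans hbt)
      have hnx : n ≠ x := fun h => hWx (h ▸ hnW)
      have hnR : n ∈ R.fn := hfnR B hB n hnB (hWYr n hnW) hnx
      -- These are the alternatives of the input rule. Either the values sent on `a` have a base
      -- type below `t`, or `B`, which is migratable because it is tied to `A` and hence to `x`, has
      -- only names below `t` apart from `a`.
      have hlow : lt σb.base t ∨ n = a ∨ lt σn.base t := by
        refine hRm'.imp_right fun hm => or_iff_not_imp_left.2 fun hna => ?_
        exact (actUniq_nform hYrn R').migr_below hm (by rwa [actSeq_nform]) hAB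
          (by rwa [mem_actNames_nform]) hxA hnB (by rw [mem_actNames_nform]; exact hWYr n hnW)
          hnx hna hσn
      by_cases haW : a ∈ W.map Prod.fst
      · obtain ⟨σa, hσa, hθa, -⟩ := hθW' a haW
        obtain rfl := Option.some.inj (hσa.symm.trans hat)
        rw [hθa, hθb, hθn, optLt_some, optLt_some]
        exact hlow.elim (fun h => .inr ⟨haW, .inl h⟩) (Or.imp_right fun h => ⟨haW, .inr h⟩)
      -- If `a` is not restricted, it is free in the whole term and safety puts `t` below the
      -- restrictions of `b` and `n`, which are used. So neither of them can be below `t`.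
      · rw [Env.binds_of_notMem haW] at hat
        have hsafe : ∀ p ∈ W, (∃ A ∈ SeqTerm.once S :: .once R :: C, p.1 ∈ A.fn) → lt t p.2.base :=
          fun p hp hpA => h.safe a (mem_fn_nform.2 ⟨⟨_, hSm, haS⟩, haW⟩) _
            ((usedType_nform hWn).2 (.inl ⟨p, hp, hpA, rfl⟩)) _ hat
        rcases hlow with hlow | rfl | hlow
        · exact (hlt.irrefl _ (hlt.trans (hsafe _ hbp ⟨_, hSm, hbS⟩) hlow)).elim
        · exact .inl rfl
        · exact (hlt.irrefl _ (hlt.trans (hsafe _ hnp ⟨_, hRm, hnR⟩) hlow)).elim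
    have hWs : ∀ n, (n ∈ W.map Prod.fst ∨ n ∈ Ys.map Prod.fst) → n ∉ Yr.map Prod.fst :=
      fun n hn => hn.elim (hWYr n) (hYsr n)
    have hnotYr : ∀ n ∈ Yr.map Prod.fst, n ≠ x := fun n hn h => hxr (h ▸ hn)
    -- The names in `Ys` are not known to the receiver, so its own context names lie in `W`. So does
    -- `b` if it is a context name, since it is free in `S`.
    have hR'W : ∀ A ∈ R', ∀ n ∈ A.fn, n ≠ x →
        (n ∈ W.map Prod.fst ∨ n ∈ Ys.map Prod.fst) → n ∈ W.map Prod.fst ∧ n ∈ R.fn := by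
      intro A hA n hn hnx hnW
      have hnR := hfnR A hA n hn (hWs n hnW) hnx
      exact ⟨hnW.resolve_right (hfreeR n hnR).1, hnR⟩
    have hbW : (b ∈ W.map Prod.fst ∨ b ∈ Ys.map Prod.fst) → b ∈ W.map Prod.fst :=
      fun h => h.resolve_right (hfreeS b hbS).1
    rw [compat_nform_iff hWYn hθ]
    refine (H1.graft_nform hlt (W := fun v => v ∈ W.map Prod.fst ∨ v ∈ Ys.map Prod.fst)
      (Y := Yr) (As := R') (Δ := (Γ.binds W).bind x τ) (substName x b) ?_ hWs hYrn
      (fun p hp => hθ p (List.mem_append_right _ hp)) ?_ ?_ hRc hRa ?_ ?_).mono ?_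
    · rintro u v (h | h)
      · exact ⟨.inl h.1, .inl h.2.1⟩
      · exact ⟨h.1, h.2.1⟩
    · intro n hn
      by_cases hnx : n = x
      · rw [hnx, substName_self] at hn
        exact absurd hn (hfreeS b hbS).2.2.1
      · exact substName_of_ne hnx
    · exact fun n hn => substName_of_ne (hnotYr n hn)
    · intro A hA n hnA hnW
      by_cases hnx : n = x
      · rw [hnx, substName_self] at hnW ⊢
        obtain ⟨σ, hσ, hθσ, -⟩ := hθW' b (hbW hnW)
        obtain rfl := Option.some.inj (hσ.symm.trans hbt)
        exact ⟨σ, by rw [Env.bind, Function.update_self], hθσ⟩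
      · rw [substName_of_ne hnx] at hnW ⊢
        obtain ⟨σ, hσ, hθσ, -⟩ := hθW' n (hR'W A hA n hnA hnx hnW).1
        exact ⟨σ, by rw [Env.bind, Function.update_of_ne hnx, hσ], hθσ⟩
    -- The cases are whether the two context names are the received one. If neither is, they share
    -- `R`. If one is, `hvia` either identifies the other with `a`, which shares `S` with `b`, or
    -- justifies the detour through `a`.
    · intro A hA B hB hAB n hn n' hn' hnW hnW'
      by_cases hnx : n = x <;> by_cases hnx' : n' = x
      · rw [hnx, substName_self] at hnW ⊢
        rw [hnx', substName_self]
        exact H1.sim (.inl ⟨hbW hnW, hbW hnW, _, hSm, hbS, hbS⟩)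
      · rw [hnx, substName_self] at hnW ⊢
        rw [substName_of_ne hnx'] at hnW' ⊢
        obtain ⟨hn1, hn2⟩ := hR'W B hB n' hn' hnx' hnW'
        rcases hvia (hbW hnW) A hA B hB hAB (hnx ▸ hn) n' hn' hn1 with rfl | ⟨haW, hlt'⟩
        · exact H1.sim (.inl ⟨hbW hnW, hn1, _, hSm, hbS, haS⟩)
        · exact H1.sim_via hlt.option (a := a) (.inl ⟨hbW hnW, haW, _, hSm, hbS, haS⟩)
            (.inl ⟨haW, hn1, _, hRm, haR, hn2⟩) hlt'
      · rw [substName_of_ne hnx] at hnW ⊢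
        rw [hnx', substName_self] at hnW' ⊢
        obtain ⟨hn1, hn2⟩ := hR'W A hA n hn hnx hnW
        have hBA : (nform Yr R').Tied B A := EdgeTied.symm hAB
        rcases hvia (hbW hnW') B hB A hA hBA (hnx' ▸ hn') n hn hn1 with rfl | ⟨haW, hlt'⟩
        · exact H1.sim (.inl ⟨hn1, hbW hnW', _, hSm, haS, hbS⟩)
        · exact H1.sim_via hlt.option (a := a) (.inl ⟨hn1, haW, _, hRm, hn2, haR⟩)
            (.inl ⟨haW, hbW hnW', _, hSm, haS, hbS⟩) hlt'.symm
      · rw [substName_of_ne hnx] at hnW ⊢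
        rw [substName_of_ne hnx'] at hnW' ⊢
        obtain ⟨hn1, hn2⟩ := hR'W A hA n hn hnx hnW
        obtain ⟨hn1', hn2'⟩ := hR'W B hB n' hn' hnx' hnW'
        exact H1.sim (.inl ⟨hn1, hn1', _, hRm, hn2, hn2'⟩)
    · rintro u v ⟨hu, hv, A, hA, huA, hvA⟩
      rw [hmem] at hu hv
      rcases List.mem_append.1 hA with hA | hA
      · rcases List.mem_append.1 hA with hA | hA
        · have hnr : ∀ n ∈ A.fn, n ∉ Yr.map Prod.fst := fun n hn hnr =>
            (hfreeS n (hfnS A hA n hn fun h => hYsr n h hnr)).2.2.1 hnr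
          exact .inl (.inr ⟨hu.resolve_right (hnr u huA), hv.resolve_right (hnr v hvA), A, hA,
            ⟨u, huA, rfl⟩, ⟨v, hvA, rfl⟩⟩)
        · obtain ⟨A, hA', rfl⟩ := List.mem_map.1 hA
          exact .inr ⟨hu, hv, A, hA', (mem_fn_subst (hxA A hA') (hbA A hA')).1 huA,
            (mem_fn_subst (hxA A hA') (hbA A hA')).1 hvA⟩
      · have hW : ∀ n ∈ A.fn, _ → n ∈ W.map Prod.fst := fun n hn h =>
          have := hfree n ⟨A, hCm A hA, hn⟩
          ((h : (_ ∨ _) ∨ _).resolve_right this.2.2.1).resolve_right this.1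
        exact .inl (.inl ⟨hW u huA hu, hW v hvA hv, A, hCm A hA, huA, hvA⟩)
  · rw [Env.binds_append, Env.binds_append]
    have hout : ∀ n ∈ S.fn, ((Γ.binds W).binds Ys).binds Yr n = Γ.binds W n := fun n hn => by
      rw [Env.binds_of_notMem (hfreeS n hn).2.2.1, Env.binds_of_notMem (hfreeS n hn).1]
    rcases List.mem_append.1 hA with hA | hA
    · rcases List.mem_append.1 hA with hA | hA
      · refine (sat_nform.1 hSs A hA).congr_env fun n hnA => ?_
        rw [fn_toProc] at hnA
        refine (Env.binds_of_notMem fun hnr => ?_).symm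
        exact (hfreeS n (hfnS A hA n hnA fun h => hYsr n h hnr)).2.2.1 hnr
      · obtain ⟨A, hA', rfl⟩ := List.mem_map.1 hA
        rw [toProc_subst (hxA A hA')]
        refine (sat_nform.1 hRs A hA').rename (noCapture_substName (hxA A hA') (hbA A hA'))
          fun n hnA => ?_
        rw [fn_toProc] at hnA
        by_cases hnx : n = x
        · rw [hnx, substName_self, hout b hbS, hbt, Env.binds_of_notMem hxr, Env.bind,
            Function.update_self]
        · rw [substName_of_ne hnx]
          by_cases hnr : n ∈ Yr.map Prod.fst
          · obtain ⟨⟨n, σ⟩, hp, rfl⟩ := List.mem_map.1 hnr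
            rw [Env.binds_of_mem hYrn hp, Env.binds_of_mem hYrn hp]
          · rw [Env.binds_of_notMem hnr, Env.binds_of_notMem hnr, Env.bind,
              Function.update_of_ne hnx,
              Env.binds_of_notMem (hfreeR n (hfnR A hA' n hnA hnr hnx)).1]
    · refine (hsat A (hCm A hA)).congr_env fun n hnA => ?_
      rw [fn_toProc] at hnA
      have hnf := hfree n ⟨A, hCm A hA, hnA⟩
      rw [Env.binds_of_notMem hnf.2.2.1, Env.binds_of_notMem hnf.1]
  · obtain ⟨⟨A, hA, hnA⟩, hnW⟩ := mem_fn_nform.1 hn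
    rw [hmem, not_or, not_or] at hnW
    refine h.safe n (mem_fn_nform.2 ⟨hfnC A hA n hnA hnW.1.2 hnW.2, hnW.1.1⟩) t ?_
    have hSu : (nform Ys S').UsedType t → P.UsedType t := fun hu =>
      (usedType_nform hWn).2 (.inr ⟨_, hSm, hS.usedType hu⟩)
    have hRu : (nform Yr R').UsedType t → P.UsedType t := fun hu =>
      (usedType_nform hWn).2 (.inr ⟨_, hRm, hR.usedType hu⟩)
    rcases (usedType_nform hWYn).1 ht with ⟨p, hp, ⟨B, hB, hpB⟩, rfl⟩ | ⟨B, hB, hBt⟩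
    · rcases List.mem_append.1 hp with hp | hp
      · rcases List.mem_append.1 hp with hp | hp
        · have hpW := List.mem_map_of_mem (f := Prod.fst) hp
          exact (usedType_nform hWn).2 (.inl ⟨p, hp,
            hfnC B hB _ hpB (hWYs _ hpW) (hWYr _ hpW), rfl⟩)
        · have hpY := List.mem_map_of_mem (f := Prod.fst) hp
          refine hSu ((usedType_nform hYsn).2 (.inl ⟨p, hp, ⟨B, ?_, hpB⟩, rfl⟩))
          -- A restriction in `Ys` is known neither to the receiver nor to `C`, so it is used in
          -- `S'` and was used before the step.
          rcases List.mem_append.1 hB with hB | hB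
          · refine (List.mem_append.1 hB).resolve_right fun hB => ?_
            obtain ⟨A, hA', rfl⟩ := List.mem_map.1 hB
            obtain ⟨m, hm, hmp⟩ := (mem_fn_subst (hxA A hA') (hbA A hA')).1 hpB
            rw [← hmp] at hpY
            by_cases hmx : m = x
            · rw [hmx, substName_self] at hpY
              exact (hfreeS b hbS).1 hpY
            · rw [substName_of_ne hmx] at hpY
              exact (hfreeR m (hfnR A hA' m hm (hYsr m hpY) hmx)).1 hpY
          · exact absurd hpY (hfree _ ⟨B, hCm B hB, hpB⟩).1
      · have hpY := List.mem_map_of_mem (f := Prod.fst) hp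
        refine hRu ((usedType_nform hYrn).2 (.inl ⟨p, hp, ?_, rfl⟩))
        rcases List.mem_append.1 hB with hB | hB
        · rcases List.mem_append.1 hB with hB | hB
          · exact absurd hpY (hfreeS _ (hfnS B hB _ hpB fun h => hYsr _ h hpY)).2.2.1
          · obtain ⟨A, hA', rfl⟩ := List.mem_map.1 hB
            obtain ⟨m, hm, hmp⟩ := (mem_fn_subst (hxA A hA') (hbA A hA')).1 hpB
            refine ⟨A, hA', ?_⟩
            by_cases hmx : m = x
            · rw [hmx, substName_self] at hmp
              exact absurd (hmp ▸ hpY) (hfreeS b hbS).2.2.1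
            · rw [substName_of_ne hmx] at hmp
              exact hmp ▸ hm
        · exact absurd hpY (hfree _ ⟨B, hCm B hB, hpB⟩).2.2.1
    · rcases List.mem_append.1 hB with hB | hB
      · rcases List.mem_append.1 hB with hB | hB
        · exact hSu ((usedType_nform hYsn).2 (.inr ⟨B, hB, hBt⟩))
        · obtain ⟨A, hA', rfl⟩ := List.mem_map.1 hB
          rw [toProc_subst (hxA A hA'),
            Proc.usedType_rename (noCapture_substName (hxA A hA') (hbA A hA'))] at hBt
          exact hRu ((usedType_nform hYrn).2 (.inr ⟨A, hA', hBt⟩))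
      · exact (usedType_nform hWn).2 (.inr ⟨B, hCm B hB, hBt⟩)

theorem Proc.Inv.step (hlt : TreeOrder lt) {Γ : Env N T} {P Q : Proc N (HType T)}
    (h : P.Inv lt Γ) (hPQ : P.Step Q) : Q.Inv lt Γ := by
  cases hPQ with
  | sync W Ys Yr S R S' R' C a b x hP hnf hS hR hQ =>
    exact ((h.of_cong hP).sync hlt hnf.2 hS hR).of_cong hQ.symm
  | tau W Y P' C hP hnf hQ => exact ((h.of_cong hP).tau hlt hnf.2).of_cong hQ.symm

theorem Proc.Inv.reach (hlt : TreeOrder lt) {Γ : Env N T} {P Q : Proc N (HType T)}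
    (h : P.Inv lt Γ) (hPQ : P.Reach Q) : Q.Inv lt Γ := by
  induction hPQ with
  | refl => exact h
  | tail _ hs ih => exact ih.step hlt hs

end Communication

end HierPi

/-- Invariance of `T`-shapedness under reduction, and hence along all reductions. -/
theorem mainTheorem1 {N : Type*} [DecidableEq N] [Infinite N] {T : Type*} [Finite T]
    (parent : T → T → Prop) (hT : HierPi.IsForest parent)
    (P : HierPi.Proc N (HierPi.HType T)) (hP : P.IsNF)
    (Γ : HierPi.Env N T) (hsafe : Γ.Safe (Relation.TransGen parent) P)
    (htyped : HierPi.Typed (Relation.TransGen parent) Γ P)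
    (hshape : P.TShaped HierPi.HType.base (Relation.TransGen parent)) :
    (∀ Q : HierPi.Proc N (HierPi.HType T), Q.IsNF → P.Step Q →
      Q.TShaped HierPi.HType.base (Relation.TransGen parent)) ∧
    (∀ Q : HierPi.Proc N (HierPi.HType T), P.Reach Q →
      Q.TShaped HierPi.HType.base (Relation.TransGen parent)) := by
  have hlt := hT.treeOrder
  have h := HierPi.Proc.inv_of_typed hlt hP.2 hsafe htyped hshape
  exact ⟨fun Q _ hQ => (h.step hlt hQ).tShaped hlt, fun Q hQ => (h.reach hlt hQ).tShaped hlt⟩
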